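/- Let $B>0$. Write $(a)_j=a(a+1)\cdots(a+j-1)$, and for $t>0$ let $$e^{\gamma}_{\alpha,\beta}(\lambda;t)=t^{\beta-1}\sum_{j\ge 0}\frac{(\gamma)_j(-\lambda t^{\alpha})^j}{j!\,\Gamma(\beta+\alpha j)},\qquad \epsilon^{\gamma}_{\alpha,\beta,p}(\lambda;t)=\int_0^\infty u^{\beta}\,e^{\gamma}_{\alpha,u+p+1}(\lambda;t)\,du ,$$ where $1/\Gamma=0$ at the poles of $\Gamma$. For $\alpha,\gamma\in(0,1)$ and $\lambda>0$ put $$k_1(t)=\int_0^1\frac{t^{-\mu}}{\Gamma(1-\mu)}\,d\mu,\qquad k_2(t)=k_2(\alpha,\gamma;\lambda;t)=\int_0^1 e^{-\gamma}_{\alpha,1-\mu}(\lambda;t)\,d\mu .$$ Let $\hat f(s)=\int_0^\infty e^{-st}f(t)\,dt$, $b_r=(r+1)/2$ and, for $r\ge 0$, $x\in\mathbb R$, $t>0$, $$p_1(r;x,t)=\frac{1}{2\sqrt B}\Big(\frac{-|x|}{\sqrt B}\Big)^{r}\frac{1}{r!\,\Gamma(b_r)}\;\epsilon^{-b_r}_{1,\,b_r-1,\,-b_r}(-1;t).$$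 Then for $i=1,2$ there is a function $p_i(x,t)$, continuous on $\mathbb R\times(0,\infty)$ and integrable in $x$ for every $t>0$, such that: (a) $p_i$ is a fundamental solution of the generalized Fokker–Planck equation $$\int_0^t k_i(t-\xi)\,\partial_\xi p_i(x,\xi)\,d\xi=B\,\partial_x^2p_i(x,t),\qquad p_i(x,0)=\delta(x),$$ in the sense of distributions in $x$: for every $\varphi\in C_c^\infty(\mathbb R)$ the function $P(t)=\int_{\mathbb R} p_i(x,t)\varphi(x)\,dx$ is differentiable on $(0,\infty)$, $P(t)\to\varphi(0)$ as $t\to0^+$, and for every $t>0$ the function $\xi\mapsto k_i(t-\xi)P'(\xi)$ is integrable on $(0,t)$ with $\int_0^t k_i(t-\xi)P'(\xi)\,d\xi=B\int_{\mathbb R} p_i(x,t)\varphi''(x)\,dx$. (b) For every $x\in\mathbb R$, $p_i(x,\cdot)$ is the inverse Laplace transform given by $$\hat p_i(x,s)=\frac1{2s}\sqrt{\frac{s\hat k_i(s)}{B}}\;e^{-|x|\sqrt{s\hat k_i(s)/B}},$$ where the Laplace integrals of $k_i$ and of $p_i(x,\cdot)$ converge absolutely and the identity holds for all real $s>s_0$,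 with some $s_0\ge0$ independent of $x$. (c) For all $x\in\mathbb R$ and $t>0$, with absolutely convergent series, $$p_1(x,t)=\sum_{r=0}^\infty p_1(r;x,t),\qquad p_2(x,t)=\sum_{r=0}^\infty\Big(p_1(r;x,\cdot)\star e^{-\gamma b_r}_{\alpha,0}(\lambda;\cdot)\Big)(t).$$ Here $\star$ is convolution in time of distributions supported on $[0,\infty)$, $\langle T\star S,\varphi\rangle=\langle T(t),\langle S(\xi),\varphi(t+\xi)\rangle\rangle$. In it, $p_1(r;x,\cdot)$ and $e^{-\gamma b_r}_{\alpha,0}(\lambda;\cdot)$ are read as distributions by reading each power $t^{a-1}/\Gamma(a)$ in their definitions as the distribution $\frac{d^n}{dt^n}\big[t_+^{a+n-1}/\Gamma(a+n)\big]$, $n\in\mathbb N_0$, $a+n>0$ (which does not depend on $n$, and is $\delta$ for $a=0$). Each of these convolutions coincides on $(0,\infty)$ with a continuous function of $t$, whose value at $t$ is meant in the series. -/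

import Mathlib

open Set MeasureTheory Filter Topology
open scoped ContDiff

noncomputable section

namespace DistributedOrder

/-- Pochhammer symbol `(a)_j = a (a + 1) ⋯ (a + j - 1)`. -/
def poch (a : ℝ) (j : ℕ) : ℝ := (ascPochhammer ℝ j).eval a

/-- The Prabhakar function
`e^γ_{α,β}(lam; t) = t^(β-1) ∑_j (γ)_j (-lam t^α)^j / (j! Γ(β + α j))`, for `t > 0`.
(`Real.Gamma` vanishes at the poles of `Γ`, so the quotient is `0` there, as it should be.) -/
def prabhakar (γ α β lam t : ℝ) : ℝ :=
  t ^ (β - 1) * ∑' j : ℕ, poch γ j * (-lam * t ^ α) ^ j / (j.factorial * Real.Gamma (β + α * j))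

/-- The generalized Volterra–Prabhakar function
`ε^γ_{α,β,p}(lam; t) = ∫_0^∞ u^β e^γ_{α,u+p+1}(lam; t) du`, for `t > 0`. -/
def volterraPrabhakar (γ α β p lam t : ℝ) : ℝ :=
  ∫ u in Ioi (0 : ℝ), u ^ β * prabhakar γ α (u + p + 1) lam t

/-- The distributed-order kernel `k₁(t) = ∫_0^1 t^(-μ) / Γ(1-μ) dμ`. -/
def k₁ (t : ℝ) : ℝ := ∫ μ in (0 : ℝ)..1, t ^ (-μ) / Real.Gamma (1 - μ)

/-- The distributed-order Prabhakar kernel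
`k₂(α, γ; lam; t) = ∫_0^1 e^{-γ}_{α,1-μ}(lam; t) dμ`. -/
def k₂ (α γ lam t : ℝ) : ℝ := ∫ μ in (0 : ℝ)..1, prabhakar (-γ) α (1 - μ) lam t

/-- The Laplace transform `∫_0^∞ e^(-s t) f(t) dt`. -/
def laplace (f : ℝ → ℝ) (s : ℝ) : ℝ := ∫ t in Ioi (0 : ℝ), Real.exp (-s * t) * f t

/-- `φ` is a test function on the real line. -/
def IsTest (φ : ℝ → ℝ) : Prop := ContDiff ℝ ∞ φ ∧ HasCompactSupport φ

/-- `p(x, t)`, for `x ∈ ℝ` and `t > 0`, is a fundamental solution of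
`∫_0^t k(t-ξ) ∂_ξ p(x,ξ) dξ = B ∂_x² p(x,t)`, `p(x,0) = δ(x)`:
the initial condition and the equation hold in the sense of distributions in `x`. -/
structure IsFundamentalSolution (k : ℝ → ℝ) (B : ℝ) (p : ℝ → ℝ → ℝ) : Prop where
  continuousOn : ContinuousOn (fun z : ℝ × ℝ => p z.1 z.2) (univ ×ˢ Ioi 0)
  integrable : ∀ t > 0, Integrable (fun x => p x t)
  initial : ∀ φ, IsTest φ → Tendsto (fun t => ∫ x, p x t * φ x) (𝓝[>] 0) (𝓝 (φ 0))
  differentiable : ∀ φ, IsTest φ → ∀ t > 0, DifferentiableAt ℝ (fun τ => ∫ x, p x τ * φ x) t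
  convIntegrable : ∀ φ, IsTest φ → ∀ t > 0,
    IntervalIntegrable (fun ξ => k (t - ξ) * deriv (fun τ => ∫ x, p x τ * φ x) ξ) volume 0 t
  equation : ∀ φ, IsTest φ → ∀ t > 0,
    ∫ ξ in (0 : ℝ)..t, k (t - ξ) * deriv (fun τ => ∫ x, p x τ * φ x) ξ
      = B * ∫ x, p x t * iteratedDeriv 2 φ x

/-- For every real `x`, the function `p(x, ·)` is an inverse Laplace transform of
`(2s)⁻¹ √(s k̂(s) / B) exp(-|x| √(s k̂(s) / B))`, where `k̂` is the Laplace transform of `k`;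
the Laplace integrals converge absolutely for all large `s`. -/
def IsInverseLaplace (k : ℝ → ℝ) (B : ℝ) (p : ℝ → ℝ → ℝ) : Prop :=
  ∃ s₀ : ℝ, 0 ≤ s₀ ∧ ∀ s > s₀,
    IntegrableOn (fun t => Real.exp (-s * t) * k t) (Ioi 0) ∧
    ∀ x : ℝ, IntegrableOn (fun t => Real.exp (-s * t) * p x t) (Ioi 0) ∧
      laplace (p x) s
        = 1 / (2 * s) * √(s * laplace k s / B) * Real.exp (-|x| * √(s * laplace k s / B))

/-- `b_r = (r + 1) / 2`. -/
def bExp (r : ℕ) : ℝ := (r + 1) / 2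

/-- `(2√B)⁻¹ (-|x|/√B)^r / (r! Γ(b_r))`. -/
def coeff (B : ℝ) (r : ℕ) (x : ℝ) : ℝ :=
  1 / (2 * √B) * (-|x| / √B) ^ r * (1 / (r.factorial * Real.Gamma (bExp r)))

/-- The function `p₁(r; x, t)`, for `t > 0`. -/
def p₁term (B : ℝ) (r : ℕ) (x t : ℝ) : ℝ :=
  coeff B r x * volterraPrabhakar (-bExp r) 1 (bExp r - 1) (-bExp r) (-1) t

/-! ### Generalized functions of time supported on `[0, ∞)`

They are given by their pairings with smooth functions whose support is bounded above. -/

/-- The pairing of the generalized function `t_+^(a-1) / Γ(a)`, for real `a`, with `φ`: it is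
the `n`-th distributional derivative of the locally integrable function
`t_+^(a+n-1) / Γ(a+n)`, for the least natural number `n` with `a + n > 0`
(any larger `n` gives the same value; for `a = 0` this is `δ`). -/
def powerDist (a : ℝ) (φ : ℝ → ℝ) : ℝ :=
  (-1) ^ ⌊1 - a⌋₊ * ∫ t in Ioi (0 : ℝ),
    t ^ (a + ⌊1 - a⌋₊ - 1) / Real.Gamma (a + ⌊1 - a⌋₊) * iteratedDeriv ⌊1 - a⌋₊ φ t

/-- The Prabhakar function `e^γ_{α,β}(lam; ·)` as a generalized function: the powers
`t^(β+αj-1) / Γ(β+αj)` in its series are read as generalized functions. -/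
def prabhakarDist (γ α β lam : ℝ) (φ : ℝ → ℝ) : ℝ :=
  ∑' j : ℕ, poch γ j * (-lam) ^ j / j.factorial * powerDist (β + α * j) φ

/-- The function `ε^γ_{α,β,p}(lam; ·)` as a generalized function. -/
def volterraPrabhakarDist (γ α β p lam : ℝ) (φ : ℝ → ℝ) : ℝ :=
  ∫ u in Ioi (0 : ℝ), u ^ β * prabhakarDist γ α (u + p + 1) lam φ

/-- `p₁(r; x, ·)` as a generalized function. -/
def p₁termDist (B : ℝ) (r : ℕ) (x : ℝ) (φ : ℝ → ℝ) : ℝ :=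
  coeff B r x * volterraPrabhakarDist (-bExp r) 1 (bExp r - 1) (-bExp r) (-1) φ

/-- The convolution of two generalized functions supported on `[0, ∞)`:
`⟨T ⋆ S, φ⟩ = ⟨T(t), ⟨S(ξ), φ(t + ξ)⟩⟩`. -/
def convDist (T S : (ℝ → ℝ) → ℝ) (φ : ℝ → ℝ) : ℝ := T fun t => S fun ξ => φ (t + ξ)

/-- On `(0, ∞)`, the generalized function `T` is the continuous function `h`. -/
def EqOnPos (T : (ℝ → ℝ) → ℝ) (h : ℝ → ℝ) : Prop :=
  ContinuousOn h (Ioi 0) ∧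
    ∀ φ, IsTest φ → tsupport φ ⊆ Ioi 0 → T φ = ∫ t in Ioi (0 : ℝ), h t * φ t

end DistributedOrder

end

open DistributedOrder

noncomputable section

namespace DistributedOrder

/-- `h` is holomorphic on the half plane `κ ≤ re w` and is `O(‖w‖ ^ N)` there. -/
structure Adm (κ N : ℝ) (h : ℂ → ℂ) : Prop where
  diff : ∀ w : ℂ, κ ≤ w.re → DifferentiableAt ℂ h w
  bound : ∃ C : ℝ, 0 < C ∧ ∀ w : ℂ, κ ≤ w.re → ‖h w‖ ≤ C * ‖w‖ ^ N

namespace Adm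

variable {κ N N' : ℝ} {h h' : ℂ → ℂ}

theorem continuousOn (hh : Adm κ N h) : ContinuousOn h {w | κ ≤ w.re} :=
  fun w hw => (hh.diff w hw).continuousAt.continuousWithinAt

theorem continuous_line (hh : Adm κ N h) : Continuous fun y : ℝ => h (κ + y * Complex.I) :=
  hh.continuousOn.comp_continuous (by fun_prop) fun y => by simp

theorem mul (hκ : 0 < κ) (hh : Adm κ N h) (hh' : Adm κ N' h') :
    Adm κ (N + N') fun w => h w * h' w := by
  refine ⟨fun w hw => (hh.diff w hw).mul (hh'.diff w hw), ?_⟩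
  obtain ⟨C, hC, h1⟩ := hh.bound
  obtain ⟨C', hC', h2⟩ := hh'.bound
  refine ⟨C * C', by positivity, fun w hw => ?_⟩
  have hw0 : 0 < ‖w‖ := (hκ.trans_le hw).trans_le (Complex.re_le_norm w)
  rw [norm_mul, Real.rpow_add hw0]
  calc ‖h w‖ * ‖h' w‖ ≤ (C * ‖w‖ ^ N) * (C' * ‖w‖ ^ N') := by
        gcongr
        exacts [h1 w hw, h2 w hw]
    _ = _ := by ring

theorem const_mul (hh : Adm κ N h) (c : ℂ) : Adm κ N fun w => c * h w := by
  refine ⟨fun w hw => (hh.diff w hw).const_mul c, ?_⟩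
  obtain ⟨C, hC, h1⟩ := hh.bound
  refine ⟨(‖c‖ + 1) * C, by positivity, fun w hw => ?_⟩
  rw [norm_mul, mul_assoc]
  refine mul_le_mul (by linarith) (h1 w hw) (norm_nonneg _) (by positivity)

theorem mono (hκ : 0 < κ) (hh : Adm κ N h) (hN : N ≤ N') : Adm κ N' h := by
  refine ⟨hh.diff, ?_⟩
  obtain ⟨C, hC, h1⟩ := hh.bound
  refine ⟨C * κ ^ (N - N'), by positivity, fun w hw => (h1 w hw).trans ?_⟩
  have hw1 : κ ≤ ‖w‖ := hw.trans (Complex.re_le_norm w)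
  have hw0 : 0 < ‖w‖ := hκ.trans_le hw1
  rw [mul_assoc]
  gcongr
  calc ‖w‖ ^ N = ‖w‖ ^ (N - N') * ‖w‖ ^ N' := by rw [← Real.rpow_add hw0]; congr 1; ring
    _ ≤ κ ^ (N - N') * ‖w‖ ^ N' := by
      refine mul_le_mul_of_nonneg_right ?_ (by positivity)
      exact Real.rpow_le_rpow_of_nonpos hκ hw1 (by linarith)

theorem cpow (hκ : 0 < κ) (a : ℝ) : Adm κ a fun w => w ^ (a : ℂ) := by
  refine ⟨fun w hw => ?_, 1, one_pos, fun w hw => ?_⟩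
  · exact (differentiableAt_id).cpow (differentiableAt_const _) (Or.inl (hκ.trans_le hw))
  · rw [one_mul, Complex.norm_cpow_real]

theorem congr (hκ : 0 < κ) (hh : Adm κ N h) (he : ∀ w : ℂ, 0 < w.re → h' w = h w) : Adm κ N h' := by
  refine ⟨fun w hw => ?_, ?_⟩
  · refine (hh.diff w hw).congr_of_eventuallyEq ?_
    filter_upwards [(isOpen_lt continuous_const Complex.continuous_re).mem_nhds (hκ.trans_le hw)]
      with z hz using he z hz
  · obtain ⟨C, hC, h1⟩ := hh.bound
    exact ⟨C, hC, fun w hw => by rw [he w (hκ.trans_le hw)]; exact h1 w hw⟩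

end Adm

/-- `‖κ + i y‖ ^ N` is integrable in `y` for `N < -1`. -/
theorem integrable_norm_line_rpow {κ N : ℝ} (hκ : 0 < κ) (hN : N < -1) :
    Integrable fun y : ℝ => ‖(κ : ℂ) + y * Complex.I‖ ^ N := by
  have h1 : Integrable fun y : ℝ => (1 + ‖y‖ ^ 2) ^ (-(-N) / 2) :=
    integrable_rpow_neg_one_add_norm_sq (by simp; linarith)
  obtain ⟨c, hc0, hc1, hcκ⟩ : ∃ c : ℝ, 0 < c ∧ c ≤ 1 ∧ c ≤ κ :=
    ⟨min 1 κ, lt_min one_pos hκ, min_le_left _ _, min_le_right _ _⟩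
  refine Integrable.mono' (h1.const_mul (c ^ N)) ?_ (Eventually.of_forall fun y => ?_)
  · refine Continuous.aestronglyMeasurable ?_
    refine Continuous.rpow_const (by fun_prop) fun y => Or.inl ?_
    intro h0
    have := congrArg Complex.re (norm_eq_zero.1 h0)
    simp at this; linarith
  · rw [Real.norm_of_nonneg (by positivity)]
    have hn : ‖(κ : ℂ) + y * Complex.I‖ ^ 2 = κ ^ 2 + y ^ 2 := by
      rw [← Complex.normSq_eq_norm_sq, Complex.normSq_add_mul_I]
    have hle : c * (1 + ‖y‖ ^ 2) ^ (1 / 2 : ℝ) ≤ ‖(κ : ℂ) + y * Complex.I‖ := by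
      rw [← Real.sqrt_eq_rpow]
      refine le_of_sq_le_sq ?_ (norm_nonneg _)
      rw [hn, mul_pow, Real.sq_sqrt (by positivity), Real.norm_eq_abs, sq_abs]
      nlinarith [sq_nonneg y, mul_le_mul hc1 hc1 hc0.le one_pos.le, mul_le_mul hcκ hcκ hc0.le hκ.le]
    calc ‖(κ : ℂ) + y * Complex.I‖ ^ N ≤ (c * (1 + ‖y‖ ^ 2) ^ (1 / 2 : ℝ)) ^ N :=
          Real.rpow_le_rpow_of_nonpos (by positivity) hle (by linarith)
      _ = _ := by
          rw [Real.mul_rpow hc0.le (by positivity), ← Real.rpow_mul (by positivity)]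
          congr 2; ring

theorem norm_line_pos {κ : ℝ} (hκ : 0 < κ) (y : ℝ) : 0 < ‖(κ : ℂ) + y * Complex.I‖ := by
  refine hκ.trans_le ((Complex.re_le_norm _).trans' ?_); simp

theorem norm_line_sq (κ y : ℝ) : ‖(κ : ℂ) + y * Complex.I‖ ^ 2 = κ ^ 2 + y ^ 2 := by
  rw [← Complex.normSq_eq_norm_sq, Complex.normSq_add_mul_I]

theorem re_line_sq (κ y : ℝ) : (((κ : ℂ) + y * Complex.I) ^ 2).re = κ ^ 2 - y ^ 2 := by
  simp [pow_two]

open Complex in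
theorem integrable_line_of_bound {κ M C δ : ℝ} (hκ : 0 < κ) (hδ : 0 < δ) {g : ℝ → ℂ}
    (hc : Continuous g)
    (hb : ∀ y : ℝ, M ≤ ‖(κ : ℂ) + y * I‖ → ‖g y‖ ≤ C * ‖(κ : ℂ) + y * I‖ ^ (-1 - δ)) :
    Integrable g := by
  refine hc.locallyIntegrable.integrable_of_isBigO_cocompact
    (g := fun y : ℝ => ‖(κ : ℂ) + y * I‖ ^ (-1 - δ)) ?_
    ((integrable_norm_line_rpow hκ (by linarith)).integrableAtFilter _)
  refine Asymptotics.IsBigO.of_bound C ?_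
  have : Tendsto (fun y : ℝ => ‖y‖) (cocompact ℝ) atTop := tendsto_norm_cocompact_atTop
  filter_upwards [this.eventually_ge_atTop M] with y hy
  rw [Real.norm_of_nonneg (by positivity : (0 : ℝ) ≤ ‖(κ : ℂ) + y * I‖ ^ (-1 - δ))]
  refine hb y (hy.trans ?_)
  refine le_trans ?_ (abs_im_le_norm _)
  simp

open Complex in
/-- The integral over a vertical line of a function that is holomorphic to the right of the line
and decays faster than `1 / ‖w‖` vanishes. -/
theorem integral_vertical_eq_zero {κ M C δ : ℝ} (hκ : 0 < κ) (hδ : 0 < δ) {g : ℂ → ℂ}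
    (hc : ContinuousOn g {w | κ ≤ w.re}) (hd : ∀ w : ℂ, κ < w.re → DifferentiableAt ℂ g w)
    (hb : ∀ w : ℂ, κ ≤ w.re → M ≤ ‖w‖ → ‖g w‖ ≤ C * ‖w‖ ^ (-1 - δ)) :
    Integrable (fun y : ℝ => g (κ + y * I)) ∧ ∫ y : ℝ, g (κ + y * I) = 0 := by
  have hi : Integrable fun y : ℝ => g (κ + y * I) := by
    refine integrable_line_of_bound (M := M) (C := C) hκ hδ ?_ fun y hy => hb _ (by simp) hy
    exact hc.comp_continuous (by fun_prop) fun y => by simp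
  have hT : Tendsto (fun R : ℝ => ∫ y in (-R)..R, g (κ + y * I)) atTop
      (𝓝 (∫ y : ℝ, g (κ + y * I))) :=
    intervalIntegral_tendsto_integral hi tendsto_neg_atTop_atBot tendsto_id
  refine ⟨hi, tendsto_nhds_unique hT ?_⟩
  have h0 : Tendsto (fun R : ℝ => 4 * |C| * R ^ (-δ)) atTop (𝓝 0) := by
    simpa using (tendsto_rpow_neg_atTop hδ).const_mul (4 * |C|)
  refine squeeze_zero_norm' ?_ h0
  filter_upwards [eventually_ge_atTop (max M 1)] with R hR
  have hR1 : 1 ≤ R := (le_max_right _ _).trans hR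
  have hRM : M ≤ R := (le_max_left _ _).trans hR
  have hR0 : 0 < R := by linarith
  have key : ∀ w : ℂ, κ ≤ w.re → R ≤ ‖w‖ → ‖g w‖ ≤ |C| * R ^ (-1 - δ) := fun w h1 h2 => by
    refine (hb w h1 (hRM.trans h2)).trans ?_
    refine mul_le_mul (le_abs_self C) ?_ (by positivity) (abs_nonneg _)
    exact Real.rpow_le_rpow_of_nonpos hR0 h2 (by linarith)
  have hrect := integral_boundary_rect_eq_zero_of_continuousOn_of_differentiableOn g
    (κ + (-R : ℝ) * I) ((κ + R : ℝ) + R * I) ?_ ?_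
  · simp only [add_re, ofReal_re, mul_re, I_re, mul_zero, ofReal_im, I_im, mul_one, sub_self,
      add_zero, add_im, mul_im, zero_add, smul_eq_mul] at hrect
    have hb1 : ‖∫ x in κ..(κ + R), g (x + (-R : ℝ) * I)‖ ≤ |C| * R ^ (-1 - δ) * |κ + R - κ| := by
      refine intervalIntegral.norm_integral_le_of_norm_le_const fun x hx => ?_
      rw [uIoc_of_le (by linarith)] at hx
      refine key _ (by simpa using hx.1.le) ?_
      refine le_trans ?_ (abs_im_le_norm _)
      simp [abs_of_pos hR0]
    have hb2 : ‖∫ x in κ..(κ + R), g (x + R * I)‖ ≤ |C| * R ^ (-1 - δ) * |κ + R - κ| := by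
      refine intervalIntegral.norm_integral_le_of_norm_le_const fun x hx => ?_
      rw [uIoc_of_le (by linarith)] at hx
      refine key _ (by simpa using hx.1.le) ?_
      refine le_trans ?_ (abs_im_le_norm _)
      simp [abs_of_pos hR0]
    have hb3 : ‖∫ y in (-R)..R, g ((κ + R : ℝ) + y * I)‖ ≤ |C| * R ^ (-1 - δ) * |R - -R| := by
      refine intervalIntegral.norm_integral_le_of_norm_le_const fun y hy => ?_
      refine key _ (by simp; linarith) ?_
      refine le_trans ?_ (re_le_norm _)
      simp; linarith
    have e : I * ∫ y in (-R)..R, g (κ + y * I) =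
        (∫ x in κ..(κ + R), g (x + (-R : ℝ) * I)) - (∫ x in κ..(κ + R), g (x + R * I)) +
        I * ∫ y in (-R)..R, g ((κ + R : ℝ) + y * I) := by
      linear_combination -hrect
    have e2 : ‖∫ y in (-R)..R, g (κ + y * I)‖ = ‖I * ∫ y in (-R)..R, g (κ + y * I)‖ := by simp
    rw [e2, e]
    refine (norm_add_le _ _).trans ((add_le_add (norm_sub_le _ _) le_rfl).trans ?_)
    rw [norm_mul, norm_I, one_mul]
    have hRR : R ^ (-1 - δ) * R = R ^ (-δ) := by
      rw [← Real.rpow_add_one hR0.ne']; congr 1; ring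
    have a1 : |κ + R - κ| = R := by rw [add_sub_cancel_left, abs_of_pos hR0]
    have a2 : |R - -R| = 2 * R := by rw [abs_of_pos (by linarith)]; ring
    rw [a1] at hb1 hb2
    rw [a2] at hb3
    rw [mul_assoc, hRR] at hb1 hb2
    rw [show |C| * R ^ (-1 - δ) * (2 * R) = 2 * (|C| * (R ^ (-1 - δ) * R)) by ring, hRR] at hb3
    linarith
  · refine hc.mono fun w hw => ?_
    have := hw.1
    simp only [add_re, ofReal_re, mul_re, I_re, mul_zero, ofReal_im, I_im, mul_one, sub_self,
      add_zero, mem_preimage] at this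
    rw [uIcc_of_le (by linarith)] at this
    exact this.1
  · intro w hw
    have := hw.1
    simp only [add_re, ofReal_re, mul_re, I_re, mul_zero, ofReal_im, I_im, mul_one, sub_self,
      add_zero, mem_preimage] at this
    rw [min_eq_left (by linarith)] at this
    exact (hd w this.1).differentiableWithinAt

theorem integral_poisson_kernel {a : ℝ} (ha : 0 < a) (η : ℝ) :
    Integrable (fun y : ℝ => 2 * a / (a ^ 2 + (y - η) ^ 2)) ∧
      ∫ y : ℝ, 2 * a / (a ^ 2 + (y - η) ^ 2) = 2 * Real.pi := by
  have e : (fun y : ℝ => 2 * a / (a ^ 2 + (y - η) ^ 2)) =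
      fun y => (fun u => (2 / a) * (1 + (u / a) ^ 2)⁻¹) (y - η) := by
    ext y; field_simp
  rw [e]
  constructor
  · refine Integrable.comp_sub_right (f := fun u : ℝ => (2 / a) * (1 + (u / a) ^ 2)⁻¹) ?_ η
    exact ((integrable_inv_one_add_sq.comp_div ha.ne')).const_mul _
  · rw [integral_sub_right_eq_self (fun u : ℝ => (2 / a) * (1 + (u / a) ^ 2)⁻¹) η,
      integral_const_mul, Measure.integral_comp_div (fun u : ℝ => (1 + u ^ 2)⁻¹) a,
      integral_univ_inv_one_add_sq, abs_of_pos ha, smul_eq_mul]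
    field_simp

open Complex in
/-- Cauchy's formula for the vertical line `re w = κ`, in the variable `w ^ 2`. -/
theorem cauchy_vertical {κ δ : ℝ} (hκ : 0 < κ) (hδ : 0 < δ) (hδ1 : δ ≤ 1) {h : ℂ → ℂ}
    (hh : Adm κ (-δ) h) {ζ : ℂ} (hζ : κ < ζ.re) :
    ∫ y : ℝ, h (κ + y * I) * (2 * (κ + y * I) / (ζ ^ 2 - (κ + y * I) ^ 2)) =
      2 * Real.pi * h ζ := by
  set a : ℝ := ζ.re - κ with ha
  have ha0 : 0 < a := sub_pos.2 hζ
  set ζ' : ℂ := (starRingEnd ℂ) ζ with hζ'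
  set f : ℂ → ℂ := fun w => h w * (2 * w / (ζ + w)) - h ζ * (2 * a / (w - 2 * κ + ζ')) with hf
  have n1 : ∀ w : ℂ, κ ≤ w.re → ζ + w ≠ 0 := fun w hw h0 => by
    have := congrArg re h0; simp at this; linarith
  have n2 : ∀ w : ℂ, κ ≤ w.re → w - 2 * κ + ζ' ≠ 0 := fun w hw h0 => by
    have := congrArg re h0; simp [ζ'] at this; linarith
  have hfd : ∀ w : ℂ, κ ≤ w.re → DifferentiableAt ℂ f w := fun w hw => by
    have h1 := hh.diff w hw
    have h2 := n1 w hw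
    have h3 := n2 w hw
    fun_prop (disch := assumption)
  have hζ0 : ζ ≠ 0 := fun h0 => by simp [h0] at hζ; linarith
  have hfζ : f ζ = 0 := by
    have e1 : 2 * ζ / (ζ + ζ) = 1 := by field_simp; ring
    have e2 : ζ - 2 * κ + ζ' = 2 * a := by
      apply Complex.ext <;> simp [ζ', ha]; ring
    have e3 : (2 * a : ℂ) ≠ 0 := by exact_mod_cast (by positivity : (2 * a : ℝ) ≠ 0)
    simp only [hf, e1, e2, div_self e3, sub_self]
  have hU : {w : ℂ | κ < w.re} ∈ 𝓝 ζ := (isOpen_lt continuous_const continuous_re).mem_nhds hζ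
  have hU' : {w : ℂ | κ ≤ w.re} ∈ 𝓝 ζ := mem_of_superset hU fun w (hw : κ < w.re) => hw.le
  obtain ⟨C, hC, hb⟩ := hh.bound
  set M : ℝ := 1 + 6 * (‖ζ‖ + κ) with hM
  have hg0 : Integrable (fun y : ℝ => dslope f ζ (κ + y * I)) ∧
      ∫ y : ℝ, dslope f ζ (κ + y * I) = 0 := by
    refine integral_vertical_eq_zero (M := M) (C := 2 * (4 * C + ‖h ζ‖ * (4 * a))) hκ hδ ?_ ?_ ?_
    · exact (_root_.continuousOn_dslope hU').2
        ⟨fun w hw => (hfd w hw).continuousAt.continuousWithinAt, hfd ζ hζ.le⟩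
    · intro w hw
      have := (Complex.differentiableOn_dslope (f := f) hU).2
        fun w (hw : κ < w.re) => (hfd w hw.le).differentiableWithinAt
      exact this.differentiableAt ((isOpen_lt continuous_const continuous_re).mem_nhds hw)
    · intro w hw hMw
      have hζn : 0 ≤ ‖ζ‖ := norm_nonneg ζ
      have hw1 : 1 ≤ ‖w‖ := by linarith
      have hw0 : 0 < ‖w‖ := by linarith
      have hne : w ≠ ζ := fun h0 => by rw [h0] at hMw; linarith
      have b1 : ‖w‖ / 2 ≤ ‖w - ζ‖ := by
        have := norm_sub_norm_le w ζ; linarith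
      have b2 : ‖w‖ / 2 ≤ ‖ζ + w‖ := by
        have := norm_sub_norm_le w (-ζ)
        rw [sub_neg_eq_add, norm_neg, add_comm w] at this; linarith
      have b3 : ‖w‖ / 2 ≤ ‖w - 2 * κ + ζ'‖ := by
        have := norm_sub_norm_le w (2 * κ - ζ')
        rw [show w - (2 * κ - ζ') = w - 2 * κ + ζ' by ring] at this
        have h2 : ‖(2 * κ : ℂ) - ζ'‖ ≤ 2 * κ + ‖ζ‖ := by
          refine (norm_sub_le _ _).trans ?_
          simp [ζ', abs_of_pos hκ]
        linarith
      have f1 : ‖f w‖ ≤ (4 * C + ‖h ζ‖ * (4 * a)) * ‖w‖ ^ (-δ) := by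
        have t1 : ‖h w * (2 * w / (ζ + w))‖ ≤ C * ‖w‖ ^ (-δ) * 4 := by
          rw [norm_mul]
          refine mul_le_mul (hb w hw) ?_ (norm_nonneg _) (by positivity)
          rw [norm_div, norm_mul, div_le_iff₀ (by linarith), Complex.norm_ofNat]
          linarith
        have t2 : ‖h ζ * (2 * a / (w - 2 * κ + ζ'))‖ ≤ ‖h ζ‖ * (4 * a * ‖w‖ ^ (-δ)) := by
          rw [norm_mul]
          refine mul_le_mul_of_nonneg_left ?_ (norm_nonneg _)
          rw [norm_div, norm_mul, Complex.norm_ofNat, norm_real, Real.norm_of_nonneg ha0.le]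
          calc 2 * a / ‖w - 2 * κ + ζ'‖ ≤ 2 * a / (‖w‖ / 2) := by gcongr
            _ = 4 * a * ‖w‖ ^ (-1 : ℝ) := by rw [Real.rpow_neg_one]; field_simp; norm_num
            _ ≤ _ := by
              gcongr
        refine (norm_sub_le _ _).trans ((add_le_add t1 t2).trans (le_of_eq ?_))
        ring
      rw [dslope_of_ne _ hne, slope_def_field, hfζ, sub_zero, norm_div, div_le_iff₀ (by linarith)]
      refine f1.trans ?_
      have : ‖w‖ ^ (-δ) = ‖w‖ ^ (-1 - δ) * ‖w‖ := by
        rw [← Real.rpow_add_one hw0.ne']; congr 1; ring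
      rw [this]
      have := mul_le_mul_of_nonneg_left b1
        (by positivity : 0 ≤ (4 * C + ‖h ζ‖ * (4 * a)) * ‖w‖ ^ (-1 - δ))
      nlinarith [this]
  have hgi : Integrable fun y : ℝ => ((2 * a / (a ^ 2 + (y - ζ.im) ^ 2) : ℝ) : ℂ) :=
    (integral_poisson_kernel ha0 ζ.im).1.ofReal
  have hline : ∀ y : ℝ, h (κ + y * I) * (2 * (κ + y * I) / (ζ ^ 2 - (κ + y * I) ^ 2)) =
      ((2 * a / (a ^ 2 + (y - ζ.im) ^ 2) : ℝ) : ℂ) * h ζ - dslope f ζ (κ + y * I) := by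
    intro y
    set w : ℂ := κ + y * I with hw
    have hwre : w.re = κ := by simp [hw]
    have hne : w ≠ ζ := fun h0 => by rw [← h0, hwre] at hζ; exact lt_irrefl _ hζ
    have m1 := n1 w hwre.ge
    have m2 := n2 w hwre.ge
    have m3 : w - ζ ≠ 0 := sub_ne_zero.2 hne
    have m4 : ζ ^ 2 - w ^ 2 ≠ 0 := by
      rw [show ζ ^ 2 - w ^ 2 = -((w - ζ) * (ζ + w)) by ring]
      exact neg_ne_zero.2 (mul_ne_zero m3 m1)
    have e1 : ((2 * a / (a ^ 2 + (y - ζ.im) ^ 2) : ℝ) : ℂ) =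
        -(2 * a / ((w - ζ) * (w - 2 * κ + ζ'))) := by
      have : (w - ζ) * (w - 2 * κ + ζ') = -((a ^ 2 + (y - ζ.im) ^ 2 : ℝ) : ℂ) := by
        have u1 : w - ζ = -a + ((y - ζ.im : ℝ) : ℂ) * I := by
          apply Complex.ext <;> simp [hw, ha]
        have u2 : w - 2 * κ + ζ' = a + ((y - ζ.im : ℝ) : ℂ) * I := by
          apply Complex.ext <;> simp [hw, ha, ζ']
          · ring
          · ring
        rw [u1, u2]
        push_cast
        linear_combination ((y : ℂ) - ζ.im) ^ 2 * I_sq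
      rw [this]; push_cast; rw [div_neg, neg_neg]
    rw [dslope_of_ne _ hne, slope_def_field, hfζ, sub_zero, e1, hf]
    simp only
    rw [show ζ ^ 2 - w ^ 2 = -((w - ζ) * (ζ + w)) by ring]
    field_simp
    ring
  simp_rw [hline]
  rw [integral_sub (hgi.mul_const _) hg0.1, hg0.2, integral_mul_const, integral_complex_ofReal,
    (integral_poisson_kernel ha0 ζ.im).2]
  push_cast; ring

end DistributedOrder
end

noncomputable section

namespace DistributedOrder

/-- The inverse Laplace integral over the parabola `s = (κ + i y) ^ 2` of the function
`s ↦ h (√s)`. -/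
def contour (κ : ℝ) (h : ℂ → ℂ) (t : ℝ) : ℂ :=
  (Real.pi : ℂ)⁻¹ * ∫ y : ℝ, Complex.exp ((κ + y * Complex.I) ^ 2 * t) *
    ((κ + y * Complex.I) * h (κ + y * Complex.I))

theorem exp_neg_le_rpow {σ : ℝ} (hσ : 0 ≤ σ) :
    ∃ C : ℝ, 0 < C ∧ ∀ v : ℝ, 0 < v → Real.exp (-v) ≤ C * v ^ (-σ) := by
  refine ⟨(⌈σ⌉₊.factorial : ℝ), by positivity, fun v hv => ?_⟩
  have hf : (1 : ℝ) ≤ (⌈σ⌉₊.factorial : ℝ) := by exact_mod_cast Nat.factorial_pos _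
  have key : v ^ σ ≤ (⌈σ⌉₊.factorial : ℝ) * Real.exp v := by
    rcases le_total v 1 with h1 | h1
    · calc v ^ σ ≤ 1 := Real.rpow_le_one hv.le h1 hσ
        _ ≤ _ := by nlinarith [Real.one_le_exp hv.le]
    · calc v ^ σ ≤ v ^ (⌈σ⌉₊ : ℝ) := Real.rpow_le_rpow_of_exponent_le h1 (Nat.le_ceil σ)
        _ = v ^ ⌈σ⌉₊ := Real.rpow_natCast _ _
        _ ≤ _ := by
          have := Real.pow_div_factorial_le_exp v hv.le ⌈σ⌉₊
          rwa [div_le_iff₀ (by positivity), mul_comm] at this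
  rw [Real.rpow_neg hv.le, Real.exp_neg, ← div_eq_mul_inv, inv_eq_one_div,
    div_le_div_iff₀ (Real.exp_pos v) (by positivity)]
  linarith

theorem norm_exp_line (κ y t : ℝ) :
    ‖Complex.exp (((κ : ℂ) + y * Complex.I) ^ 2 * t)‖ =
      Real.exp (2 * κ ^ 2 * t) * Real.exp (-(‖(κ : ℂ) + y * Complex.I‖ ^ 2 * t)) := by
  rw [Complex.norm_exp, Complex.re_mul_ofReal, re_line_sq, norm_line_sq, ← Real.exp_add]
  congr 1; ring

theorem norm_integrand_le {κ : ℝ} (hκ : 0 < κ) {σ : ℝ} (hσ : 0 ≤ σ) :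
    ∃ K : ℝ, 0 < K ∧ ∀ (N C t y : ℝ) (z : ℂ), 0 < t → ‖z‖ ≤ C * ‖(κ : ℂ) + y * Complex.I‖ ^ N →
      ‖Complex.exp ((κ + y * Complex.I) ^ 2 * t) * ((κ + y * Complex.I) * z)‖ ≤
        K * C * Real.exp (2 * κ ^ 2 * t) * t ^ (-σ) *
          ‖(κ : ℂ) + y * Complex.I‖ ^ (N + 1 - 2 * σ) := by
  obtain ⟨K, hK, hKe⟩ := exp_neg_le_rpow hσ
  refine ⟨K, hK, fun N C t y z ht hz => ?_⟩
  have hw := norm_line_pos hκ y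
  set r := ‖(κ : ℂ) + y * Complex.I‖ with hr
  rw [norm_mul, norm_mul, norm_exp_line, ← hr]
  have h1 := hKe (r ^ 2 * t) (by positivity)
  rw [Real.mul_rpow (by positivity) ht.le, ← Real.rpow_natCast r 2, ← Real.rpow_mul hw.le] at h1
  rw [Real.rpow_natCast] at h1
  calc Real.exp (2 * κ ^ 2 * t) * Real.exp (-(r ^ 2 * t)) * (r * ‖z‖)
      ≤ Real.exp (2 * κ ^ 2 * t) * (K * (r ^ (((2 : ℕ) : ℝ) * -σ) * t ^ (-σ))) *
          (r * (C * r ^ N)) := by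
        gcongr
    _ = K * C * Real.exp (2 * κ ^ 2 * t) * t ^ (-σ) *
          (r ^ (((2 : ℕ) : ℝ) * -σ) * r * r ^ N) := by ring
    _ = _ := by
        congr 1
        rw [← Real.rpow_add_one hw.ne', ← Real.rpow_add hw]
        congr 1; push_cast; ring

theorem measurable_integrand {κ : ℝ} {h : ℂ → ℂ}
    (hc : Continuous fun y : ℝ => h (κ + y * Complex.I)) (t : ℝ) :
    AEStronglyMeasurable (fun y : ℝ => Complex.exp ((κ + y * Complex.I) ^ 2 * t) *
      ((κ + y * Complex.I) * h (κ + y * Complex.I))) :=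
  (Continuous.mul (by fun_prop) (Continuous.mul (by fun_prop) hc)).aestronglyMeasurable

theorem integrable_integrand {κ N C : ℝ} (hκ : 0 < κ) {h : ℂ → ℂ}
    (hc : Continuous fun y : ℝ => h (κ + y * Complex.I))
    (hb : ∀ y : ℝ, ‖h (κ + y * Complex.I)‖ ≤ C * ‖(κ : ℂ) + y * Complex.I‖ ^ N)
    {t : ℝ} (ht : 0 < t) :
    Integrable (fun y : ℝ => Complex.exp ((κ + y * Complex.I) ^ 2 * t) *
      ((κ + y * Complex.I) * h (κ + y * Complex.I))) := by
  obtain ⟨K, hK, hKb⟩ := norm_integrand_le hκ (σ := |N| + 2) (by positivity)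
  refine Integrable.mono' (((integrable_norm_line_rpow (N := N + 1 - 2 * (|N| + 2)) hκ
    (by linarith [le_abs_self N, abs_nonneg N]))).const_mul
      (K * C * Real.exp (2 * κ ^ 2 * t) * t ^ (-(|N| + 2)))) (measurable_integrand hc t) ?_
  exact Eventually.of_forall fun y => hKb N C t y _ ht (hb y)

theorem norm_contour_le {κ N σ : ℝ} (hκ : 0 < κ) (hσ : 0 ≤ σ) (hN : N + 2 < 2 * σ) :
    ∃ K : ℝ, 0 < K ∧ ∀ (C : ℝ) (h : ℂ → ℂ),
      (∀ y : ℝ, ‖h (κ + y * Complex.I)‖ ≤ C * ‖(κ : ℂ) + y * Complex.I‖ ^ N) →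
      ∀ t : ℝ, 0 < t → ‖contour κ h t‖ ≤ K * C * Real.exp (2 * κ ^ 2 * t) * t ^ (-σ) := by
  obtain ⟨K, hK, hKb⟩ := norm_integrand_le hκ hσ
  have hi := integrable_norm_line_rpow (N := N + 1 - 2 * σ) hκ (by linarith)
  set J := ∫ y : ℝ, ‖(κ : ℂ) + y * Complex.I‖ ^ (N + 1 - 2 * σ) with hJ
  have hJ0 : 0 ≤ J := integral_nonneg fun y => by positivity
  refine ⟨K * (J + 1), by positivity, fun C h hb t ht => ?_⟩
  have hC : 0 ≤ C := by
    have h1 := (norm_nonneg _).trans (hb 0)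
    have h2 : 0 < ‖(κ : ℂ) + (0 : ℝ) * Complex.I‖ ^ N := Real.rpow_pos_of_pos (norm_line_pos hκ 0) _
    exact nonneg_of_mul_nonneg_left h1 h2
  have h1 : ‖∫ y : ℝ, Complex.exp ((κ + y * Complex.I) ^ 2 * t) *
      ((κ + y * Complex.I) * h (κ + y * Complex.I))‖ ≤
      K * C * Real.exp (2 * κ ^ 2 * t) * t ^ (-σ) * J := by
    rw [hJ, ← integral_const_mul]
    exact norm_integral_le_of_norm_le (hi.const_mul _)
      (Eventually.of_forall fun y => hKb N C t y _ ht (hb y))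
  have hpi : ‖(Real.pi : ℂ)⁻¹‖ ≤ 1 := by
    rw [norm_inv, Complex.norm_real, Real.norm_of_nonneg Real.pi_pos.le]
    exact inv_le_one_of_one_le₀ (by linarith [Real.pi_gt_three])
  rw [contour, norm_mul]
  calc _ ≤ 1 * (K * C * Real.exp (2 * κ ^ 2 * t) * t ^ (-σ) * J) := by gcongr
    _ ≤ K * C * Real.exp (2 * κ ^ 2 * t) * t ^ (-σ) * (J + 1) := by
      rw [one_mul]; gcongr; linarith
    _ = _ := by ring

/-- Joint continuity of a family of inverse Laplace integrals. -/
theorem continuousOn_contour_family {κ N C : ℝ} (hκ : 0 < κ) {h : ℝ → ℂ → ℂ}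
    (hc : Continuous fun z : ℝ × ℝ => h z.1 (κ + z.2 * Complex.I))
    (hb : ∀ x y : ℝ, ‖h x (κ + y * Complex.I)‖ ≤ C * ‖(κ : ℂ) + y * Complex.I‖ ^ N) :
    ContinuousOn (fun z : ℝ × ℝ => contour κ (h z.1) z.2) (univ ×ˢ Ioi 0) := by
  obtain ⟨K, hK, hKb⟩ := norm_integrand_le hκ (σ := |N| + 2) (by positivity)
  have hC : 0 ≤ C := by
    have h1 := (norm_nonneg _).trans (hb 0 0)
    exact nonneg_of_mul_nonneg_left h1 (Real.rpow_pos_of_pos (norm_line_pos hκ 0) _)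
  rintro ⟨x₀, t₀⟩ ⟨-, ht₀⟩
  have ht₀ : 0 < t₀ := ht₀
  refine ContinuousAt.continuousWithinAt ?_
  refine ContinuousAt.mul continuousAt_const ?_
  refine continuousAt_of_dominated (bound := fun y => K * C * Real.exp (2 * κ ^ 2 * (2 * t₀)) *
    (t₀ / 2) ^ (-(|N| + 2)) * ‖(κ : ℂ) + y * Complex.I‖ ^ (N + 1 - 2 * (|N| + 2))) ?_ ?_ ?_ ?_
  · refine Eventually.of_forall fun z => measurable_integrand ?_ _
    exact hc.comp (by fun_prop : Continuous fun y : ℝ => (z.1, y))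
  · have h1 : ∀ᶠ z : ℝ × ℝ in 𝓝 (x₀, t₀), t₀ / 2 < z.2 :=
      continuousAt_snd.eventually (lt_mem_nhds (by simp; linarith))
    have h2 : ∀ᶠ z : ℝ × ℝ in 𝓝 (x₀, t₀), z.2 < 2 * t₀ :=
      continuousAt_snd.eventually (gt_mem_nhds (by simp; linarith))
    filter_upwards [h1, h2] with z hz1 hz2
    refine Eventually.of_forall fun y => (hKb N C z.2 y _ (by linarith) (hb z.1 y)).trans ?_
    have h4 : z.2 ^ (-(|N| + 2)) ≤ (t₀ / 2) ^ (-(|N| + 2)) :=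
      Real.rpow_le_rpow_of_nonpos (by linarith) hz1.le (by linarith [abs_nonneg N])
    have h5 : 0 < z.2 := by linarith
    gcongr
  · exact (integrable_norm_line_rpow hκ (by linarith [le_abs_self N, abs_nonneg N])).const_mul _
  · refine Eventually.of_forall fun y => Continuous.continuousAt ?_
    have : Continuous fun z : ℝ × ℝ => h z.1 (κ + y * Complex.I) :=
      hc.comp (by fun_prop : Continuous fun z : ℝ × ℝ => (z.1, y))
    exact Continuous.mul (by fun_prop) (Continuous.mul (by fun_prop) this)

theorem hasDerivAt_contour {κ N C : ℝ} (hκ : 0 < κ) {h : ℂ → ℂ}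
    (hc : Continuous fun y : ℝ => h (κ + y * Complex.I))
    (hb : ∀ y : ℝ, ‖h (κ + y * Complex.I)‖ ≤ C * ‖(κ : ℂ) + y * Complex.I‖ ^ N)
    {t : ℝ} (ht : 0 < t) :
    HasDerivAt (contour κ h) (contour κ (fun w => w ^ 2 * h w) t) t := by
  obtain ⟨K, hK, hKb⟩ := norm_integrand_le hκ (σ := |N| + 4) (by positivity)
  have hC : 0 ≤ C := by
    have h1 := (norm_nonneg _).trans (hb 0)
    exact nonneg_of_mul_nonneg_left h1 (Real.rpow_pos_of_pos (norm_line_pos hκ 0) _)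
  have hb2 : ∀ y : ℝ, ‖((κ : ℂ) + y * Complex.I) ^ 2 * h (κ + y * Complex.I)‖ ≤
      C * ‖(κ : ℂ) + y * Complex.I‖ ^ (N + 2) := fun y => by
    rw [norm_mul, norm_pow, Real.rpow_add (norm_line_pos hκ y), Real.rpow_two]
    nlinarith [hb y, sq_nonneg ‖(κ : ℂ) + y * Complex.I‖]
  refine HasDerivAt.const_mul _ ?_
  refine (hasDerivAt_integral_of_dominated_loc_of_deriv_le (s := Ioo (t / 2) (2 * t))
    (bound := fun y : ℝ => K * C * Real.exp (2 * κ ^ 2 * (2 * t)) *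
      (t / 2) ^ (-(|N| + 4)) * ‖(κ : ℂ) + y * Complex.I‖ ^ (N + 2 + 1 - 2 * (|N| + 4)))
    (F' := fun (τ y : ℝ) => Complex.exp ((κ + y * Complex.I) ^ 2 * τ) *
      ((κ + y * Complex.I) * ((κ + y * Complex.I) ^ 2 * h (κ + y * Complex.I))))
    (Ioo_mem_nhds (half_lt_self ht) (lt_two_mul_self ht)) ?_ ?_ ?_ ?_ ?_ ?_).2
  · exact Eventually.of_forall fun τ => measurable_integrand hc τ
  · exact integrable_integrand hκ hc hb ht
  · exact measurable_integrand (h := fun w => w ^ 2 * h w) (Continuous.mul (by fun_prop) hc) t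
  · refine Eventually.of_forall fun y τ hτ =>
      (hKb (N + 2) C τ y _ (by linarith [hτ.1]) (hb2 y)).trans ?_
    have h4 : τ ^ (-(|N| + 4)) ≤ (t / 2) ^ (-(|N| + 4)) :=
      Real.rpow_le_rpow_of_nonpos (by linarith) hτ.1.le (by linarith [abs_nonneg N])
    have := hτ.2.le
    have := hτ.1
    have : 0 < τ := by linarith
    gcongr
  · exact (integrable_norm_line_rpow hκ (by linarith [le_abs_self N, abs_nonneg N])).const_mul _
  · refine Eventually.of_forall fun y τ _ => ?_
    have h1 : HasDerivAt (fun τ : ℝ => ((κ : ℂ) + y * Complex.I) ^ 2 * τ)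
        (((κ : ℂ) + y * Complex.I) ^ 2) τ := by
      simpa using (Complex.ofRealCLM.hasDerivAt (x := τ)).const_mul (((κ : ℂ) + y * Complex.I) ^ 2)
    have h2 := (h1.cexp).mul_const (((κ : ℂ) + y * Complex.I) * h (κ + y * Complex.I))
    refine h2.congr_deriv ?_
    ring

theorem Adm.line_bound {κ N : ℝ} {h : ℂ → ℂ} (hh : Adm κ N h) :
    ∃ C : ℝ, ∀ y : ℝ, ‖h (κ + y * Complex.I)‖ ≤ C * ‖(κ : ℂ) + y * Complex.I‖ ^ N := by
  obtain ⟨C, -, hC⟩ := hh.bound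
  exact ⟨C, fun y => hC _ (by simp)⟩

theorem Adm.hasDerivAt_contour {κ N : ℝ} (hκ : 0 < κ) {h : ℂ → ℂ} (hh : Adm κ N h)
    {t : ℝ} (ht : 0 < t) : HasDerivAt (contour κ h) (contour κ (fun w => w ^ 2 * h w) t) t := by
  obtain ⟨C, hC⟩ := hh.line_bound
  exact DistributedOrder.hasDerivAt_contour hκ hh.continuous_line hC ht

theorem Adm.continuousOn_contour {κ N : ℝ} (hκ : 0 < κ) {h : ℂ → ℂ} (hh : Adm κ N h) :
    ContinuousOn (contour κ h) (Ioi 0) :=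
  fun _ ht => (hh.hasDerivAt_contour hκ ht).continuousAt.continuousWithinAt

theorem contour_congr {κ : ℝ} {h h' : ℂ → ℂ}
    (e : ∀ y : ℝ, h (κ + y * Complex.I) = h' (κ + y * Complex.I)) (t : ℝ) :
    contour κ h t = contour κ h' t := by
  simp only [contour, e]

theorem contour_const_mul {κ : ℝ} (c : ℂ) (h : ℂ → ℂ) (t : ℝ) :
    contour κ (fun w => c * h w) t = c * contour κ h t := by
  rw [contour, contour, mul_left_comm c, ← integral_const_mul c]
  congr 1
  refine integral_congr_ae (Eventually.of_forall fun y => ?_)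
  ring

/-- For a function `h` that is real on the real line, `contour κ h` is real. -/
theorem contour_conj {κ : ℝ} {h : ℂ → ℂ}
    (e : ∀ y : ℝ, h ((starRingEnd ℂ) (κ + y * Complex.I)) =
      (starRingEnd ℂ) (h (κ + y * Complex.I))) (t : ℝ) :
    (((contour κ h t).re : ℝ) : ℂ) = contour κ h t := by
  refine Complex.conj_eq_iff_re.1 ?_
  rw [contour, map_mul, map_inv₀, Complex.conj_ofReal, ← integral_conj,
    ← integral_neg_eq_self]
  congr 1
  refine integral_congr_ae (Eventually.of_forall fun y => ?_)
  beta_reduce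
  have hw : (starRingEnd ℂ) ((κ : ℂ) + ((-y : ℝ) : ℂ) * Complex.I) = κ + y * Complex.I := by
    simp
  rw [map_mul, map_mul, ← e, hw, ← Complex.exp_conj, map_mul, map_pow, hw, Complex.conj_ofReal]

theorem exists_const_mul_norm_sq_le {κ c : ℝ} (hκ : 0 < κ) (hc : κ ^ 2 < c) :
    ∃ C : ℝ, 0 < C ∧ ∀ y : ℝ, C * ‖(κ : ℂ) + y * Complex.I‖ ^ 2 ≤ c - κ ^ 2 + y ^ 2 := by
  refine ⟨min 1 ((c - κ ^ 2) / κ ^ 2), lt_min one_pos (div_pos (by linarith) (by positivity)),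
    fun y => ?_⟩
  rw [norm_line_sq, mul_add]
  refine add_le_add ?_ ?_
  · calc _ ≤ (c - κ ^ 2) / κ ^ 2 * κ ^ 2 := by gcongr; exact min_le_right _ _
      _ = _ := by field_simp
  · calc _ ≤ 1 * y ^ 2 := by gcongr; exact min_le_left _ _
      _ = _ := one_mul _

open Complex in
/-- The Laplace transform of `contour κ h` at `ζ ^ 2` is `h ζ`. -/
theorem Adm.laplace_contour {κ δ : ℝ} (hκ : 0 < κ) (hδ : 0 < δ) {h : ℂ → ℂ}
    (hh : Adm κ (-δ) h) {ζ : ℂ} (hζ : κ < ζ.re) (hζ2 : κ ^ 2 < (ζ ^ 2).re) :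
    IntegrableOn (fun t : ℝ => cexp (-(ζ ^ 2) * t) * contour κ h t) (Ioi 0) ∧
      ∫ t in Ioi (0 : ℝ), cexp (-(ζ ^ 2) * t) * contour κ h t = h ζ := by
  wlog hδ1 : δ ≤ 1 generalizing δ
  · exact this one_pos (hh.mono hκ (by linarith)) le_rfl
  obtain ⟨C, hC0, hC⟩ := hh.bound
  have hcl := hh.continuous_line
  obtain ⟨c, hc0, hc⟩ := exists_const_mul_norm_sq_le hκ hζ2
  set F : ℝ → ℝ → ℂ := fun t y => cexp (-(ζ ^ 2) * t) * (cexp ((κ + y * I) ^ 2 * t) *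
    ((κ + y * I) * h (κ + y * I))) with hF
  have hFe : ∀ t y : ℝ, F t y = cexp ((-(ζ ^ 2) + (κ + y * I) ^ 2) * t) *
      ((κ + y * I) * h (κ + y * I)) := fun t y => by
    simp only [hF]; rw [← mul_assoc, ← Complex.exp_add]; congr 2; ring
  have hre : ∀ y : ℝ, (-(ζ ^ 2) + ((κ : ℂ) + y * I) ^ 2).re = -((ζ ^ 2).re - κ ^ 2 + y ^ 2) :=
    fun y => by rw [add_re, neg_re, re_line_sq]; ring
  have hre0 : ∀ y : ℝ, (-(ζ ^ 2) + ((κ : ℂ) + y * I) ^ 2).re < 0 := fun y => by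
    rw [hre]; nlinarith [sq_nonneg y]
  have hFi : Integrable (Function.uncurry F) ((volume.restrict (Ioi 0)).prod volume) := by
    rw [integrable_prod_iff']
    · constructor
      · refine Eventually.of_forall fun y => ?_
        simp only [Function.uncurry, hFe]
        exact (integrableOn_exp_mul_complex_Ioi (hre0 y) 0).mul_const _
      · have hn : ∀ y : ℝ, ∫ t in Ioi (0 : ℝ), ‖Function.uncurry F (t, y)‖ =
            ((ζ ^ 2).re - κ ^ 2 + y ^ 2)⁻¹ * ‖((κ : ℂ) + y * I) * h (κ + y * I)‖ := fun y => by
          simp only [Function.uncurry, hFe, norm_mul, Complex.norm_exp, re_mul_ofReal]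
          rw [integral_mul_const, integral_exp_mul_Ioi (hre0 y), hre]
          simp only [mul_zero, Real.exp_zero]
          rw [neg_div_neg_eq, one_div]
        simp_rw [hn]
        refine Integrable.mono' ((integrable_norm_line_rpow (N := -1 - δ) hκ
          (by linarith)).const_mul (c⁻¹ * C)) ?_ (Eventually.of_forall fun y => ?_)
        · refine Continuous.aestronglyMeasurable ?_
          refine Continuous.mul (Continuous.inv₀ (by fun_prop) fun y => ?_)
            (Continuous.norm (Continuous.mul (by fun_prop) hcl))
          nlinarith [sq_nonneg y]
        · have hw := norm_line_pos hκ y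
          have h1 := hC (κ + y * I) (by simp)
          rw [Real.norm_of_nonneg (by
            have : 0 ≤ (ζ ^ 2).re - κ ^ 2 + y ^ 2 := by nlinarith [sq_nonneg y]
            positivity), norm_mul]
          calc _ ≤ (c * ‖(κ : ℂ) + y * I‖ ^ 2)⁻¹ *
                (‖(κ : ℂ) + y * I‖ * (C * ‖(κ : ℂ) + y * I‖ ^ (-δ))) := by
                gcongr
                exact hc y
            _ = c⁻¹ * C * (‖(κ : ℂ) + y * I‖ ^ (-δ) * ‖(κ : ℂ) + y * I‖ ^ (-1 : ℝ)) := by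
                rw [Real.rpow_neg_one]; field_simp
            _ = _ := by rw [← Real.rpow_add hw]; congr 2; ring
    · refine Continuous.aestronglyMeasurable ?_
      simp only [hF, Function.uncurry_def]
      have : Continuous fun p : ℝ × ℝ => h (κ + p.2 * I) := hcl.comp continuous_snd
      exact Continuous.mul (by fun_prop) (Continuous.mul (by fun_prop)
        (Continuous.mul (by fun_prop) this))
  have hcont : ∀ t : ℝ, cexp (-(ζ ^ 2) * t) * contour κ h t =
      (Real.pi : ℂ)⁻¹ * ∫ y : ℝ, F t y := fun t => by
    rw [contour, mul_left_comm, ← integral_const_mul]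
  simp_rw [hcont]
  refine ⟨(hFi.integral_prod_left).const_mul _, ?_⟩
  rw [integral_const_mul, integral_integral_swap hFi]
  have hin : ∀ y : ℝ, ∫ t in Ioi (0 : ℝ), F t y =
      2⁻¹ * (h (κ + y * I) * (2 * (κ + y * I) / (ζ ^ 2 - (κ + y * I) ^ 2))) := fun y => by
    simp only [hFe]
    rw [integral_mul_const, integral_exp_mul_complex_Ioi (hre0 y)]
    have h0 : -(ζ ^ 2) + ((κ : ℂ) + y * I) ^ 2 ≠ 0 := fun h => by
      have := hre0 y; rw [h] at this; simp at this
    have h1 : ζ ^ 2 - ((κ : ℂ) + y * I) ^ 2 ≠ 0 := fun h => h0 (by linear_combination -h)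
    have h2 : -(ζ ^ 2) + ((κ : ℂ) + y * I) ^ 2 = -(ζ ^ 2 - ((κ : ℂ) + y * I) ^ 2) := by ring
    rw [h2]
    simp only [ofReal_zero, mul_zero, Complex.exp_zero]
    field_simp
  simp_rw [hin]
  rw [integral_const_mul, cauchy_vertical hκ hδ hδ1 hh hζ]
  have : (Real.pi : ℂ) ≠ 0 := by exact_mod_cast Real.pi_ne_zero
  field_simp

end DistributedOrder
end

noncomputable section

namespace DistributedOrder

open Complex in
/-- The Laplace transform is holomorphic in its half plane of absolute convergence. -/
theorem differentiableAt_laplace_complex {f : ℝ → ℂ} {s₀ : ℝ}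
    (hi : ∀ s : ℝ, s₀ < s → IntegrableOn (fun t : ℝ => cexp (-s * t) * f t) (Ioi 0))
    {z : ℂ} (hz : s₀ < z.re) :
    DifferentiableAt ℂ (fun z => ∫ t in Ioi (0 : ℝ), cexp (-z * t) * f t) z := by
  set ε : ℝ := (z.re - s₀) / 3 with hε
  have hε0 : 0 < ε := by simp only [hε]; linarith
  have hm : AEStronglyMeasurable f (volume.restrict (Ioi 0)) := by
    have h1 := (hi (s₀ + 1) (by linarith)).aestronglyMeasurable
    have h2 : Continuous fun t : ℝ => cexp (((s₀ + 1 : ℝ) : ℂ) * t) := by fun_prop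
    refine (h2.aestronglyMeasurable.mul h1).congr (Eventually.of_forall fun t => ?_)
    simp only [Pi.mul_apply]
    rw [← mul_assoc, ← Complex.exp_add, neg_mul, add_neg_cancel, Complex.exp_zero, one_mul]
  have hn : ∀ (z : ℂ) (t : ℝ), ‖cexp (-z * t)‖ = Real.exp (-z.re * t) := fun z t => by
    rw [norm_exp, re_mul_ofReal, neg_re]
  refine (hasDerivAt_integral_of_dominated_loc_of_deriv_le (s := Metric.ball z ε)
    (bound := fun t : ℝ => ε⁻¹ * ‖cexp (-(s₀ + ε : ℝ) * t) * f t‖)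
    (F' := fun (z : ℂ) (t : ℝ) => -t * cexp (-z * t) * f t)
    (Metric.ball_mem_nhds z hε0) ?_ ?_ ?_ ?_ ?_ ?_).2.differentiableAt
  · refine Eventually.of_forall fun z => AEStronglyMeasurable.mul ?_ hm
    exact Continuous.aestronglyMeasurable (by fun_prop)
  · refine Integrable.mono (hi z.re hz) ?_ (Eventually.of_forall fun t => ?_)
    · exact AEStronglyMeasurable.mul (Continuous.aestronglyMeasurable (by fun_prop)) hm
    · rw [norm_mul, norm_mul, hn, hn, ofReal_re]
  · exact AEStronglyMeasurable.mul (Continuous.aestronglyMeasurable (by fun_prop)) hm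
  · filter_upwards [ae_restrict_mem measurableSet_Ioi] with t ht z' hz'
    have ht : 0 < t := ht
    have h1 : s₀ + 2 * ε ≤ z'.re := by
      have := (abs_re_le_norm (z' - z)).trans (mem_ball_iff_norm.1 hz').le
      rw [sub_re, abs_le] at this
      simp only [hε] at this ⊢; linarith
    rw [norm_mul, norm_mul, norm_mul, hn, hn, ofReal_re, norm_neg, norm_real,
      Real.norm_of_nonneg ht.le, ← mul_assoc]
    refine mul_le_mul_of_nonneg_right ?_ (norm_nonneg _)
    have h2 : t * ε ≤ Real.exp (ε * t) := by linarith [Real.add_one_le_exp (ε * t)]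
    rw [inv_mul_eq_div, le_div_iff₀ hε0]
    calc t * Real.exp (-z'.re * t) * ε = t * ε * Real.exp (-z'.re * t) := by ring
      _ ≤ Real.exp (ε * t) * Real.exp (-(s₀ + 2 * ε) * t) := by
          gcongr
      _ = Real.exp (-(s₀ + ε) * t) := by rw [← Real.exp_add]; congr 1; ring
  · exact ((hi (s₀ + ε) (by linarith)).norm).const_mul _
  · refine Eventually.of_forall fun t z' _ => ?_
    have h1 : HasDerivAt (fun z : ℂ => -z * t) (-t) z' := by
      simpa using ((hasDerivAt_id z').neg).mul_const (t : ℂ)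
    refine ((h1.cexp).mul_const (f t)).congr_deriv ?_
    ring

open Complex FourierTransform in
/-- A continuous function on `(0, ∞)` with vanishing Laplace transform vanishes. -/
theorem eq_zero_of_laplace_eq_zero {f : ℝ → ℂ} {s₀ : ℝ} (hc : ContinuousOn f (Ioi 0))
    (hi : ∀ s : ℝ, s₀ < s → IntegrableOn (fun t : ℝ => cexp (-s * t) * f t) (Ioi 0))
    (h0 : ∀ s : ℝ, s₀ < s → ∫ t in Ioi (0 : ℝ), cexp (-s * t) * f t = 0) {t : ℝ} (ht : 0 < t) :
    f t = 0 := by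
  set Φ : ℂ → ℂ := fun z => ∫ t in Ioi (0 : ℝ), cexp (-z * t) * f t with hΦ
  have hopen : IsOpen {z : ℂ | s₀ < z.re} := isOpen_lt continuous_const continuous_re
  have hA : AnalyticOnNhd ℂ Φ {z : ℂ | s₀ < z.re} :=
    DifferentiableOn.analyticOnNhd
      (fun z hz => (differentiableAt_laplace_complex hi hz).differentiableWithinAt) hopen
  have hconv : IsPreconnected {z : ℂ | s₀ < z.re} := (convex_halfSpace_re_gt s₀).isPreconnected
  set σ : ℝ := s₀ + 1 with hσ
  have hz0 : EqOn Φ 0 {z : ℂ | s₀ < z.re} := by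
    refine hA.eqOn_zero_of_preconnected_of_frequently_eq_zero hconv
      (z₀ := (σ : ℂ)) (by simp [hσ]) ?_
    have hT : Tendsto (fun n : ℕ => ((σ + 1 / ((n : ℝ) + 1) : ℝ) : ℂ)) atTop (𝓝[≠] (σ : ℂ)) := by
      refine tendsto_nhdsWithin_iff.2 ⟨?_, Eventually.of_forall fun n => ?_⟩
      · have := (tendsto_one_div_add_atTop_nhds_zero_nat (𝕜 := ℝ)).const_add σ
        rw [add_zero] at this
        exact (continuous_ofReal.tendsto _).comp this
      · simp only [mem_compl_iff, mem_singleton_iff, ofReal_inj]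
        have : 0 < 1 / ((n : ℝ) + 1) := by positivity
        linarith
    refine hT.frequently (Frequently.of_forall fun n => ?_)
    have : 0 < 1 / ((n : ℝ) + 1) := by positivity
    exact h0 _ (by simp only [hσ]; linarith)
  set u : ℝ → ℂ := indicator (Ioi 0) fun t : ℝ => cexp (-σ * t) * f t with hu
  have hui : Integrable u := by
    rw [hu, integrable_indicator_iff measurableSet_Ioi]
    exact hi σ (by simp [hσ])
  have hF : 𝓕 u = 0 := by
    ext v
    rw [Real.fourier_real_eq_integral_exp_smul]
    have h1 := hz0 (x := (σ : ℂ) + (2 * Real.pi * v : ℝ) * I) (by simp [hσ])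
    simp only [hΦ, Pi.zero_apply] at h1
    rw [Pi.zero_apply, ← h1, ← integral_indicator measurableSet_Ioi]
    refine integral_congr_ae (Eventually.of_forall fun t => ?_)
    by_cases ht : t ∈ Ioi (0 : ℝ)
    · simp only [hu, indicator_of_mem ht, smul_eq_mul]
      rw [← mul_assoc, ← Complex.exp_add]
      congr 2; push_cast; ring
    · simp only [hu, indicator_of_notMem ht, smul_zero]
  have hut : ContinuousAt u t := by
    have h1 : ContinuousAt (fun t : ℝ => cexp (-σ * t) * f t) t :=
      ContinuousAt.mul (by fun_prop) (hc.continuousAt (Ioi_mem_nhds ht))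
    refine h1.congr ?_
    filter_upwards [Ioi_mem_nhds ht] with τ hτ
    rw [hu, indicator_of_mem hτ]
  have h2 := hui.fourierInv_fourier_eq (by rw [hF]; exact integrable_zero _ _ _) hut
  rw [hF] at h2
  have h3 : u t = 0 := by rw [← h2]; simp [Real.fourierInv_eq]
  rw [hu, indicator_of_mem (mem_Ioi.2 ht)] at h3
  exact (mul_eq_zero.1 h3).resolve_left (Complex.exp_ne_zero _)

open Complex in
theorem eq_of_laplace_complex_eq {f g : ℝ → ℂ} {s₀ : ℝ} (hf : ContinuousOn f (Ioi 0))
    (hg : ContinuousOn g (Ioi 0))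
    (hfi : ∀ s : ℝ, s₀ < s → IntegrableOn (fun t : ℝ => cexp (-s * t) * f t) (Ioi 0))
    (hgi : ∀ s : ℝ, s₀ < s → IntegrableOn (fun t : ℝ => cexp (-s * t) * g t) (Ioi 0))
    (h : ∀ s : ℝ, s₀ < s → ∫ t in Ioi (0 : ℝ), cexp (-s * t) * f t =
      ∫ t in Ioi (0 : ℝ), cexp (-s * t) * g t) {t : ℝ} (ht : 0 < t) : f t = g t := by
  refine sub_eq_zero.1 (eq_zero_of_laplace_eq_zero (f := fun t => f t - g t) (s₀ := s₀)
    (hf.sub hg) (fun s hs => ?_) (fun s hs => ?_) ht)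
  · simp only [mul_sub]
    exact (hfi s hs).sub (hgi s hs)
  · simp only [mul_sub]
    rw [integral_sub (hfi s hs) (hgi s hs), h s hs, sub_self]

theorem eq_of_laplace_eq {f g : ℝ → ℝ} {s₀ : ℝ} (hf : ContinuousOn f (Ioi 0))
    (hg : ContinuousOn g (Ioi 0))
    (hfi : ∀ s : ℝ, s₀ < s → IntegrableOn (fun t : ℝ => Real.exp (-s * t) * f t) (Ioi 0))
    (hgi : ∀ s : ℝ, s₀ < s → IntegrableOn (fun t : ℝ => Real.exp (-s * t) * g t) (Ioi 0))
    (h : ∀ s : ℝ, s₀ < s → laplace f s = laplace g s) {t : ℝ} (ht : 0 < t) : f t = g t := by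
  have e : ∀ (u : ℝ → ℝ) (s : ℝ), (fun t : ℝ => Complex.exp (-s * t) * (u t : ℂ)) =
      fun t => ((Real.exp (-s * t) * u t : ℝ) : ℂ) := fun u s => by ext t; push_cast; rfl
  have := eq_of_laplace_complex_eq (f := fun t => (f t : ℂ)) (g := fun t => (g t : ℂ)) (s₀ := s₀)
    (Complex.continuous_ofReal.comp_continuousOn hf) (Complex.continuous_ofReal.comp_continuousOn hg)
    (fun s hs => by rw [e f s]; exact (hfi s hs).ofReal)
    (fun s hs => by rw [e g s]; exact (hgi s hs).ofReal)
    (fun s hs => by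
      rw [e f s, e g s, integral_complex_ofReal, integral_complex_ofReal]
      exact congrArg _ (h s hs)) ht
  exact_mod_cast this

theorem integrableOn_Ioc_of_laplace {f : ℝ → ℝ} {s : ℝ}
    (hi : IntegrableOn (fun t : ℝ => Real.exp (-s * t) * f t) (Ioi 0)) (T : ℝ) :
    IntegrableOn f (Ioc 0 T) := by
  have h1 : IntegrableOn (fun t : ℝ => Real.exp (-s * t) * f t) (Ioc 0 T) :=
    hi.mono_set Ioc_subset_Ioi_self
  have h2 := h1.continuousOn_mul_of_subset (K := Icc 0 T) (g := fun t => Real.exp (s * t))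
    (by fun_prop) isCompact_Icc measurableSet_Ioc Ioc_subset_Icc_self
  refine h2.congr_fun (fun t _ => ?_) measurableSet_Ioc
  simp only
  rw [← mul_assoc, ← Real.exp_add]
  simp

theorem conv_intervalIntegrable {f g : ℝ → ℝ} (hf : ContinuousOn f (Ioi 0))
    (hg : ContinuousOn g (Ioi 0)) (hfi : ∀ T, IntegrableOn f (Ioc 0 T))
    (hgi : ∀ T, IntegrableOn g (Ioc 0 T)) {t : ℝ} (ht : 0 < t) :
    IntervalIntegrable (fun ξ => f (t - ξ) * g ξ) volume 0 t := by
  have hI : ∀ {u : ℝ → ℝ} {T : ℝ}, 0 < T → (∀ T, IntegrableOn u (Ioc 0 T)) →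
      IntervalIntegrable u volume 0 T := fun hT hu =>
    (intervalIntegrable_iff_integrableOn_Ioc_of_le hT.le).2 (hu _)
  have hmaps : ∀ {u : ℝ → ℝ} {s : Set ℝ}, ContinuousOn u (Ioi 0) → (∀ ξ ∈ s, ξ < t) →
      ContinuousOn (fun ξ => u (t - ξ)) s := fun hu hs =>
    hu.comp (by fun_prop) fun ξ hξ => sub_pos.2 (hs ξ hξ)
  refine IntervalIntegrable.trans (b := t / 2) ?_ ?_
  · refine (hI (half_pos ht) hgi).continuousOn_mul (hmaps hf fun ξ hξ => ?_)
    rw [uIcc_of_le (half_pos ht).le] at hξ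
    linarith [hξ.2]
  · have h1 : IntervalIntegrable (fun ξ => f (t - ξ)) volume (t / 2) t := by
      have := (hI (half_pos ht) hfi).comp_sub_left t
      simpa [sub_half] using this.symm
    refine h1.mul_continuousOn (hg.mono fun ξ hξ => ?_)
    rw [uIcc_of_le (half_le_self ht.le)] at hξ
    exact mem_Ioi.2 (by linarith [hξ.1])

theorem continuousAt_partial_conv {f g β : ℝ → ℝ} {t₀ c : ℝ} (ht₀ : 0 < t₀) (hc : 0 < c)
    (hf : ∀ T, IntegrableOn f (Ioc 0 T)) (hg : ContinuousOn g (Ioi 0)) (hβ : Continuous β)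
    (hβ0 : ∀ᶠ t in 𝓝 t₀, 0 ≤ β t ∧ β t ≤ t - c) :
    ContinuousAt (fun t => ∫ ξ in (0 : ℝ)..β t, f ξ * g (t - ξ)) t₀ := by
  have hev : (fun t => ∫ ξ in (0 : ℝ)..β t, f ξ * g (t - ξ)) =ᶠ[𝓝 t₀] fun t =>
      ∫ ξ in Ioc 0 (2 * t₀), (Iic (β t)).indicator (fun ξ => f ξ * g (t - ξ)) ξ := by
    filter_upwards [hβ0, gt_mem_nhds (by linarith : t₀ < 2 * t₀)] with t h1 h2
    rw [intervalIntegral.integral_of_le h1.1, setIntegral_indicator measurableSet_Iic,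
      Ioc_inter_Iic, min_eq_right (by linarith [h1.2])]
  refine ContinuousAt.congr ?_ hev.symm
  obtain ⟨M, hM⟩ : ∃ M, ∀ x ∈ Icc c (2 * t₀), ‖g x‖ ≤ M :=
    isCompact_Icc.exists_bound_of_continuousOn
      (hg.mono fun x hx => mem_Ioi.2 (by linarith [hx.1]))
  have hmeas : ∀ t : ℝ, AEStronglyMeasurable ((Iio t).indicator fun ξ => g (t - ξ))
      (volume.restrict (Ioc 0 (2 * t₀))) := fun t => by
    refine AEStronglyMeasurable.restrict ?_
    refine (aestronglyMeasurable_indicator_iff measurableSet_Iio).2 ?_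
    exact ContinuousOn.aestronglyMeasurable
      (hg.comp (by fun_prop) fun ξ hξ => mem_Ioi.2 (sub_pos.2 (mem_Iio.1 hξ))) measurableSet_Iio
  refine continuousAt_of_dominated (bound := fun ξ => ‖f ξ‖ * M) ?_ ?_ ?_ ?_
  · filter_upwards [hβ0] with t ht
    refine (((hf (2 * t₀)).aestronglyMeasurable.mul (hmeas t)).indicator
      (measurableSet_Iic (a := β t))).congr (Eventually.of_forall fun ξ => ?_)
    by_cases hξ : ξ ∈ Iic (β t)
    · have : ξ ∈ Iio t := mem_Iio.2 (by have := mem_Iic.1 hξ; linarith [ht.2])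
      simp [indicator_of_mem hξ, indicator_of_mem this]
    · simp [indicator_of_notMem hξ]
  · filter_upwards [hβ0, gt_mem_nhds (by linarith : t₀ < 2 * t₀)] with t h1 h2
    filter_upwards [ae_restrict_mem measurableSet_Ioc] with ξ hξ
    by_cases h3 : ξ ≤ β t
    · rw [indicator_of_mem (mem_Iic.2 h3), norm_mul]
      exact mul_le_mul_of_nonneg_left (hM (t - ξ) ⟨by linarith [h1.2], by linarith [hξ.1]⟩)
        (norm_nonneg _)
    · rw [indicator_of_notMem (by simpa using h3), norm_zero]
      refine mul_nonneg (norm_nonneg _) ((norm_nonneg _).trans (hM (2 * t₀) ⟨?_, le_rfl⟩))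
      linarith [h1.1, h1.2]
  · exact ((hf (2 * t₀)).norm).mul_const M
  · have hne : ∀ᵐ ξ : ℝ ∂(volume.restrict (Ioc 0 (2 * t₀))), ξ ≠ β t₀ :=
      ae_restrict_of_ae (Measure.ae_ne volume (β t₀))
    filter_upwards [hne] with ξ hξ
    rcases lt_or_gt_of_ne hξ with h | h
    · have hpos : 0 < t₀ - ξ := by linarith [hβ0.self_of_nhds.2]
      have hgc : ContinuousAt (fun t => f ξ * g (t - ξ)) t₀ := by
        refine ContinuousAt.mul continuousAt_const ?_
        exact ContinuousAt.comp (f := fun t => t - ξ) (g := g)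
          (hg.continuousAt (Ioi_mem_nhds hpos)) (by fun_prop)
      refine hgc.congr ?_
      filter_upwards [hβ.continuousAt.eventually (lt_mem_nhds h)] with t ht
      rw [indicator_of_mem (mem_Iic.2 ht.le)]
    · refine (continuousAt_const (y := (0 : ℝ))).congr ?_
      filter_upwards [hβ.continuousAt.eventually (gt_mem_nhds h)] with t ht
      rw [indicator_of_notMem (by simpa using ht)]

theorem continuousOn_conv {f g : ℝ → ℝ} (hf : ContinuousOn f (Ioi 0))
    (hg : ContinuousOn g (Ioi 0)) (hfi : ∀ T, IntegrableOn f (Ioc 0 T))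
    (hgi : ∀ T, IntegrableOn g (Ioc 0 T)) :
    ContinuousOn (fun t => ∫ ξ in (0 : ℝ)..t, f (t - ξ) * g ξ) (Ioi 0) := by
  intro t₀ ht₀
  have ht₀ : 0 < t₀ := ht₀
  refine ContinuousAt.continuousWithinAt ?_
  have h1 : ContinuousAt (fun t => ∫ ξ in (0 : ℝ)..(t₀ / 2), g ξ * f (t - ξ)) t₀ := by
    refine continuousAt_partial_conv (β := fun _ => t₀ / 2) (c := t₀ / 4) ht₀ (by linarith)
      hgi hf continuous_const ?_
    filter_upwards [lt_mem_nhds (by linarith : 3 * t₀ / 4 < t₀)] with t ht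
    constructor <;> linarith
  have h2 : ContinuousAt (fun t => ∫ ξ in (0 : ℝ)..(t - t₀ / 2), f ξ * g (t - ξ)) t₀ := by
    refine continuousAt_partial_conv (β := fun t => t - t₀ / 2) (c := t₀ / 2) ht₀ (by linarith)
      hfi hg (by fun_prop) ?_
    filter_upwards [lt_mem_nhds (by linarith : 3 * t₀ / 4 < t₀)] with t ht
    constructor <;> linarith
  refine (h1.add h2).congr ?_
  filter_upwards [lt_mem_nhds (by linarith : 3 * t₀ / 4 < t₀)] with t ht
  have hI := conv_intervalIntegrable hf hg hfi hgi (by linarith : 0 < t)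
  have e2 : ∫ ξ in (0 : ℝ)..(t - t₀ / 2), f ξ * g (t - ξ) =
      ∫ ξ in (t₀ / 2)..t, f (t - ξ) * g ξ := by
    have := intervalIntegral.integral_comp_sub_left (a := t₀ / 2) (b := t)
      (fun ξ => f ξ * g (t - ξ)) t
    simp only [sub_sub_cancel, sub_self] at this
    exact this.symm
  have e1 : ∫ ξ in (0 : ℝ)..(t₀ / 2), g ξ * f (t - ξ) =
      ∫ ξ in (0 : ℝ)..(t₀ / 2), f (t - ξ) * g ξ := by simp only [mul_comm]
  simp only [Pi.add_apply]
  rw [e1, e2]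
  refine intervalIntegral.integral_add_adjacent_intervals ?_ ?_
  · refine hI.mono_set ?_
    rw [uIcc_of_le (by linarith), uIcc_of_le (by linarith)]
    exact Icc_subset_Icc le_rfl (by linarith)
  · refine hI.mono_set ?_
    rw [uIcc_of_le (by linarith), uIcc_of_le (by linarith)]
    exact Icc_subset_Icc (by linarith) le_rfl

/-- The Laplace transform of a convolution. -/
theorem laplace_conv {f g : ℝ → ℝ} {s : ℝ}
    (hfi : IntegrableOn (fun t : ℝ => Real.exp (-s * t) * f t) (Ioi 0))
    (hgi : IntegrableOn (fun t : ℝ => Real.exp (-s * t) * g t) (Ioi 0)) :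
    IntegrableOn (fun t : ℝ => Real.exp (-s * t) * ∫ ξ in (0 : ℝ)..t, f (t - ξ) * g ξ) (Ioi 0) ∧
      laplace (fun t => ∫ ξ in (0 : ℝ)..t, f (t - ξ) * g ξ) s = laplace f s * laplace g s := by
  have e : ∀ t : ℝ, Real.exp (-s * t) * ∫ ξ in (0 : ℝ)..t, f (t - ξ) * g ξ =
      ∫ ξ in (0 : ℝ)..t, ContinuousLinearMap.mul ℝ ℝ (Real.exp (-s * ξ) * g ξ)
        (Real.exp (-s * (t - ξ)) * f (t - ξ)) := fun t => by
    rw [← intervalIntegral.integral_const_mul]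
    refine intervalIntegral.integral_congr fun ξ _ => ?_
    simp only [ContinuousLinearMap.mul_apply']
    rw [show -s * t = -s * ξ + -s * (t - ξ) by ring, Real.exp_add]
    ring
  constructor
  · have h1 := integrable_posConvolution hgi hfi (ContinuousLinearMap.mul ℝ ℝ)
    refine h1.integrableOn.congr_fun (s := Ioi 0) (fun t ht => ?_) measurableSet_Ioi
    rw [posConvolution, indicator_of_mem ht]
    exact (e t).symm
  · simp only [laplace, e]
    rw [integral_posConvolution hgi hfi]
    simp [mul_comm]

end DistributedOrder
end

noncomputable section

namespace DistributedOrder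

theorem laplace_rpow {a s : ℝ} (ha : 0 < a) (hs : 0 < s) :
    IntegrableOn (fun t : ℝ => Real.exp (-s * t) * (t ^ (a - 1) / Real.Gamma a)) (Ioi 0) ∧
      laplace (fun t => t ^ (a - 1) / Real.Gamma a) s = s ^ (-a) := by
  have hG := Real.Gamma_pos_of_pos ha
  have key := Real.integral_rpow_mul_exp_neg_mul_Ioi ha hs
  have hpos : 0 < (1 / s) ^ a * Real.Gamma a := by positivity
  have hi : IntegrableOn (fun t : ℝ => t ^ (a - 1) * Real.exp (-(s * t))) (Ioi 0) := by
    by_contra hcon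
    rw [integral_undef hcon] at key
    exact hpos.ne key
  have e : (fun t : ℝ => Real.exp (-s * t) * (t ^ (a - 1) / Real.Gamma a)) =
      fun t => (Real.Gamma a)⁻¹ * (t ^ (a - 1) * Real.exp (-(s * t))) := by
    ext t; rw [neg_mul]; ring
  refine ⟨by rw [e]; exact hi.const_mul _, ?_⟩
  rw [laplace, e, integral_const_mul, key, one_div, Real.inv_rpow hs.le, Real.rpow_neg hs.le]
  field_simp

/-- Differentiation lowers the exponent of `t ^ (a - 1) / Γ(a)`, also at the poles of `Γ`. -/
theorem hasDerivAt_rpow_div_Gamma (a : ℝ) {t : ℝ} (ht : 0 < t) :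
    HasDerivAt (fun t : ℝ => t ^ (a - 1) / Real.Gamma a)
      (t ^ (a - 1 - 1) / Real.Gamma (a - 1)) t := by
  refine ((Real.hasDerivAt_rpow_const (p := a - 1) (Or.inl ht.ne')).div_const _).congr_deriv ?_
  by_cases ha : a - 1 = 0
  · rw [ha, Real.Gamma_zero]; simp
  · have h1 : Real.Gamma a = (a - 1) * Real.Gamma (a - 1) := by
      rw [← Real.Gamma_add_one ha]; congr 1; ring
    rw [h1, mul_div_mul_left _ _ ha]

/-- The inverse Laplace transform of `s ^ (-a)`. -/
theorem contour_cpow {κ : ℝ} (hκ : 0 < κ) (a : ℝ) {t : ℝ} (ht : 0 < t) :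
    contour κ (fun w => w ^ ((-2 * a : ℝ) : ℂ)) t = ((t ^ (a - 1) / Real.Gamma a : ℝ) : ℂ) := by
  have hpos : ∀ a : ℝ, 0 < a → ∀ t : ℝ, 0 < t → contour κ (fun w => w ^ ((-2 * a : ℝ) : ℂ)) t =
      ((t ^ (a - 1) / Real.Gamma a : ℝ) : ℂ) := fun a ha t ht => by
    have hA : Adm κ (-(2 * a)) (fun w => w ^ ((-2 * a : ℝ) : ℂ)) := by
      rw [← neg_mul]; exact Adm.cpow hκ _
    have e : ∀ s : ℝ, (fun t : ℝ => Complex.exp (-s * t) *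
        ((t ^ (a - 1) / Real.Gamma a : ℝ) : ℂ)) =
        fun t => ((Real.exp (-s * t) * (t ^ (a - 1) / Real.Gamma a) : ℝ) : ℂ) := fun s => by
      ext t; push_cast; rfl
    have hz : ∀ s : ℝ, κ ^ 2 < s → κ < (((√s : ℝ) : ℂ)).re ∧
        κ ^ 2 < ((((√s : ℝ) : ℂ)) ^ 2).re ∧ (((√s : ℝ) : ℂ)) ^ 2 = s := fun s hs => by
      have h0 : 0 ≤ s := (sq_nonneg κ).trans hs.le
      have h2 : (((√s : ℝ) : ℂ)) ^ 2 = s := by rw [← Complex.ofReal_pow, Real.sq_sqrt h0]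
      rw [h2]
      exact ⟨by rw [Complex.ofReal_re]; exact Real.lt_sqrt_of_sq_lt hs, by simpa using hs, rfl⟩
    refine eq_of_laplace_complex_eq (s₀ := κ ^ 2) (g := fun t : ℝ =>
      ((t ^ (a - 1) / Real.Gamma a : ℝ) : ℂ)) (hA.continuousOn_contour hκ)
      (fun t ht => (hasDerivAt_rpow_div_Gamma a ht).ofReal_comp.continuousAt.continuousWithinAt)
      (fun s hs => ?_) (fun s hs => ?_) (fun s hs => ?_) ht
    · obtain ⟨h1, h2, h3⟩ := hz s hs
      have := (hA.laplace_contour hκ (by positivity) h1 h2).1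
      rwa [h3] at this
    · rw [e]
      exact (laplace_rpow ha ((by positivity : 0 < κ ^ 2).trans hs)).1.ofReal
    · have hs0 : 0 < s := (by positivity : 0 < κ ^ 2).trans hs
      obtain ⟨h1, h2, h3⟩ := hz s hs
      have := (hA.laplace_contour hκ (by positivity) h1 h2).2
      rw [h3] at this
      rw [this, e, integral_complex_ofReal]
      have h4 := (laplace_rpow ha hs0).2
      rw [laplace] at h4
      rw [h4, ← Complex.ofReal_cpow (Real.sqrt_nonneg s), Real.sqrt_eq_rpow,
        ← Real.rpow_mul hs0.le]
      congr 2; ring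
  have hall : ∀ n : ℕ, ∀ a : ℝ, -n < a → ∀ t : ℝ, 0 < t →
      contour κ (fun w => w ^ ((-2 * a : ℝ) : ℂ)) t =
      ((t ^ (a - 1) / Real.Gamma a : ℝ) : ℂ) := by
    intro n
    induction n with
    | zero => intro a ha; exact hpos a (by simpa using ha)
    | succ n ih =>
      intro a ha t ht
      have hA : Adm κ (-2 * (a + 1)) (fun w => w ^ ((-2 * (a + 1) : ℝ) : ℂ)) := Adm.cpow hκ _
      have h1 := hA.hasDerivAt_contour hκ ht
      have h2 : HasDerivAt (contour κ fun w => w ^ ((-2 * (a + 1) : ℝ) : ℂ))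
          ((t ^ (a - 1) / Real.Gamma a : ℝ) : ℂ) t := by
        have h3 := (hasDerivAt_rpow_div_Gamma (a + 1) ht).ofReal_comp
        rw [add_sub_cancel_right] at h3
        refine h3.congr_of_eventuallyEq ?_
        filter_upwards [Ioi_mem_nhds ht] with τ hτ
        rw [ih (a + 1) (by push_cast at ha; linarith) τ hτ, add_sub_cancel_right]
      rw [← h1.unique h2]
      refine contour_congr (fun y => ?_) t
      have hw : (κ : ℂ) + y * Complex.I ≠ 0 := norm_pos_iff.1 (norm_line_pos hκ y)
      rw [← Complex.cpow_ofNat, ← Complex.cpow_add _ _ hw]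
      congr 1; push_cast; ring
  obtain ⟨n, hn⟩ := exists_nat_gt (-a)
  exact hall n a (by linarith) t ht

theorem contour_inv_sq {κ : ℝ} (hκ : 0 < κ) {t : ℝ} (ht : 0 < t) :
    contour κ (fun w => (w ^ 2)⁻¹) t = 1 := by
  have h := contour_cpow hκ 1 ht
  simp only [sub_self, Real.rpow_zero, Real.Gamma_one, div_one, Complex.ofReal_one] at h
  rw [← h]
  refine contour_congr (fun y => ?_) t
  rw [mul_one, Complex.ofReal_neg, Complex.cpow_neg]
  norm_num

/-! ### The binomial series -/

theorem poch_div_factorial (γ : ℝ) (j : ℕ) :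
    ((poch γ j / j.factorial : ℝ) : ℂ) = Ring.choose ((γ : ℂ) + j - 1) j := by
  have h0 : (j.factorial : ℂ) ≠ 0 := by exact_mod_cast j.factorial_ne_zero
  have h1 : (j.factorial : ℂ) * Ring.choose ((γ : ℂ) + j - 1) j =
      (ascPochhammer ℂ j).eval (γ : ℂ) := by
    rw [← Ring.multichoose_eq, ← nsmul_eq_mul, Ring.factorial_nsmul_multichoose_eq_ascPochhammer,
      Polynomial.ascPochhammer_smeval_eq_eval]
  have h2 : (ascPochhammer ℂ j).eval (γ : ℂ) = ((poch γ j : ℝ) : ℂ) := by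
    rw [ascPochhammer_eval₂ Complex.ofRealHom]
    exact Polynomial.eval₂_at_apply Complex.ofRealHom γ
  rw [Complex.ofReal_div, ← h2, ← h1, Complex.ofReal_natCast, mul_div_cancel_left₀ _ h0]

theorem hasSum_binomial (γ : ℝ) {z : ℂ} (hz : ‖z‖ < 1) :
    HasSum (fun j : ℕ => ((poch γ j / j.factorial : ℝ) : ℂ) * (-z) ^ j)
      ((1 + z) ^ ((-γ : ℝ) : ℂ)) ∧
    Summable fun j : ℕ => |poch γ j / j.factorial| * ‖z‖ ^ j := by
  have hp := Complex.one_div_one_sub_cpow_hasFPowerSeriesOnBall_zero (γ : ℂ)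
  have hmem : -z ∈ Metric.eball (0 : ℂ) 1 := by
    rw [← ENNReal.ofReal_one, Metric.eball_ofReal]; simpa using hz
  have e : ∀ j : ℕ, (FormalMultilinearSeries.ofScalars ℂ fun n : ℕ =>
      Ring.choose ((γ : ℂ) + n - 1) n) j (fun _ => -z) =
      ((poch γ j / j.factorial : ℝ) : ℂ) * (-z) ^ j := fun j => by
    rw [FormalMultilinearSeries.ofScalars_apply_eq, poch_div_factorial, smul_eq_mul]
  constructor
  · have h1 := hp.hasSum hmem
    simp only [e, zero_add, sub_neg_eq_add] at h1
    rwa [one_div, ← Complex.cpow_neg, ← Complex.ofReal_neg] at h1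
  · have h1 := FormalMultilinearSeries.summable_norm_apply _
      (Metric.eball_subset_eball hp.r_le hmem)
    simp only [e, norm_mul, norm_pow, norm_neg, Complex.norm_real, Real.norm_eq_abs] at h1
    exact h1

theorem norm_rpow_le_of_nonpos {κ e : ℝ} (hκ : 0 < κ) (he : e ≤ 0) {w : ℂ} (hw : κ ≤ w.re) :
    ‖w‖ ^ e ≤ κ ^ e :=
  Real.rpow_le_rpow_of_nonpos hκ (hw.trans (Complex.re_le_norm w)) he

theorem norm_lam_cpow_le {κ α lam : ℝ} (hκ : 0 < κ) (hα : 0 ≤ α) {w : ℂ} (hw : κ ≤ w.re) :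
    ‖(lam : ℂ) * w ^ ((-2 * α : ℝ) : ℂ)‖ ≤ |lam| * κ ^ (-2 * α) := by
  rw [norm_mul, Complex.norm_real, Real.norm_eq_abs, Complex.norm_cpow_real]
  exact mul_le_mul_of_nonneg_left (norm_rpow_le_of_nonpos hκ (by linarith) hw) (abs_nonneg _)

theorem Adm.one_add_cpow {κ α lam : ℝ} (hκ : 0 < κ) (hα : 0 ≤ α)
    (hlam : |lam| * κ ^ (-2 * α) < 1) (e : ℝ) :
    Adm κ 0 fun w => (1 + lam * w ^ ((-2 * α : ℝ) : ℂ)) ^ (e : ℂ) := by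
  set ρ := |lam| * κ ^ (-2 * α) with hρ
  refine ⟨fun w hw => ?_, (1 + ρ) ^ e + (1 - ρ) ^ e, ?_, fun w hw => ?_⟩
  · have h1 := norm_lam_cpow_le (lam := lam) hκ hα hw
    refine DifferentiableAt.cpow ?_ (differentiableAt_const _) ?_
    · exact (((Adm.cpow hκ (-2 * α)).diff w hw).const_mul _).const_add _
    · exact Complex.mem_slitPlane_of_norm_lt_one (h1.trans_lt hlam)
  · have : 0 ≤ ρ := by positivity
    have : 0 < 1 - ρ := by linarith
    positivity
  · have hρ0 : 0 ≤ ρ := by positivity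
    have h1 := norm_lam_cpow_le (lam := lam) hκ hα hw
    rw [Complex.norm_cpow_real, Real.rpow_zero, mul_one]
    have h2 : ‖1 + (lam : ℂ) * w ^ ((-2 * α : ℝ) : ℂ)‖ ≤ 1 + ρ := by
      refine (norm_add_le _ _).trans ?_
      rw [norm_one]; linarith
    have h3 : 1 - ρ ≤ ‖1 + (lam : ℂ) * w ^ ((-2 * α : ℝ) : ℂ)‖ := by
      have := norm_sub_norm_le (1 : ℂ) (-((lam : ℂ) * w ^ ((-2 * α : ℝ) : ℂ)))
      rw [norm_neg, norm_one, sub_neg_eq_add] at this; linarith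
    have h4 : 0 < 1 - ρ := by linarith
    rcases le_total 0 e with he | he
    · have := Real.rpow_le_rpow (norm_nonneg _) h2 he
      have : 0 ≤ (1 - ρ) ^ e := by positivity
      linarith
    · have := Real.rpow_le_rpow_of_nonpos h4 h3 he
      have : 0 ≤ (1 + ρ) ^ e := by positivity
      linarith

/-- The Laplace transform of the Prabhakar function, in the variable `w = √s`. -/
def prabSym (γ α β lam : ℝ) (w : ℂ) : ℂ :=
  w ^ ((-2 * β : ℝ) : ℂ) * (1 + lam * w ^ ((-2 * α : ℝ) : ℂ)) ^ ((-γ : ℝ) : ℂ)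

theorem adm_prabSym {κ α lam : ℝ} (hκ : 0 < κ) (hα : 0 ≤ α)
    (hlam : |lam| * κ ^ (-2 * α) < 1) (γ β : ℝ) : Adm κ (-2 * β) (prabSym γ α β lam) := by
  have := (Adm.cpow hκ (-2 * β)).mul hκ (Adm.one_add_cpow hκ hα hlam (-γ))
  rwa [add_zero] at this

theorem hasSum_prabSym {κ α lam : ℝ} (hκ : 0 < κ) (hα : 0 ≤ α)
    (hlam : |lam| * κ ^ (-2 * α) < 1) (γ β : ℝ) {w : ℂ} (hw : κ ≤ w.re) :
    HasSum (fun j : ℕ => ((poch γ j * (-lam) ^ j / j.factorial : ℝ) : ℂ) *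
      w ^ ((-2 * (β + α * j) : ℝ) : ℂ)) (prabSym γ α β lam w) := by
  have h1 := (hasSum_binomial γ ((norm_lam_cpow_le (lam := lam) hκ hα hw).trans_lt hlam)).1
  refine (h1.mul_left (w ^ ((-2 * β : ℝ) : ℂ))).congr_fun fun j => ?_
  have hw0 : w ≠ 0 := fun h => by rw [h] at hw; simp at hw; linarith
  have e : w ^ ((-2 * (β + α * j) : ℝ) : ℂ) =
      w ^ ((-2 * β : ℝ) : ℂ) * (w ^ ((-2 * α : ℝ) : ℂ)) ^ j := by
    rw [← Complex.cpow_mul_nat, ← Complex.cpow_add _ _ hw0]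
    congr 1; push_cast; ring
  rw [e]; push_cast; ring

theorem summable_prab_coeff {x lam : ℝ} (hx : 0 ≤ x) (hlam : |lam| * x < 1) (γ : ℝ) :
    Summable fun j : ℕ => |poch γ j * (-lam) ^ j / j.factorial| * x ^ j := by
  have h : ‖((|lam| * x : ℝ) : ℂ)‖ = |lam| * x := by
    rw [Complex.norm_real, Real.norm_of_nonneg (by positivity)]
  refine ((hasSum_binomial γ (h.trans_lt hlam)).2).congr fun j => ?_
  rw [h, abs_div, abs_div, abs_mul, abs_pow, abs_neg, mul_pow]
  ring

theorem norm_prab_term_le {κ α lam : ℝ} (hκ : 0 < κ) (hα : 0 ≤ α) (γ β : ℝ) (j : ℕ) {w : ℂ}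
    (hw : κ ≤ w.re) :
    ‖((poch γ j * (-lam) ^ j / j.factorial : ℝ) : ℂ) * w ^ ((-2 * (β + α * j) : ℝ) : ℂ)‖ ≤
      |poch γ j * (-lam) ^ j / j.factorial| * (κ ^ (-2 * α)) ^ j * ‖w‖ ^ (-2 * β) := by
  have hw1 := hw.trans (Complex.re_le_norm w)
  have hw0 : 0 < ‖w‖ := hκ.trans_le hw1
  rw [norm_mul, Complex.norm_real, Real.norm_eq_abs, Complex.norm_cpow_real, mul_assoc]
  gcongr
  rw [show -2 * (β + α * j) = (-2 * α) * j + -2 * β by ring, Real.rpow_add hw0,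
    Real.rpow_mul_natCast hw0.le]
  refine mul_le_mul_of_nonneg_right ?_ (by positivity)
  exact pow_le_pow_left₀ (by positivity) (norm_rpow_le_of_nonpos hκ (by linarith) hw) j

theorem hasSum_prabhakar {κ α lam : ℝ} (hκ : 0 < κ) (hα : 0 ≤ α)
    (hlam : |lam| * κ ^ (-2 * α) < 1) (γ β : ℝ) {t : ℝ} (ht : 0 < t) :
    HasSum (fun j : ℕ => poch γ j * (-lam) ^ j / j.factorial *
      (t ^ (β + α * j - 1) / Real.Gamma (β + α * j))) (prabhakar γ α β lam t) ∧
    contour κ (prabSym γ α β lam) t = ((prabhakar γ α β lam t : ℝ) : ℂ) := by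
  set c : ℕ → ℝ := fun j => poch γ j * (-lam) ^ j / j.factorial with hc
  obtain ⟨K, hK, hKb⟩ := norm_integrand_le hκ (σ := |β| + 2) (by positivity)
  have hsum := summable_prab_coeff (x := κ ^ (-2 * α)) (by positivity) hlam γ
  set D : ℝ → ℝ := fun y => K * Real.exp (2 * κ ^ 2 * t) * t ^ (-(|β| + 2)) *
    ‖(κ : ℂ) + y * Complex.I‖ ^ (-2 * β + 1 - 2 * (|β| + 2)) with hD
  have hI : HasSum (fun j : ℕ => ∫ y : ℝ, Complex.exp ((κ + y * Complex.I) ^ 2 * t) *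
      ((κ + y * Complex.I) * ((c j : ℂ) *
        ((κ : ℂ) + y * Complex.I) ^ ((-2 * (β + α * j) : ℝ) : ℂ))))
      (∫ y : ℝ, Complex.exp ((κ + y * Complex.I) ^ 2 * t) *
        ((κ + y * Complex.I) * prabSym γ α β lam (κ + y * Complex.I))) := by
    refine hasSum_integral_of_dominated_convergence
      (fun j y => |c j| * (κ ^ (-2 * α)) ^ j * D y) (fun j => ?_) (fun j => ?_) ?_ ?_ ?_
    · exact measurable_integrand (h := fun w => (c j : ℂ) * w ^ ((-2 * (β + α * j) : ℝ) : ℂ))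
        ((Adm.cpow hκ _).const_mul (c j : ℂ)).continuous_line t
    · refine Eventually.of_forall fun y => ?_
      refine (hKb (-2 * β) _ t y _ ht
        (norm_prab_term_le (lam := lam) hκ hα γ β j (by simp))).trans (le_of_eq ?_)
      simp only [hD, hc]; ring
    · exact Eventually.of_forall fun y => hsum.mul_right _
    · simp_rw [tsum_mul_right]
      exact ((integrable_norm_line_rpow hκ (by
        linarith [neg_abs_le β, abs_nonneg β])).const_mul _).const_mul _
    · refine Eventually.of_forall fun y => ?_
      exact ((hasSum_prabSym hκ hα hlam γ β (by simp)).mul_left _).mul_left _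
  have h2 := (hI.mul_left ((Real.pi : ℂ)⁻¹))
  have e : ∀ j : ℕ, (Real.pi : ℂ)⁻¹ * ∫ y : ℝ, Complex.exp ((κ + y * Complex.I) ^ 2 * t) *
      ((κ + y * Complex.I) * ((c j : ℂ) *
        ((κ : ℂ) + y * Complex.I) ^ ((-2 * (β + α * j) : ℝ) : ℂ))) =
      ((c j * (t ^ (β + α * j - 1) / Real.Gamma (β + α * j)) : ℝ) : ℂ) := fun j => by
    rw [Complex.ofReal_mul (c j), ← contour_cpow hκ _ ht, ← contour_const_mul, contour]
  simp only [e] at h2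
  have h3 : HasSum (fun j : ℕ => c j * (t ^ (β + α * j - 1) / Real.Gamma (β + α * j)))
      (contour κ (prabSym γ α β lam) t).re := by
    exact Complex.hasSum_re h2
  have h4 : HasSum (fun j : ℕ => c j * (t ^ (β + α * j - 1) / Real.Gamma (β + α * j)))
      (prabhakar γ α β lam t) := by
    have h5 := h3.summable.hasSum
    rw [prabhakar, ← tsum_mul_left]
    convert h5 using 1
    refine tsum_congr fun j => ?_
    have : t ^ (β + α * j - 1) = t ^ (β - 1) * (t ^ α) ^ j := by
      rw [← Real.rpow_mul_natCast ht.le, ← Real.rpow_add ht]; congr 1; ring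
    rw [this, mul_pow, hc, div_mul_div_comm]
    ring
  exact ⟨h4, h2.unique (Complex.hasSum_ofReal.2 h4)⟩

/-- The Prabhakar function as an inverse Laplace integral. -/
theorem contour_prabSym {κ α lam : ℝ} (hκ : 0 < κ) (hα : 0 ≤ α)
    (hlam : |lam| * κ ^ (-2 * α) < 1) (γ β : ℝ) {t : ℝ} (ht : 0 < t) :
    contour κ (prabSym γ α β lam) t = ((prabhakar γ α β lam t : ℝ) : ℂ) :=
  (hasSum_prabhakar hκ hα hlam γ β ht).2

end DistributedOrder
end

noncomputable section

namespace DistributedOrder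

/-- The logarithm of `((s - 1) / log s) (1 + lam s ^ (-α)) ^ γ`, in the variable `w = √s`. -/
def logSym (α γ lam : ℝ) (w : ℂ) : ℂ :=
  2 * Complex.log w + Complex.log (1 + ((-1 : ℝ) : ℂ) * w ^ ((-2 * 1 : ℝ) : ℂ)) -
    Complex.log (2 * Complex.log w) +
    (γ : ℂ) * Complex.log (1 + (lam : ℂ) * w ^ ((-2 * α : ℝ) : ℂ))

/-- The `b`-th power of `((s - 1) / log s) (1 + lam s ^ (-α)) ^ γ`, in the variable `w = √s`. -/
def symPow (α γ lam b : ℝ) (w : ℂ) : ℂ := Complex.exp (b * logSym α γ lam w)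

theorem symPow_ne_zero (α γ lam b : ℝ) (w : ℂ) : symPow α γ lam b w ≠ 0 := Complex.exp_ne_zero _

theorem symPow_neg (α γ lam b : ℝ) (w : ℂ) :
    symPow α γ lam (-b) w = (symPow α γ lam b w)⁻¹ := by
  rw [symPow, symPow, ← Complex.exp_neg]; push_cast; ring_nf

theorem symPow_pow (α γ lam b : ℝ) (n : ℕ) (w : ℂ) :
    symPow α γ lam b w ^ n = symPow α γ lam (n * b) w := by
  rw [symPow, symPow, ← Complex.exp_nat_mul]; push_cast; ring_nf

section

variable {κ α lam : ℝ}

theorem one_lt_norm (hκ : 1 < κ) {w : ℂ} (hw : κ ≤ w.re) : 1 < ‖w‖ :=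
  hκ.trans_le (hw.trans (Complex.re_le_norm w))

theorem log_re_pos (hκ : 1 < κ) {w : ℂ} (hw : κ ≤ w.re) : 0 < (2 * Complex.log w).re := by
  simp only [Complex.mul_re, Complex.re_ofNat, Complex.im_ofNat, zero_mul, sub_zero, Complex.log_re]
  have := Real.log_pos (one_lt_norm hκ hw)
  linarith

theorem ne_zero_of_re (hκ : 0 < κ) {w : ℂ} (hw : κ ≤ w.re) : w ≠ 0 := fun h => by
  rw [h] at hw; simp at hw; linarith

theorem lam_one (hκ : 1 < κ) : |(-1 : ℝ)| * κ ^ (-2 * (1 : ℝ)) < 1 := by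
  rw [abs_neg, abs_one, one_mul]
  exact Real.rpow_lt_one_of_one_lt_of_neg hκ (by norm_num)

theorem one_add_mem_slitPlane (hκ : 0 < κ) (hα : 0 ≤ α) (hlam : |lam| * κ ^ (-2 * α) < 1) {w : ℂ}
    (hw : κ ≤ w.re) : 1 + (lam : ℂ) * w ^ ((-2 * α : ℝ) : ℂ) ∈ Complex.slitPlane :=
  Complex.mem_slitPlane_of_norm_lt_one ((norm_lam_cpow_le hκ hα hw).trans_lt hlam)

theorem one_add_re_pos (hκ : 0 < κ) (hα : 0 ≤ α) (hlam : |lam| * κ ^ (-2 * α) < 1) {w : ℂ}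
    (hw : κ ≤ w.re) : 0 < (1 + (lam : ℂ) * w ^ ((-2 * α : ℝ) : ℂ)).re := by
  have h1 := (norm_lam_cpow_le (lam := lam) hκ hα hw).trans_lt hlam
  have h2 := (Complex.abs_re_le_norm _).trans_lt h1
  rw [Complex.add_re, Complex.one_re]
  linarith [(abs_lt.1 h2).1]

theorem symPow_eq (hκ : 1 < κ) (hα : 0 ≤ α) (hlam : |lam| * κ ^ (-2 * α) < 1) (γ b : ℝ) {w : ℂ}
    (hw : κ ≤ w.re) :
    symPow α γ lam b w = w ^ ((2 * b : ℝ) : ℂ) *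
      (1 + ((-1 : ℝ) : ℂ) * w ^ ((-2 * 1 : ℝ) : ℂ)) ^ (b : ℂ) *
      (2 * Complex.log w) ^ ((-b : ℝ) : ℂ) *
      (1 + (lam : ℂ) * w ^ ((-2 * α : ℝ) : ℂ)) ^ ((γ * b : ℝ) : ℂ) := by
  have hκ0 : 0 < κ := one_pos.trans hκ
  have h1 := ne_zero_of_re hκ0 hw
  have h2 := Complex.slitPlane_ne_zero (one_add_mem_slitPlane hκ0 zero_le_one (lam_one hκ) hw)
  have h3 : 2 * Complex.log w ≠ 0 := ne_zero_of_re (log_re_pos hκ hw) le_rfl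
  have h4 := Complex.slitPlane_ne_zero (one_add_mem_slitPlane hκ0 hα hlam hw)
  rw [Complex.cpow_def_of_ne_zero h1, Complex.cpow_def_of_ne_zero h2, Complex.cpow_def_of_ne_zero h3,
    Complex.cpow_def_of_ne_zero h4, ← Complex.exp_add, ← Complex.exp_add, ← Complex.exp_add,
    symPow, logSym]
  congr 1; push_cast; ring

theorem Adm.log_cpow_neg (hκ : 1 < κ) {b : ℝ} (hb : 0 ≤ b) :
    Adm κ 0 fun w => (2 * Complex.log w) ^ ((-b : ℝ) : ℂ) := by
  have hκ0 : 0 < κ := one_pos.trans hκ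
  have hL := Real.log_pos hκ
  refine ⟨fun w hw => ?_, (2 * Real.log κ) ^ (-b), by positivity, fun w hw => ?_⟩
  · refine DifferentiableAt.cpow ?_ (differentiableAt_const _) (Or.inl (log_re_pos hκ hw))
    exact (Complex.differentiableAt_log (Or.inl (hκ0.trans_le hw))).const_mul _
  · rw [Complex.norm_cpow_real, Real.rpow_zero, mul_one]
    refine Real.rpow_le_rpow_of_nonpos (by positivity) ?_ (by linarith)
    refine le_trans ?_ (Complex.re_le_norm _)
    simp only [Complex.mul_re, Complex.re_ofNat, Complex.im_ofNat, zero_mul, sub_zero,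
      Complex.log_re]
    gcongr
    exact hw.trans (Complex.re_le_norm w)

theorem Adm.log_cpow (hκ : 1 < κ) {b : ℝ} (hb : 0 ≤ b) :
    Adm κ b fun w => (2 * Complex.log w) ^ (b : ℂ) := by
  have hκ0 : 0 < κ := one_pos.trans hκ
  refine ⟨fun w hw => ?_, 12 ^ b, by positivity, fun w hw => ?_⟩
  · refine DifferentiableAt.cpow ?_ (differentiableAt_const _) (Or.inl (log_re_pos hκ hw))
    exact (Complex.differentiableAt_log (Or.inl (hκ0.trans_le hw))).const_mul _
  · have h1 := one_lt_norm hκ hw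
    rw [Complex.norm_cpow_real, ← Real.mul_rpow (by norm_num) (norm_nonneg w)]
    refine Real.rpow_le_rpow (norm_nonneg _) ?_ hb
    rw [norm_mul, Complex.norm_ofNat]
    have h2 : ‖Complex.log w‖ ≤ |Real.log ‖w‖| + |Complex.arg w| := by
      have := Complex.norm_le_abs_re_add_abs_im (Complex.log w)
      rwa [Complex.log_re, Complex.log_im] at this
    have h3 : |Real.log ‖w‖| ≤ ‖w‖ := by
      rw [abs_of_pos (Real.log_pos h1)]
      linarith [Real.log_le_sub_one_of_pos (one_pos.trans h1)]
    have h4 := Complex.abs_arg_le_pi w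
    linarith [Real.pi_lt_four]

theorem adm_symPow (hκ : 1 < κ) (hα : 0 ≤ α) (hlam : |lam| * κ ^ (-2 * α) < 1) (γ : ℝ) {b c : ℝ}
    (hlog : Adm κ c fun w => (2 * Complex.log w) ^ ((-b : ℝ) : ℂ)) :
    Adm κ (2 * b + c) (symPow α γ lam b) := by
  have hκ0 : 0 < κ := one_pos.trans hκ
  have h := (((Adm.cpow hκ0 (2 * b)).mul hκ0
    (Adm.one_add_cpow hκ0 zero_le_one (lam_one hκ) b)).mul hκ0 hlog).mul hκ0
    (Adm.one_add_cpow hκ0 hα hlam (γ * b))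
  rw [add_zero, add_zero] at h
  refine ⟨fun w hw => ?_, ?_⟩
  · have hd : DifferentiableAt ℂ (logSym α γ lam) w := by
      have e1 := Complex.differentiableAt_log (z := w) (Or.inl (hκ0.trans_le hw))
      have e2 := (((Adm.cpow hκ0 (-2 * 1)).diff w hw).const_mul ((-1 : ℝ) : ℂ)).const_add 1
      have e3 := (((Adm.cpow hκ0 (-2 * α)).diff w hw).const_mul (lam : ℂ)).const_add 1
      exact (((e1.const_mul 2).add (e2.clog (one_add_mem_slitPlane hκ0 zero_le_one
        (lam_one hκ) hw))).sub ((e1.const_mul 2).clog (Or.inl (log_re_pos hκ hw)))).add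
        ((e3.clog (one_add_mem_slitPlane hκ0 hα hlam hw)).const_mul _)
    exact (hd.const_mul (b : ℂ)).cexp
  · obtain ⟨C, hC, hb⟩ := h.bound
    exact ⟨C, hC, fun w hw => by rw [symPow_eq hκ hα hlam γ b hw]; exact hb w hw⟩

theorem adm_symPow_of_nonneg (hκ : 1 < κ) (hα : 0 ≤ α) (hlam : |lam| * κ ^ (-2 * α) < 1) (γ : ℝ)
    {b : ℝ} (hb : 0 ≤ b) : Adm κ (2 * b) (symPow α γ lam b) := by
  have := adm_symPow hκ hα hlam γ (Adm.log_cpow_neg hκ hb)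
  rwa [add_zero] at this

theorem adm_symPow_neg (hκ : 1 < κ) (hα : 0 ≤ α) (hlam : |lam| * κ ^ (-2 * α) < 1) (γ : ℝ)
    {b : ℝ} (hb : 0 ≤ b) : Adm κ (-b) (symPow α γ lam (-b)) := by
  have := adm_symPow hκ hα hlam γ (b := -b) (c := b) (by simpa using Adm.log_cpow hκ hb)
  rwa [show 2 * -b + b = -b by ring] at this

/-! ### Symmetry, and values on the real line -/

theorem arg_ne_pi {w : ℂ} (hw : 0 < w.re) : w.arg ≠ Real.pi :=
  (Complex.mem_slitPlane_iff_arg.1 (Or.inl hw)).1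

theorem conj_cpow_real {w : ℂ} (hw : 0 < w.re) (a : ℝ) :
    ((starRingEnd ℂ) w) ^ (a : ℂ) = (starRingEnd ℂ) (w ^ (a : ℂ)) := by
  rw [Complex.conj_cpow _ _ (arg_ne_pi hw), Complex.conj_ofReal]

theorem symPow_conj (hκ : 1 < κ) (hα : 0 ≤ α) (hlam : |lam| * κ ^ (-2 * α) < 1) (γ b : ℝ) {w : ℂ}
    (hw : κ ≤ w.re) :
    symPow α γ lam b ((starRingEnd ℂ) w) = (starRingEnd ℂ) (symPow α γ lam b w) := by
  have hκ0 : 0 < κ := one_pos.trans hκ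
  have hw0 : 0 < w.re := hκ0.trans_le hw
  have e : logSym α γ lam ((starRingEnd ℂ) w) = (starRingEnd ℂ) (logSym α γ lam w) := by
    simp only [logSym, map_add, map_sub, map_mul, Complex.conj_ofReal, map_ofNat]
    rw [← Complex.log_conj _ (arg_ne_pi hw0),
      ← Complex.log_conj _ (arg_ne_pi (one_add_re_pos hκ0 zero_le_one (lam_one hκ) hw)),
      ← Complex.log_conj _ (arg_ne_pi (log_re_pos hκ hw)),
      ← Complex.log_conj _ (arg_ne_pi (one_add_re_pos hκ0 hα hlam hw))]
    simp only [map_add, map_mul, map_one, map_ofNat, Complex.conj_ofReal]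
    rw [conj_cpow_real hw0, conj_cpow_real hw0, Complex.log_conj _ (arg_ne_pi hw0)]
  rw [symPow, symPow, e, ← Complex.exp_conj, map_mul, Complex.conj_ofReal]

/-- The function `((s - 1) / log s) (1 + lam s ^ (-α)) ^ γ`. -/
def symReal (α γ lam s : ℝ) : ℝ := (s - 1) / Real.log s * (1 + lam * s ^ (-α)) ^ γ

theorem one_add_lam_pos (hκ : 0 < κ) (hα : 0 ≤ α) (hlam : |lam| * κ ^ (-2 * α) < 1) {s : ℝ}
    (hs : κ ^ 2 ≤ s) : 0 < 1 + lam * s ^ (-α) := by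
  have h1 : s ^ (-α) ≤ κ ^ (-2 * α) := by
    calc s ^ (-α) ≤ (κ ^ 2) ^ (-α) :=
          Real.rpow_le_rpow_of_nonpos (by positivity) hs (by linarith)
      _ = _ := by rw [← Real.rpow_natCast, ← Real.rpow_mul hκ.le]; congr 1; push_cast; ring
  have h2 : 0 ≤ s ^ (-α) := Real.rpow_nonneg ((sq_nonneg κ).trans hs) _
  have h3 : -(|lam| * κ ^ (-2 * α)) ≤ lam * s ^ (-α) := by
    nlinarith [neg_abs_le lam, abs_nonneg lam, mul_le_mul_of_nonneg_left h1 (abs_nonneg lam),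
      mul_le_mul_of_nonneg_right (neg_abs_le lam) h2]
  linarith

theorem symReal_pos (hκ : 1 < κ) (hα : 0 ≤ α) (hlam : |lam| * κ ^ (-2 * α) < 1) (γ : ℝ) {s : ℝ}
    (hs : κ ^ 2 ≤ s) : 0 < symReal α γ lam s := by
  have hs1 : 1 < s := by nlinarith
  have h1 := one_add_lam_pos (one_pos.trans hκ) hα hlam hs
  have h2 := Real.log_pos hs1
  have h3 : 0 < s - 1 := by linarith
  rw [symReal]; positivity

theorem symPow_ofReal (hκ : 1 < κ) (hα : 0 ≤ α) (hlam : |lam| * κ ^ (-2 * α) < 1) (γ b : ℝ) {s : ℝ}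
    (hs : κ ^ 2 ≤ s) :
    symPow α γ lam b ((√s : ℝ) : ℂ) = ((symReal α γ lam s ^ b : ℝ) : ℂ) := by
  have hs1 : 1 < s := by nlinarith
  have hs0 : 0 < s := by linarith
  have hq0 : 0 ≤ √s := Real.sqrt_nonneg s
  have h1 := one_add_lam_pos (one_pos.trans hκ) hα hlam hs
  have h2 := Real.log_pos hs1
  have h3 : 0 < s - 1 := by linarith
  have hpow : ∀ a : ℝ, ((√s : ℝ) : ℂ) ^ ((-2 * a : ℝ) : ℂ) = ((s ^ (-a) : ℝ) : ℂ) := fun a => by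
    rw [← Complex.ofReal_cpow hq0, Real.sqrt_eq_rpow, ← Real.rpow_mul hs0.le]
    congr 2; ring
  have h4 : 0 < 1 + -1 * s ^ (-1 : ℝ) := by
    rw [Real.rpow_neg_one]
    have := inv_lt_one_of_one_lt₀ hs1
    linarith
  have e : logSym α γ lam ((√s : ℝ) : ℂ) = ((Real.log (symReal α γ lam s) : ℝ) : ℂ) := by
    rw [logSym, hpow, hpow]
    have e1 : Complex.log ((√s : ℝ) : ℂ) = ((Real.log s / 2 : ℝ) : ℂ) := by
      rw [← Complex.ofReal_log hq0, Real.log_sqrt hs0.le]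
    have e2 : (2 : ℂ) * ((Real.log s / 2 : ℝ) : ℂ) = ((Real.log s : ℝ) : ℂ) := by push_cast; ring
    have e4 : 1 + ((-1 : ℝ) : ℂ) * ((s ^ (-1 : ℝ) : ℝ) : ℂ) = ((1 + -1 * s ^ (-1 : ℝ) : ℝ) : ℂ) := by
      push_cast; rfl
    have e5 : 1 + (lam : ℂ) * ((s ^ (-α) : ℝ) : ℂ) = ((1 + lam * s ^ (-α) : ℝ) : ℂ) := by
      push_cast; rfl
    rw [e1, e2, e4, e5, ← Complex.ofReal_log h2.le, ← Complex.ofReal_log h4.le,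
      ← Complex.ofReal_log h1.le, symReal, Real.log_mul (div_pos h3 h2).ne' (by positivity),
      Real.log_div h3.ne' h2.ne', Real.log_rpow h1]
    have e3 : s - 1 = s * (1 + -1 * s ^ (-1 : ℝ)) := by
      rw [Real.rpow_neg_one]; field_simp; ring
    rw [e3, Real.log_mul hs0.ne' h4.ne']
    push_cast; ring
  rw [symPow, e, Real.rpow_def_of_pos (symReal_pos hκ hα hlam γ hs)]
  push_cast; rw [mul_comm]

/-! ### Lower bound for the real part of the square root -/

theorem re_cpow_neg {w : ℂ} (hw : w ≠ 0) (a : ℝ) :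
    (w ^ ((-2 * a : ℝ) : ℂ)).re = Real.exp (-2 * a * Real.log ‖w‖) * Real.cos (2 * a * w.arg) ∧
    (w ^ ((-2 * a : ℝ) : ℂ)).im = -(Real.exp (-2 * a * Real.log ‖w‖) * Real.sin (2 * a * w.arg)) := by
  have h1 : (Complex.log w * ((-2 * a : ℝ) : ℂ)).re = -2 * a * Real.log ‖w‖ := by
    rw [Complex.re_mul_ofReal, Complex.log_re]; ring
  have h2 : (Complex.log w * ((-2 * a : ℝ) : ℂ)).im = -(2 * a * w.arg) := by
    rw [Complex.im_mul_ofReal, Complex.log_im]; ring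
  rw [Complex.cpow_def_of_ne_zero hw, Complex.exp_re, Complex.exp_im, h1, h2, Real.cos_neg,
    Real.sin_neg]
  exact ⟨rfl, by ring⟩

theorem arg_one_sub_le (hκ : 1 < κ) {w : ℂ} (hw : κ ≤ w.re) (him : 0 ≤ w.im) :
    (1 + ((-1 : ℝ) : ℂ) * w ^ ((-2 * 1 : ℝ) : ℂ)).arg ≤ (2 * Complex.log w).arg := by
  have hκ0 : 0 < κ := one_pos.trans hκ
  set u := 1 + ((-1 : ℝ) : ℂ) * w ^ ((-2 * 1 : ℝ) : ℂ) with hu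
  set v := 2 * Complex.log w with hv
  have hu0 : 0 < u.re := one_add_re_pos hκ0 zero_le_one (lam_one hκ) hw
  have hv0 : 0 < v.re := log_re_pos hκ hw
  obtain ⟨c1, c2⟩ := re_cpow_neg (ne_zero_of_re hκ0 hw) 1
  have hn := one_lt_norm hκ hw
  set ℓ := Real.log ‖w‖ with hℓ
  have hℓ0 : 0 < ℓ := Real.log_pos hn
  set θ := w.arg with hθ
  have hθ0 : 0 ≤ θ := Complex.arg_nonneg_iff.2 him
  have ure : u.re = 1 - Real.exp (-2 * 1 * ℓ) * Real.cos (2 * 1 * θ) := by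
    rw [hu, Complex.add_re, Complex.one_re, Complex.re_ofReal_mul, c1]; ring
  have uim : u.im = Real.exp (-2 * 1 * ℓ) * Real.sin (2 * 1 * θ) := by
    rw [hu, Complex.add_im, Complex.one_im, Complex.im_ofReal_mul, c2]; ring
  have vre : v.re = 2 * ℓ := by simp [hv, Complex.log_re, hℓ]
  have vim : v.im = 2 * θ := by simp [hv, Complex.log_im, hθ]
  have hE : 0 < Real.exp (-2 * 1 * ℓ) := Real.exp_pos _
  have hE2 : Real.exp (-2 * 1 * ℓ) * (1 + 2 * ℓ) ≤ 1 := by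
    have h1 := Real.add_one_le_exp (2 * ℓ)
    have h2 : Real.exp (-2 * 1 * ℓ) * Real.exp (2 * ℓ) = 1 := by
      rw [← Real.exp_add]; simp
    nlinarith
  have hcos : Real.cos (2 * 1 * θ) ≤ 1 := Real.cos_le_one _
  have hsin : Real.sin (2 * 1 * θ) ≤ 2 * θ := by
    have := Real.sin_le (by linarith : 0 ≤ 2 * 1 * θ); linarith
  by_contra! hcon
  have hua := Complex.abs_arg_lt_pi_div_two_iff.2 (Or.inl hu0)
  have hva := Complex.abs_arg_lt_pi_div_two_iff.2 (Or.inl hv0)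
  rw [abs_lt] at hua hva
  have htan := Real.strictMonoOn_tan ⟨hva.1, hva.2⟩ ⟨hua.1, hua.2⟩ hcon
  rw [Complex.tan_arg, Complex.tan_arg, div_lt_div_iff₀ hv0 hu0, vre, vim, uim, ure] at htan
  have h5 : Real.exp (-2 * 1 * ℓ) * Real.sin (2 * 1 * θ) * (2 * ℓ) ≤
      Real.exp (-2 * 1 * ℓ) * (2 * θ) * (2 * ℓ) := by gcongr
  have h6 : Real.exp (-2 * 1 * ℓ) * (2 * ℓ) ≤
      1 - Real.exp (-2 * 1 * ℓ) * Real.cos (2 * 1 * θ) := by nlinarith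
  nlinarith [mul_le_mul_of_nonneg_left h6 (by linarith : 0 ≤ 2 * θ)]

theorem re_symPow_half_of_im_nonneg (hκ : 1 < κ) (hα : 0 ≤ α) (hα1 : α ≤ 1) (hlam0 : 0 ≤ lam)
    (hlam : |lam| * κ ^ (-2 * α) < 1) {γ : ℝ} (hγ : 0 ≤ γ) (hγ1 : γ < 1) {w : ℂ} (hw : κ ≤ w.re)
    (him : 0 ≤ w.im) :
    Real.cos (Real.pi * (1 + γ) / 4) * κ / ‖w‖ * ‖symPow α γ lam (1 / 2) w‖ ≤
      (symPow α γ lam (1 / 2) w).re := by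
  have hκ0 : 0 < κ := one_pos.trans hκ
  have hw0 := ne_zero_of_re hκ0 hw
  have hn : 0 < ‖w‖ := norm_pos_iff.2 hw0
  have hpi := Real.pi_pos
  set θ := w.arg with hθ
  have hθ0 : 0 ≤ θ := Complex.arg_nonneg_iff.2 him
  have hθ1 : θ < Real.pi / 2 :=
    (abs_lt.1 (Complex.abs_arg_lt_pi_div_two_iff.2 (Or.inl (hκ0.trans_le hw)))).2
  set u := 1 + ((-1 : ℝ) : ℂ) * w ^ ((-2 * 1 : ℝ) : ℂ) with hu
  set v := 2 * Complex.log w with hv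
  set z := 1 + (lam : ℂ) * w ^ ((-2 * α : ℝ) : ℂ) with hz
  have a1 : u.arg ≤ v.arg := arg_one_sub_le hκ hw him
  have a2 : 0 ≤ u.arg := by
    rw [Complex.arg_nonneg_iff, hu, Complex.add_im, Complex.one_im, Complex.im_ofReal_mul,
      (re_cpow_neg hw0 1).2]
    have : 0 ≤ Real.sin (2 * 1 * w.arg) := Real.sin_nonneg_of_nonneg_of_le_pi (by linarith)
      (by linarith)
    have h2 := Real.exp_pos (-2 * 1 * Real.log ‖w‖)
    nlinarith [mul_nonneg h2.le this]
  have a3 : v.arg < Real.pi / 2 :=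
    (abs_lt.1 (Complex.abs_arg_lt_pi_div_two_iff.2 (Or.inl (log_re_pos hκ hw)))).2
  have hzre : 0 < z.re := one_add_re_pos hκ0 hα hlam hw
  have a4 : -(Real.pi / 2) < z.arg :=
    (abs_lt.1 (Complex.abs_arg_lt_pi_div_two_iff.2 (Or.inl hzre))).1
  have a5 : z.arg ≤ 0 := by
    have hzim : z.im ≤ 0 := by
      rw [hz, Complex.add_im, Complex.one_im, Complex.im_ofReal_mul, (re_cpow_neg hw0 α).2]
      have : 0 ≤ Real.sin (2 * α * w.arg) := Real.sin_nonneg_of_nonneg_of_le_pi (by positivity)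
        (by nlinarith)
      have h2 := Real.exp_pos (-2 * α * Real.log ‖w‖)
      nlinarith [mul_nonneg hlam0 (mul_nonneg h2.le this)]
    rcases hzim.lt_or_eq with h | h
    · exact (Complex.arg_neg_iff.2 h).le
    · exact (Complex.arg_eq_zero_iff.2 ⟨hzre.le, h⟩).le
  set φ := (logSym α γ lam w).im / 2 with hφ
  have him' : (logSym α γ lam w).im = 2 * θ + u.arg - v.arg + γ * z.arg := by
    simp only [logSym, Complex.add_im, Complex.sub_im, Complex.log_im, Complex.mul_im,
      Complex.ofReal_re, Complex.ofReal_im, Complex.re_ofNat, Complex.im_ofNat, zero_mul, add_zero, hθ, hu, hv, hz]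
  have hφ1 : φ ≤ θ := by
    have := mul_nonpos_of_nonneg_of_nonpos hγ a5
    rw [hφ, him']; linarith
  have hφ2 : -(Real.pi * (1 + γ) / 4) ≤ φ := by
    have : γ * -(Real.pi / 2) ≤ γ * z.arg := mul_le_mul_of_nonneg_left a4.le hγ
    rw [hφ, him']; linarith
  have hcosθ : Real.cos θ = w.re / ‖w‖ := Complex.cos_arg hw0
  have hc0 : 0 < Real.cos (Real.pi * (1 + γ) / 4) :=
    Real.cos_pos_of_mem_Ioo ⟨by nlinarith, by nlinarith⟩
  have hcos : Real.cos (Real.pi * (1 + γ) / 4) * κ / ‖w‖ ≤ Real.cos φ := by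
    have hκw : κ / ‖w‖ ≤ 1 := by
      rw [div_le_one hn]; exact hw.trans (Complex.re_le_norm w)
    have hκp : 0 ≤ κ / ‖w‖ := by positivity
    rcases le_total 0 φ with h0 | h0
    · have h1 : Real.cos θ ≤ Real.cos φ := Real.cos_le_cos_of_nonneg_of_le_pi h0 (by linarith) hφ1
      have h2 : κ / ‖w‖ ≤ Real.cos θ := by rw [hcosθ]; gcongr
      rw [mul_div_assoc]
      nlinarith [Real.cos_le_one (Real.pi * (1 + γ) / 4)]
    · have h1 : Real.cos (Real.pi * (1 + γ) / 4) ≤ Real.cos φ := by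
        rw [← Real.cos_neg φ]
        exact Real.cos_le_cos_of_nonneg_of_le_pi (by linarith) (by nlinarith) (by linarith)
      rw [mul_div_assoc]
      nlinarith
  have e1 : ((((1 / 2 : ℝ)) : ℂ) * logSym α γ lam w).im = φ := by
    rw [Complex.im_ofReal_mul, hφ]; ring
  rw [symPow, Complex.norm_exp, Complex.exp_re, e1, mul_comm]
  gcongr

theorem re_symPow_half (hκ : 1 < κ) (hα : 0 ≤ α) (hα1 : α ≤ 1) (hlam0 : 0 ≤ lam)
    (hlam : |lam| * κ ^ (-2 * α) < 1) {γ : ℝ} (hγ : 0 ≤ γ) (hγ1 : γ < 1) :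
    ∃ c : ℝ, 0 < c ∧ ∀ w : ℂ, κ ≤ w.re → c / ‖w‖ * ‖symPow α γ lam (1 / 2) w‖ ≤
      (symPow α γ lam (1 / 2) w).re := by
  have hpi := Real.pi_pos
  refine ⟨Real.cos (Real.pi * (1 + γ) / 4) * κ, mul_pos
    (Real.cos_pos_of_mem_Ioo ⟨by nlinarith, by nlinarith⟩) (one_pos.trans hκ), fun w hw => ?_⟩
  rcases le_total 0 w.im with h | h
  · exact re_symPow_half_of_im_nonneg hκ hα hα1 hlam0 hlam hγ hγ1 hw h
  · have := re_symPow_half_of_im_nonneg hκ hα hα1 hlam0 hlam hγ hγ1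
      (w := (starRingEnd ℂ) w) (by simpa using hw) (by simpa using h)
    rw [symPow_conj hκ hα hlam γ _ hw, Complex.norm_conj, Complex.norm_conj, Complex.conj_re] at this
    exact this

end

end DistributedOrder
end

noncomputable section

namespace DistributedOrder

theorem sqrt_facts {κ s : ℝ} (hs : κ ^ 2 < s) :
    κ < (((√s : ℝ) : ℂ)).re ∧ κ ^ 2 < ((((√s : ℝ) : ℂ)) ^ 2).re ∧
      (((√s : ℝ) : ℂ)) ^ 2 = s := by
  have h0 : 0 ≤ s := (sq_nonneg κ).trans hs.le
  have h2 : (((√s : ℝ) : ℂ)) ^ 2 = s := by rw [← Complex.ofReal_pow, Real.sq_sqrt h0]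
  rw [h2]
  exact ⟨by rw [Complex.ofReal_re]; exact Real.lt_sqrt_of_sq_lt hs, by simpa using hs, rfl⟩

theorem Adm.laplace_contour_re {κ δ : ℝ} (hκ : 0 < κ) (hδ : 0 < δ) {h : ℂ → ℂ}
    (hh : Adm κ (-δ) h) {s : ℝ} (hs : κ ^ 2 < s) :
    IntegrableOn (fun t : ℝ => Real.exp (-s * t) * (contour κ h t).re) (Ioi 0) ∧
      laplace (fun t => (contour κ h t).re) s = (h ((√s : ℝ) : ℂ)).re := by
  obtain ⟨h1, h2, h3⟩ := sqrt_facts hs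
  obtain ⟨hi, he⟩ := hh.laplace_contour hκ hδ h1 h2
  rw [h3] at hi he
  have e : ∀ t : ℝ, (Complex.exp (-(s : ℂ) * t) * contour κ h t).re =
      Real.exp (-s * t) * (contour κ h t).re := fun t => by
    rw [← Complex.ofReal_neg, ← Complex.ofReal_mul, ← Complex.ofReal_exp, Complex.re_ofReal_mul]
  constructor
  · exact hi.re.congr (Eventually.of_forall fun t => e t)
  · rw [← he, laplace]
    simp only [← e]
    exact integral_re hi

section

variable {κ α lam : ℝ}

theorem laplace_prabhakar (hκ : 0 < κ) (hα : 0 ≤ α) (hlam : |lam| * κ ^ (-2 * α) < 1) (γ : ℝ)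
    {β s : ℝ} (hβ : 0 < β) (hs : κ ^ 2 < s) :
    IntegrableOn (fun t : ℝ => Real.exp (-s * t) * prabhakar γ α β lam t) (Ioi 0) ∧
      laplace (prabhakar γ α β lam) s = s ^ (-β) * (1 + lam * s ^ (-α)) ^ (-γ) := by
  have hA := adm_prabSym hκ hα hlam γ β
  rw [neg_mul] at hA
  obtain ⟨h1, h2⟩ := hA.laplace_contour_re hκ (by positivity) hs
  have e : EqOn (fun t => Real.exp (-s * t) * (contour κ (prabSym γ α β lam) t).re)
      (fun t => Real.exp (-s * t) * prabhakar γ α β lam t) (Ioi 0) := fun t ht => by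
    simp only [contour_prabSym hκ hα hlam γ β ht, Complex.ofReal_re]
  have hs0 : 0 < s := (by positivity : 0 < κ ^ 2).trans hs
  refine ⟨h1.congr_fun e measurableSet_Ioi, ?_⟩
  rw [laplace] at h2 ⊢
  rw [← setIntegral_congr_fun measurableSet_Ioi e, h2]
  have hpow : ∀ a : ℝ, ((√s : ℝ) : ℂ) ^ ((-2 * a : ℝ) : ℂ) = ((s ^ (-a) : ℝ) : ℂ) := fun a => by
    rw [← Complex.ofReal_cpow (Real.sqrt_nonneg s), Real.sqrt_eq_rpow, ← Real.rpow_mul hs0.le]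
    congr 2; ring
  have h3 := one_add_lam_pos hκ hα hlam hs.le
  have e5 : 1 + (lam : ℂ) * ((s ^ (-α) : ℝ) : ℂ) = ((1 + lam * s ^ (-α) : ℝ) : ℂ) := by
    push_cast; rfl
  rw [prabSym, hpow, hpow, e5, ← Complex.ofReal_cpow h3.le, ← Complex.ofReal_mul, Complex.ofReal_re]

theorem continuousOn_prabhakar_family (hκ : 1 < κ) (hα : 0 ≤ α) (hlam : |lam| * κ ^ (-2 * α) < 1)
    (γ : ℝ) : ContinuousOn (fun z : ℝ × ℝ => prabhakar γ α (1 - z.1) lam z.2) (Iio 1 ×ˢ Ioi 0) := by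
  have hκ0 : 0 < κ := one_pos.trans hκ
  obtain ⟨C, hC0, hC⟩ := (Adm.one_add_cpow hκ0 hα hlam (-γ)).bound
  have hcont : Continuous fun z : ℝ × ℝ => prabSym γ α (max 0 (1 - z.1)) lam (κ + z.2 * Complex.I) := by
    have h1 : Continuous fun z : ℝ × ℝ => (1 + (lam : ℂ) *
        ((κ : ℂ) + z.2 * Complex.I) ^ ((-2 * α : ℝ) : ℂ)) ^ ((-γ : ℝ) : ℂ) :=
      (Adm.one_add_cpow hκ0 hα hlam (-γ)).continuous_line.comp continuous_snd
    refine Continuous.mul ?_ h1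
    refine Continuous.cpow (by fun_prop) (by fun_prop) fun z => Or.inl (by simpa using hκ0)
  have hb : ∀ x y : ℝ, ‖prabSym γ α (max 0 (1 - x)) lam (κ + y * Complex.I)‖ ≤
      C * ‖(κ : ℂ) + y * Complex.I‖ ^ (0 : ℝ) := fun x y => by
    have hw : κ ≤ ((κ : ℂ) + y * Complex.I).re := by simp
    have h1 := one_lt_norm hκ hw
    rw [prabSym, norm_mul]
    refine le_trans ?_ (hC _ hw)
    refine mul_le_of_le_one_left (norm_nonneg _) ?_
    rw [Complex.norm_cpow_real]
    exact Real.rpow_le_one_of_one_le_of_nonpos h1.le (by linarith [le_max_left 0 (1 - x)])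
  have h2 := continuousOn_contour_family hκ0 hcont hb
  have h3 : ContinuousOn (fun z : ℝ × ℝ =>
      (contour κ (prabSym γ α (max 0 (1 - z.1)) lam) z.2).re) (Iio 1 ×ˢ Ioi 0) :=
    Complex.continuous_re.comp_continuousOn (h2.mono (prod_mono (subset_univ _) le_rfl))
  refine h3.congr fun z hz => ?_
  have h4 : z.1 < 1 := hz.1
  show _ = (contour κ (prabSym γ α (max 0 (1 - z.1)) lam) z.2).re
  rw [max_eq_right (by linarith), contour_prabSym hκ0 hα hlam γ _ hz.2, Complex.ofReal_re]

theorem poch_neg_succ_nonpos {γ : ℝ} (hγ : 0 ≤ γ) (hγ1 : γ < 1) (j : ℕ) : poch (-γ) (j + 1) ≤ 0 := by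
  rw [poch, ascPochhammer_succ_left, Polynomial.eval_mul, Polynomial.eval_comp]
  simp only [Polynomial.eval_X, Polynomial.eval_add, Polynomial.eval_one]
  exact mul_nonpos_of_nonpos_of_nonneg (by linarith) (ascPochhammer_pos j _ (by linarith)).le

theorem abs_prabhakar_le (hκ : 0 < κ) (hα : 0 ≤ α) (hlam0 : 0 ≤ lam)
    (hlam : |lam| * κ ^ (-2 * α) < 1) {γ : ℝ} (hγ : 0 ≤ γ) (hγ1 : γ < 1) {β t : ℝ} (hβ : 0 < β)
    (ht : 0 < t) : |prabhakar (-γ) α β lam t| ≤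
      2 * (t ^ (β - 1) / Real.Gamma β) - prabhakar (-γ) α β (-lam) t := by
  have h1 := (hasSum_prabhakar hκ hα hlam (-γ) β ht).1
  have h2 := (hasSum_prabhakar hκ hα (by rwa [abs_neg]) (-γ) β ht (lam := -lam)).1
  have h3 : HasSum (fun j : ℕ => if j = 0 then 2 * (t ^ (β - 1) / Real.Gamma β) else 0)
      (2 * (t ^ (β - 1) / Real.Gamma β)) := by
    simpa using hasSum_ite_eq (0 : ℕ) (2 * (t ^ (β - 1) / Real.Gamma β))
  have h4 := h3.sub h2
  rw [← h1.tsum_eq, ← Real.norm_eq_abs]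
  refine tsum_of_norm_bounded h4 fun j => ?_
  have hp : 0 ≤ t ^ (β + α * j - 1) / Real.Gamma (β + α * j) := by
    have := Real.Gamma_pos_of_pos (by positivity : 0 < β + α * j)
    positivity
  rw [norm_mul, Real.norm_of_nonneg hp, Real.norm_eq_abs, abs_div, abs_mul, abs_pow, abs_neg,
    neg_neg, abs_of_nonneg hlam0, Nat.abs_cast]
  rcases j with _ | j
  · simp [poch]; linarith
  · rw [if_neg (Nat.succ_ne_zero j), abs_of_nonpos (poch_neg_succ_nonpos hγ hγ1 j)]
    exact le_of_eq (by ring)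

theorem integrable_prod_of_integral_norm_le {f : ℝ × ℝ → ℝ} {μ ν : Measure ℝ} [SFinite μ]
    [IsFiniteMeasure ν] (hf : AEStronglyMeasurable f (μ.prod ν)) {C : ℝ}
    (h1 : ∀ᵐ y ∂ν, Integrable (fun x => f (x, y)) μ) (h2 : ∀ᵐ y ∂ν, ∫ x, ‖f (x, y)‖ ∂μ ≤ C) :
    Integrable f (μ.prod ν) := by
  rw [integrable_prod_iff' hf]
  refine ⟨h1, Integrable.mono' (integrable_const C) hf.norm.prod_swap.integral_prod_right' ?_⟩
  filter_upwards [h2] with y hy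
  rwa [Real.norm_of_nonneg (integral_nonneg fun _ => norm_nonneg _)]

theorem integral_abs_prabhakar_le (hκ : 1 < κ) (hα : 0 ≤ α) (hlam0 : 0 ≤ lam)
    (hlam : |lam| * κ ^ (-2 * α) < 1) {γ : ℝ} (hγ : 0 ≤ γ) (hγ1 : γ < 1) {β s : ℝ} (hβ : 0 < β)
    (hs : κ ^ 2 < s) :
    ∫ t in Ioi (0 : ℝ), ‖Real.exp (-s * t) * prabhakar (-γ) α β lam t‖ ≤ 2 := by
  have hκ0 : 0 < κ := one_pos.trans hκ
  have hs1 : 1 < s := by nlinarith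
  have hs0 : 0 < s := by linarith
  have g1 := laplace_rpow hβ hs0
  have g2 := laplace_prabhakar hκ0 hα (by rwa [abs_neg]) (-γ) hβ hs (lam := -lam)
  have g3 : ∫ t in Ioi (0 : ℝ), ‖Real.exp (-s * t) * prabhakar (-γ) α β lam t‖ ≤
      ∫ t in Ioi (0 : ℝ), (2 * (Real.exp (-s * t) * (t ^ (β - 1) / Real.Gamma β)) -
        Real.exp (-s * t) * prabhakar (-γ) α β (-lam) t) := by
    refine setIntegral_mono_on
      (laplace_prabhakar hκ0 hα hlam (-γ) hβ hs).1.norm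
      ((g1.1.const_mul 2).sub g2.1) measurableSet_Ioi fun t ht => ?_
    have := abs_prabhakar_le hκ0 hα hlam0 hlam hγ hγ1 hβ ht
    rw [norm_mul, Real.norm_of_nonneg (Real.exp_pos _).le, Real.norm_eq_abs]
    calc _ ≤ _ := mul_le_mul_of_nonneg_left this (Real.exp_pos (-s * t)).le
      _ = _ := by ring
  refine g3.trans ?_
  rw [integral_sub (g1.1.const_mul 2) g2.1, integral_const_mul]
  have g4 := g1.2
  have g5 := g2.2
  rw [laplace] at g4 g5
  rw [g4, g5, neg_neg]
  have g6 := one_add_lam_pos hκ0 hα (lam := -lam) (by rwa [abs_neg]) hs.le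
  have g7 : s ^ (-β) ≤ 1 := Real.rpow_le_one_of_one_le_of_nonpos hs1.le (by linarith)
  have g8 : 0 ≤ s ^ (-β) * (1 + -lam * s ^ (-α)) ^ γ := by positivity
  linarith

theorem integrable_prod_prabhakar (hκ : 1 < κ) (hα : 0 ≤ α) (hlam0 : 0 ≤ lam)
    (hlam : |lam| * κ ^ (-2 * α) < 1) {γ : ℝ} (hγ : 0 ≤ γ) (hγ1 : γ < 1) {s : ℝ} (hs : κ ^ 2 < s) :
    Integrable (fun z : ℝ × ℝ => Real.exp (-s * z.1) * prabhakar (-γ) α (1 - z.2) lam z.1)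
      ((volume.restrict (Ioi 0)).prod (volume.restrict (Ioo 0 1))) := by
  have hκ0 : 0 < κ := one_pos.trans hκ
  refine integrable_prod_of_integral_norm_le (C := 2) ?_ ?_ ?_
  · rw [Measure.prod_restrict]
    refine ContinuousOn.aestronglyMeasurable ?_ (measurableSet_Ioi.prod measurableSet_Ioo)
    refine ContinuousOn.mul (by fun_prop) ?_
    refine ContinuousOn.comp (f := fun z : ℝ × ℝ => (z.2, z.1))
      (continuousOn_prabhakar_family hκ hα hlam (-γ)) (by fun_prop) fun z hz => ?_
    exact ⟨hz.2.2, hz.1⟩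
  · filter_upwards [ae_restrict_mem measurableSet_Ioo] with μ hμ
    have hβ : 0 < 1 - μ := by linarith [hμ.2]
    exact (laplace_prabhakar hκ0 hα hlam (-γ) hβ hs).1
  · filter_upwards [ae_restrict_mem measurableSet_Ioo] with μ hμ
    have hβ : 0 < 1 - μ := by linarith [hμ.2]
    exact integral_abs_prabhakar_le hκ hα hlam0 hlam hγ hγ1 hβ hs

theorem laplace_k₂ (hκ : 1 < κ) (hα : 0 ≤ α) (hlam0 : 0 ≤ lam)
    (hlam : |lam| * κ ^ (-2 * α) < 1) {γ : ℝ} (hγ : 0 ≤ γ) (hγ1 : γ < 1) {s : ℝ} (hs : κ ^ 2 < s) :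
    IntegrableOn (fun t : ℝ => Real.exp (-s * t) * k₂ α γ lam t) (Ioi 0) ∧
      laplace (k₂ α γ lam) s = symReal α γ lam s / s := by
  have hκ0 : 0 < κ := one_pos.trans hκ
  have hs1 : 1 < s := by nlinarith
  have hs0 : 0 < s := by linarith
  have hFi := integrable_prod_prabhakar hκ hα hlam0 hlam hγ hγ1 hs
  have hk : ∀ t : ℝ, Real.exp (-s * t) * k₂ α γ lam t =
      ∫ μ in Ioo (0 : ℝ) 1, Real.exp (-s * t) * prabhakar (-γ) α (1 - μ) lam t := fun t => by
    rw [k₂, intervalIntegral.integral_of_le zero_le_one, integral_Ioc_eq_integral_Ioo,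
      ← integral_const_mul]
  rw [laplace]
  simp_rw [hk]
  refine ⟨hFi.integral_prod_left, ?_⟩
  rw [integral_integral_swap (f := fun t μ => Real.exp (-s * t) * prabhakar (-γ) α (1 - μ) lam t)
    hFi]
  have hin : EqOn (fun μ => ∫ t in Ioi (0 : ℝ), Real.exp (-s * t) * prabhakar (-γ) α (1 - μ) lam t)
      (fun μ => s ^ (μ - 1) * (1 + lam * s ^ (-α)) ^ γ) (Ioo 0 1) := fun μ hμ => by
    have := (laplace_prabhakar hκ0 hα hlam (-γ) (by linarith [hμ.2] : 0 < 1 - μ) hs).2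
    rw [laplace, neg_neg, neg_sub] at this
    exact this
  rw [setIntegral_congr_fun measurableSet_Ioo hin, integral_mul_const,
    ← integral_Ioc_eq_integral_Ioo, ← intervalIntegral.integral_of_le zero_le_one]
  have hlog := Real.log_pos hs1
  have hint : ∫ μ in (0 : ℝ)..1, s ^ (μ - 1) = s ^ ((1 : ℝ) - 1) / Real.log s -
      s ^ ((0 : ℝ) - 1) / Real.log s := by
    refine intervalIntegral.integral_eq_sub_of_hasDerivAt
      (f := fun μ => s ^ (μ - 1) / Real.log s) (fun μ _ => ?_) ?_
    · have h1 := ((Real.hasStrictDerivAt_const_rpow hs0 (μ - 1)).hasDerivAt.comp μ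
        ((hasDerivAt_id μ).sub_const 1)).div_const (Real.log s)
      refine h1.congr_deriv ?_
      field_simp
    · refine Continuous.intervalIntegrable ?_ _ _
      exact Continuous.rpow continuous_const (by fun_prop) fun _ => Or.inl hs0.ne'
  rw [hint, symReal, sub_self, Real.rpow_zero, zero_sub, Real.rpow_neg_one]
  field_simp

theorem continuousOn_k₂ (hκ : 1 < κ) (hα : 0 ≤ α) (hlam : |lam| * κ ^ (-2 * α) < 1) (γ : ℝ) :
    ContinuousOn (k₂ α γ lam) (Ioi 0) := by
  have hκ0 : 0 < κ := one_pos.trans hκ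
  have hfam := continuousOn_prabhakar_family hκ hα hlam (-γ)
  obtain ⟨C, hC0, hC⟩ := (Adm.one_add_cpow hκ0 hα hlam (- -γ)).bound
  obtain ⟨K, hK, hKb⟩ := norm_contour_le hκ0 (N := 0) (σ := 2) (by norm_num) (by norm_num)
  have hbd : ∀ μ ∈ Ioo (0 : ℝ) 1, ∀ t : ℝ, 0 < t →
      ‖prabhakar (-γ) α (1 - μ) lam t‖ ≤ K * C * Real.exp (2 * κ ^ 2 * t) * t ^ (-2 : ℝ) := by
    intro μ hμ t ht
    have h1 := hKb C (prabSym (-γ) α (1 - μ) lam) (fun y => ?_) t ht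
    · rwa [contour_prabSym hκ0 hα hlam _ _ ht, Complex.norm_real] at h1
    · have hw : κ ≤ ((κ : ℂ) + y * Complex.I).re := by simp
      have h1 := one_lt_norm hκ hw
      rw [prabSym, norm_mul]
      refine le_trans ?_ (hC _ hw)
      refine mul_le_of_le_one_left (norm_nonneg _) ?_
      rw [Complex.norm_cpow_real]
      exact Real.rpow_le_one_of_one_le_of_nonpos h1.le (by linarith [hμ.2])
  intro t₀ ht₀
  have ht₀ : 0 < t₀ := ht₀
  refine ContinuousAt.continuousWithinAt ?_
  have e : k₂ α γ lam = fun t => ∫ μ in Ioo (0 : ℝ) 1, prabhakar (-γ) α (1 - μ) lam t := by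
    ext t
    rw [k₂, intervalIntegral.integral_of_le zero_le_one, integral_Ioc_eq_integral_Ioo]
  rw [e]
  refine continuousAt_of_dominated (bound := fun _ =>
    K * C * Real.exp (2 * κ ^ 2 * (2 * t₀)) * (t₀ / 2) ^ (-2 : ℝ)) ?_ ?_ (integrable_const _) ?_
  · filter_upwards [Ioi_mem_nhds ht₀] with t ht
    refine ContinuousOn.aestronglyMeasurable ?_ measurableSet_Ioo
    exact hfam.comp (f := fun μ : ℝ => (μ, t)) (by fun_prop) fun μ hμ => ⟨hμ.2, ht⟩
  · filter_upwards [Ioo_mem_nhds (half_lt_self ht₀) (lt_two_mul_self ht₀)] with t ht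
    filter_upwards [ae_restrict_mem measurableSet_Ioo] with μ hμ
    have ht1 : 0 < t := by linarith [ht.1]
    have := ht.2.le
    refine (hbd μ hμ t ht1).trans ?_
    have h4 : t ^ (-2 : ℝ) ≤ (t₀ / 2) ^ (-2 : ℝ) :=
      Real.rpow_le_rpow_of_nonpos (by linarith) ht.1.le (by norm_num)
    gcongr
  · filter_upwards [ae_restrict_mem measurableSet_Ioo] with μ hμ
    have h1 : ContinuousOn (fun t : ℝ => prabhakar (-γ) α (1 - μ) lam t) (Ioi 0) :=
      hfam.comp (f := fun t : ℝ => (μ, t)) (by fun_prop) fun t ht => ⟨hμ.2, ht⟩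
    exact h1.continuousAt (Ioi_mem_nhds ht₀)

theorem k₁_eq_k₂ : k₁ = k₂ 1 0 0 := by
  ext t
  rw [k₁, k₂]
  refine intervalIntegral.integral_congr fun μ _ => ?_
  simp only [prabhakar, neg_zero, zero_mul]
  rw [tsum_eq_single 0 fun j hj => by rw [zero_pow hj]; simp]
  simp [poch]
  ring_nf

end

end DistributedOrder
end

noncomputable section
namespace DistributedOrder

open Complex (I)

/-! ### Test functions -/

namespace IsTest

variable {φ : ℝ → ℝ}

theorem deriv (hφ : IsTest φ) : IsTest (deriv φ) :=
  ⟨((contDiff_infty_iff_deriv).1 hφ.1).2, hφ.2.deriv⟩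

theorem continuous (hφ : IsTest φ) : Continuous φ := hφ.1.continuous

theorem integrable (hφ : IsTest φ) : Integrable φ :=
  hφ.continuous.integrable_of_hasCompactSupport hφ.2

theorem hasDerivAt (hφ : IsTest φ) (x : ℝ) : HasDerivAt φ (_root_.deriv φ x) x :=
  ((contDiff_infty_iff_deriv).1 hφ.1).1.differentiableAt.hasDerivAt

theorem comp_neg (hφ : IsTest φ) : IsTest fun x => φ (-x) :=
  ⟨hφ.1.comp contDiff_neg, hφ.2.comp_homeomorph (Homeomorph.neg ℝ)⟩

theorem exists_norm_le (hφ : IsTest φ) : ∃ C, ∀ x, ‖φ x‖ ≤ C :=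
  hφ.continuous.bounded_above_of_compact_support hφ.2

end IsTest

/-! ### Exponentials of `-|x|` -/

theorem integrable_exp_neg_abs {ρ : ℂ} (hρ : 0 < ρ.re) :
    Integrable (fun x : ℝ => Complex.exp (-|x| * ρ)) ∧
      ∫ x : ℝ, ‖Complex.exp (-|x| * ρ)‖ = 2 / ρ.re := by
  have e : ∀ x : ℝ, ‖Complex.exp (-|x| * ρ)‖ = Real.exp (-ρ.re * |x|) := fun x => by
    rw [Complex.norm_exp]; congr 1
    simp [Complex.mul_re]; ring
  have hI : ∫ x in Ioi (0 : ℝ), Real.exp (-ρ.re * x) = 1 / ρ.re := by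
    have := integral_exp_mul_Ioi (neg_neg_of_pos hρ) 0
    rw [this]; simp
  have hint : Integrable fun x : ℝ => Real.exp (-ρ.re * |x|) := by
    by_contra h
    have h1 := integral_comp_abs (f := fun x => Real.exp (-ρ.re * x))
    rw [integral_undef h, hI] at h1
    have : 0 < 1 / ρ.re := by positivity
    linarith
  constructor
  · refine Integrable.mono' hint (by fun_prop) (Eventually.of_forall fun x => (e x).le)
  · simp_rw [e]
    rw [integral_comp_abs (f := fun x => Real.exp (-ρ.re * x)), hI]; ring

theorem integral_Ioi_exp_neg_mul_deriv_deriv {φ : ℝ → ℝ} (hφ : IsTest φ) (ρ : ℂ) :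
    ∫ x in Ioi (0 : ℝ), Complex.exp (-x * ρ) * (deriv (deriv φ) x - ρ ^ 2 * φ x) =
      -(deriv φ 0 + ρ * φ 0) := by
  have hd : ∀ x : ℝ, HasDerivAt (fun x : ℝ => Complex.exp (-x * ρ) * (deriv φ x + ρ * φ x))
      (Complex.exp (-x * ρ) * (deriv (deriv φ) x - ρ ^ 2 * φ x)) x := fun x => by
    have h1 : HasDerivAt (fun x : ℝ => Complex.exp (-x * ρ)) (Complex.exp (-x * ρ) * (-1 * ρ)) x :=
      ((Complex.ofRealCLM.hasDerivAt (x := x)).neg.mul_const ρ).cexp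
    have h2 : HasDerivAt (fun x : ℝ => (deriv φ x + ρ * φ x : ℂ))
        (deriv (deriv φ) x + ρ * deriv φ x) x :=
      (hφ.deriv.hasDerivAt x).ofReal_comp.add ((hφ.hasDerivAt x).ofReal_comp.const_mul ρ)
    refine (h1.mul h2).congr_deriv ?_
    ring
  have hc : HasCompactSupport fun x : ℝ => Complex.exp (-x * ρ) * (deriv φ x + ρ * φ x) := by
    refine HasCompactSupport.mul_left ?_
    refine HasCompactSupport.add ?_ ?_
    · exact hφ.deriv.2.comp_left (g := fun x : ℝ => (x : ℂ)) Complex.ofReal_zero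
    · exact (hφ.2.comp_left (g := fun x : ℝ => (x : ℂ)) Complex.ofReal_zero).mul_left
  have hc' : HasCompactSupport fun x : ℝ =>
      Complex.exp (-x * ρ) * (deriv (deriv φ) x - ρ ^ 2 * φ x) := by
    refine HasCompactSupport.mul_left ?_
    refine HasCompactSupport.sub ?_ ?_
    · exact hφ.deriv.deriv.2.comp_left (g := fun x : ℝ => (x : ℂ)) Complex.ofReal_zero
    · exact (hφ.2.comp_left (g := fun x : ℝ => (x : ℂ)) Complex.ofReal_zero).mul_left
  have hcont : Continuous fun x : ℝ =>
      Complex.exp (-x * ρ) * (deriv (deriv φ) x - ρ ^ 2 * φ x) := by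
    have h1 := hφ.deriv.deriv.continuous
    have h2 := hφ.continuous
    fun_prop
  have := integral_Ioi_of_hasDerivAt_of_tendsto (m := 0)
    (hd 0).continuousAt.continuousWithinAt (fun x _ => hd x)
    (hcont.integrable_of_hasCompactSupport hc').integrableOn
    (hc.is_zero_at_infty.mono_left atTop_le_cocompact)
  rw [this]; simp

theorem integral_exp_neg_abs_mul_deriv_deriv {φ : ℝ → ℝ} (hφ : IsTest φ) (ρ : ℂ) :
    ∫ x : ℝ, Complex.exp (-|x| * ρ) * deriv (deriv φ) x =
      ρ ^ 2 * (∫ x : ℝ, Complex.exp (-|x| * ρ) * φ x) - 2 * ρ * φ 0 := by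
  have hint : ∀ {ψ : ℝ → ℝ}, IsTest ψ →
      Integrable fun x : ℝ => Complex.exp (-|x| * ρ) * ψ x := fun {ψ} hψ => by
    refine Continuous.integrable_of_hasCompactSupport ?_ ?_
    · have := hψ.continuous
      fun_prop
    · exact (hψ.2.comp_left (g := fun x : ℝ => (x : ℂ)) Complex.ofReal_zero).mul_left
  have hI : Integrable fun x : ℝ => Complex.exp (-|x| * ρ) * (deriv (deriv φ) x - ρ ^ 2 * φ x) := by
    refine ((hint hφ.deriv.deriv).sub ((hint hφ).const_mul (ρ ^ 2))).congr
      (Eventually.of_forall fun x => ?_)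
    simp only [Pi.sub_apply]; ring
  have h1 : ∫ x : ℝ, Complex.exp (-|x| * ρ) * (deriv (deriv φ) x - ρ ^ 2 * φ x) =
      -2 * ρ * φ 0 := by
    rw [← intervalIntegral.integral_Iic_add_Ioi (b := 0) hI.integrableOn hI.integrableOn]
    have e1 : ∫ x in Ioi (0 : ℝ), Complex.exp (-|x| * ρ) * (deriv (deriv φ) x - ρ ^ 2 * φ x) =
        -(deriv φ 0 + ρ * φ 0) := by
      rw [← integral_Ioi_exp_neg_mul_deriv_deriv hφ ρ]
      refine setIntegral_congr_fun measurableSet_Ioi fun x hx => ?_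
      simp only [abs_of_pos (mem_Ioi.1 hx)]
    have hd1 : deriv (fun x => φ (-x)) = fun x => -deriv φ (-x) := by
      ext x; exact deriv_comp_neg φ x
    have hd2 : deriv (deriv fun x => φ (-x)) = fun x => deriv (deriv φ) (-x) := by
      ext x
      rw [hd1]
      simp only [deriv.fun_neg, deriv_comp_neg (deriv φ) x, neg_neg]
    have e2 : ∫ x in Iic (0 : ℝ), Complex.exp (-|x| * ρ) * (deriv (deriv φ) x - ρ ^ 2 * φ x) =
        -(-deriv φ 0 + ρ * φ 0) := by
      have := integral_Ioi_exp_neg_mul_deriv_deriv hφ.comp_neg ρ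
      rw [hd2, hd1] at this
      simp only [neg_zero, Complex.ofReal_neg] at this
      rw [← this]
      have h3 := integral_comp_neg_Ioi 0
        (fun x : ℝ => Complex.exp (-|x| * ρ) * (deriv (deriv φ) x - ρ ^ 2 * φ x))
      rw [neg_zero] at h3
      rw [← h3]
      refine setIntegral_congr_fun measurableSet_Ioi fun x hx => ?_
      simp only [abs_neg, abs_of_pos (mem_Ioi.1 hx)]
    rw [e1, e2]; ring
  have h2 : ∫ x : ℝ, Complex.exp (-|x| * ρ) * deriv (deriv φ) x =
      (∫ x : ℝ, Complex.exp (-|x| * ρ) * (deriv (deriv φ) x - ρ ^ 2 * φ x)) +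
        ρ ^ 2 * ∫ x : ℝ, Complex.exp (-|x| * ρ) * φ x := by
    rw [← integral_const_mul, ← integral_add hI ((hint hφ).const_mul _)]
    refine integral_congr_ae (Eventually.of_forall fun x => ?_)
    simp only; ring
  rw [h2, h1]; ring

/-! ### Superpositions of damped waves -/

/-- A symbol `R`, growing like a positive power of `w` and with a quantitative positive real
part. -/
structure WaveSym (κ : ℝ) (R : ℂ → ℂ) : Prop where
  adm : Adm κ 1 R
  inv : Adm κ (-(1 / 2)) fun w => (R w)⁻¹
  ne : ∀ w : ℂ, κ ≤ w.re → R w ≠ 0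
  re : ∃ c : ℝ, 0 < c ∧ ∀ w : ℂ, κ ≤ w.re → c / ‖w‖ * ‖R w‖ ≤ (R w).re
  conj : ∀ w : ℂ, κ ≤ w.re → R ((starRingEnd ℂ) w) = (starRingEnd ℂ) (R w)

/-- The symbol `A(w) exp(-|x| R(w))`. -/
def wave (A R : ℂ → ℂ) (x : ℝ) (w : ℂ) : ℂ := A w * Complex.exp (-|x| * R w)

variable {κ N : ℝ} {A R : ℂ → ℂ}

theorem WaveSym.re_pos (hκ : 0 < κ) (hR : WaveSym κ R) {w : ℂ} (hw : κ ≤ w.re) : 0 < (R w).re := by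
  obtain ⟨c, hc, h⟩ := hR.re
  have h1 : 0 < ‖R w‖ := norm_pos_iff.2 (hR.ne w hw)
  have h2 : 0 < ‖w‖ := norm_pos_iff.2 (ne_zero_of_re hκ hw)
  exact lt_of_lt_of_le (by positivity) (h w hw)

theorem norm_wave_le (hκ : 0 < κ) (hR : WaveSym κ R) (A : ℂ → ℂ) (x : ℝ) {w : ℂ} (hw : κ ≤ w.re) :
    ‖wave A R x w‖ ≤ ‖A w‖ := by
  rw [wave, norm_mul]
  refine mul_le_of_le_one_right (norm_nonneg _) ?_
  rw [Complex.norm_exp, Real.exp_le_one_iff]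
  simp only [Complex.mul_re, Complex.neg_re, Complex.ofReal_re, Complex.neg_im, Complex.ofReal_im,
    neg_zero, zero_mul, sub_zero]
  have := mul_nonneg (abs_nonneg x) (hR.re_pos hκ hw).le
  linarith

theorem Adm.wave (hκ : 0 < κ) (hR : WaveSym κ R) (hA : Adm κ N A) (x : ℝ) :
    Adm κ N (wave A R x) := by
  obtain ⟨C, hC, hb⟩ := hA.bound
  refine ⟨fun w hw => ?_, C, hC, fun w hw => (norm_wave_le hκ hR A x hw).trans (hb w hw)⟩
  exact (hA.diff w hw).mul ((hR.adm.diff w hw).const_mul _).cexp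

theorem continuous_wave (hR : WaveSym κ R) (hA : Adm κ N A) :
    Continuous fun z : ℝ × ℝ => wave A R z.1 (κ + z.2 * I) := by
  have h1 := hA.continuous_line.comp (continuous_snd (X := ℝ))
  have h2 := hR.adm.continuous_line.comp (continuous_snd (X := ℝ))
  refine h1.mul (Complex.continuous_exp.comp ?_)
  exact Continuous.mul (by fun_prop) h2

theorem wave_conj (hR : WaveSym κ R)
    (hA : ∀ w : ℂ, κ ≤ w.re → A ((starRingEnd ℂ) w) = (starRingEnd ℂ) (A w)) (x : ℝ) {w : ℂ}
    (hw : κ ≤ w.re) : wave A R x ((starRingEnd ℂ) w) = (starRingEnd ℂ) (wave A R x w) := by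
  rw [wave, wave, hA w hw, hR.conj w hw, map_mul, ← Complex.exp_conj]
  simp

theorem continuousOn_contour_wave (hκ : 0 < κ) (hR : WaveSym κ R) (hA : Adm κ N A) :
    ContinuousOn (fun z : ℝ × ℝ => contour κ (wave A R z.1) z.2) (univ ×ˢ Ioi 0) := by
  obtain ⟨C, hC⟩ := hA.line_bound
  exact continuousOn_contour_family hκ (continuous_wave hR hA) fun x y =>
    (norm_wave_le hκ hR A x (by simp)).trans (hC y)

theorem integrable_prod_wave (hκ : 0 < κ) (hR : WaveSym κ R) (hA : Adm κ N A) {t : ℝ}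
    (ht : 0 < t) : Integrable (fun z : ℝ × ℝ => Complex.exp ((κ + z.2 * I) ^ 2 * t) *
      ((κ + z.2 * I) * wave A R z.1 (κ + z.2 * I))) (volume.prod volume) := by
  have hcont : Continuous fun z : ℝ × ℝ => Complex.exp ((κ + z.2 * I) ^ 2 * t) *
      ((κ + z.2 * I) * wave A R z.1 (κ + z.2 * I)) :=
    Continuous.mul (by fun_prop) (Continuous.mul (by fun_prop) (continuous_wave hR hA))
  obtain ⟨c, hc, hre⟩ := hR.re
  rw [integrable_prod_iff' hcont.aestronglyMeasurable]
  have hw : ∀ y : ℝ, κ ≤ ((κ : ℂ) + y * I).re := fun y => by simp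
  constructor
  · refine Eventually.of_forall fun y => ?_
    exact (((integrable_exp_neg_abs (hR.re_pos hκ (hw y))).1.const_mul (A (κ + y * I))).const_mul
      (κ + y * I)).const_mul (Complex.exp ((κ + y * I) ^ 2 * t))
  · have hAw : Adm κ (N + 1 + -(1 / 2)) fun w => (A w * w) * (R w)⁻¹ := by
      refine (hA.mul hκ ?_).mul hκ hR.inv
      have := Adm.cpow hκ 1
      simpa using this
    obtain ⟨C, hC⟩ := hAw.line_bound
    have hi := (integrable_integrand (h := fun w => (A w * w) * (R w)⁻¹) hκ
      hAw.continuous_line hC ht).norm.const_mul (2 / c)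
    refine Integrable.mono' hi ?_ (Eventually.of_forall fun y => ?_)
    · exact hcont.norm.aestronglyMeasurable.prod_swap.integral_prod_right'
    · rw [Real.norm_of_nonneg (integral_nonneg fun _ => norm_nonneg _)]
      have h1 : 0 < ‖R (κ + y * I)‖ := norm_pos_iff.2 (hR.ne _ (hw y))
      have h2 := norm_line_pos hκ y
      have h3 := hre _ (hw y)
      have h4 := hR.re_pos hκ (hw y)
      simp only [wave, norm_mul, norm_inv]
      rw [integral_const_mul, integral_const_mul, integral_const_mul,
        (integrable_exp_neg_abs h4).2]
      have h5 : 2 / (R (κ + y * I)).re ≤ 2 / c * (‖(κ : ℂ) + y * I‖ * ‖R (κ + y * I)‖⁻¹) := by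
        rw [div_le_iff₀ h4]
        calc (2 : ℝ) = 2 / c * (‖(κ : ℂ) + y * I‖ * ‖R (κ + y * I)‖⁻¹) *
            (c / ‖(κ : ℂ) + y * I‖ * ‖R (κ + y * I)‖) := by field_simp
          _ ≤ _ := by gcongr
      have h6 := mul_le_mul_of_nonneg_left h5 (by positivity :
        0 ≤ ‖Complex.exp ((κ + y * I) ^ 2 * t)‖ * ‖(κ : ℂ) + y * I‖ * ‖A (κ + y * I)‖)
      calc _ = ‖Complex.exp ((κ + y * I) ^ 2 * t)‖ * ‖(κ : ℂ) + y * I‖ * ‖A (κ + y * I)‖ *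
          (2 / (R (κ + y * I)).re) := by ring
        _ ≤ _ := h6
        _ = _ := by ring

theorem integrable_contour_wave (hκ : 0 < κ) (hR : WaveSym κ R) (hA : Adm κ N A) {t : ℝ}
    (ht : 0 < t) : Integrable fun x : ℝ => contour κ (wave A R x) t :=
  (integrable_prod_wave hκ hR hA ht).integral_prod_left.const_mul _

theorem integral_contour_wave_mul (hκ : 0 < κ) (hR : WaveSym κ R) (hA : Adm κ N A) {φ : ℝ → ℝ}
    (hφ : IsTest φ) {t : ℝ} (ht : 0 < t) :
    ∫ x : ℝ, contour κ (wave A R x) t * φ x =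
      contour κ (fun w => A w * ∫ x : ℝ, Complex.exp (-|x| * R w) * φ x) t := by
  obtain ⟨C, hC⟩ := hφ.exists_norm_le
  have hi : Integrable (fun z : ℝ × ℝ => Complex.exp ((κ + z.2 * I) ^ 2 * t) *
      ((κ + z.2 * I) * wave A R z.1 (κ + z.2 * I)) * φ z.1) (volume.prod volume) := by
    refine (integrable_prod_wave hκ hR hA ht).mul_bdd (c := C) ?_ ?_
    · exact (Complex.continuous_ofReal.comp
        (hφ.continuous.comp continuous_fst)).aestronglyMeasurable
    · exact Eventually.of_forall fun z => by rw [Complex.norm_real]; exact hC _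
  simp only [contour]
  simp_rw [mul_assoc _ _ (φ _ : ℂ), ← integral_mul_const]
  rw [integral_const_mul, integral_integral_swap hi]
  congr 1
  refine integral_congr_ae (Eventually.of_forall fun y => ?_)
  simp only [wave]
  rw [← integral_const_mul, ← integral_const_mul, ← integral_const_mul]
  refine integral_congr_ae (Eventually.of_forall fun x => ?_)
  simp only; ring

end DistributedOrder
end

noncomputable section
namespace DistributedOrder

open Complex (I)

variable {κ N : ℝ} {A R : ℂ → ℂ}

theorem integrable_exp_neg_abs_mul {φ : ℝ → ℝ} (hφ : IsTest φ) (ρ : ℂ) :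
    Integrable fun x : ℝ => Complex.exp (-|x| * ρ) * φ x := by
  refine Continuous.integrable_of_hasCompactSupport ?_ ?_
  · have := hφ.continuous
    fun_prop
  · exact (hφ.2.comp_left (g := fun x : ℝ => (x : ℂ)) Complex.ofReal_zero).mul_left

/-- The transform `∫ exp(-|x| R(w)) φ(x) dx`. -/
def absTransform (R : ℂ → ℂ) (φ : ℝ → ℝ) (w : ℂ) : ℂ := ∫ x : ℝ, Complex.exp (-|x| * R w) * φ x

theorem norm_exp_neg_abs_mul_le (hκ : 0 < κ) (hR : WaveSym κ R) (φ : ℝ → ℝ) (x : ℝ) {w : ℂ}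
    (hw : κ ≤ w.re) : ‖Complex.exp (-|x| * R w) * φ x‖ ≤ ‖φ x‖ := by
  have := norm_wave_le hκ hR (fun _ => 1) x hw
  rw [wave, one_mul, norm_one] at this
  rw [norm_mul, Complex.norm_real]
  exact mul_le_of_le_one_left (norm_nonneg _) this

theorem norm_absTransform_le (hκ : 0 < κ) (hR : WaveSym κ R) {φ : ℝ → ℝ} (hφ : IsTest φ) {w : ℂ}
    (hw : κ ≤ w.re) : ‖absTransform R φ w‖ ≤ ∫ x, ‖φ x‖ :=
  norm_integral_le_of_norm_le hφ.integrable.norm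
    (Eventually.of_forall fun x => norm_exp_neg_abs_mul_le hκ hR φ x hw)

theorem continuous_absTransform (hκ : 0 < κ) (hR : WaveSym κ R) {φ : ℝ → ℝ} (hφ : IsTest φ) :
    Continuous fun y : ℝ => absTransform R φ (κ + y * I) := by
  refine continuous_of_dominated (bound := fun x => ‖φ x‖) (fun y => ?_) (fun y => ?_)
    hφ.integrable.norm ?_
  · exact (integrable_exp_neg_abs_mul hφ _).aestronglyMeasurable
  · exact Eventually.of_forall fun x => norm_exp_neg_abs_mul_le hκ hR φ x (by simp)
  · refine Eventually.of_forall fun x => ?_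
    have := hR.adm.continuous_line
    exact (Complex.continuous_exp.comp (continuous_const.mul this)).mul continuous_const

theorem norm_mul_absTransform_le (hκ : 0 < κ) (hR : WaveSym κ R) (hA : Adm κ N A) {φ : ℝ → ℝ}
    (hφ : IsTest φ) : ∃ C : ℝ, ∀ y : ℝ, ‖A (κ + y * I) * absTransform R φ (κ + y * I)‖ ≤
      C * ‖(κ : ℂ) + y * I‖ ^ N := by
  obtain ⟨C, hC⟩ := hA.line_bound
  refine ⟨C * ∫ x, ‖φ x‖, fun y => ?_⟩
  rw [norm_mul]
  calc _ ≤ (C * ‖(κ : ℂ) + y * I‖ ^ N) * ∫ x, ‖φ x‖ :=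
        mul_le_mul (hC y) (norm_absTransform_le hκ hR hφ (by simp)) (norm_nonneg _)
          ((norm_nonneg _).trans (hC y))
    _ = _ := by ring

/-- The real superposition of damped waves with amplitude `A`. -/
def waveSol (κ : ℝ) (A R : ℂ → ℂ) (x t : ℝ) : ℝ := (contour κ (wave A R x) t).re

/-- Compatibility of a symbol with complex conjugation. -/
def ConjSym (κ : ℝ) (A : ℂ → ℂ) : Prop :=
  ∀ w : ℂ, κ ≤ w.re → A ((starRingEnd ℂ) w) = (starRingEnd ℂ) (A w)

theorem ofReal_waveSol (hR : WaveSym κ R) (hA : ConjSym κ A) (x t : ℝ) :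
    ((waveSol κ A R x t : ℝ) : ℂ) = contour κ (wave A R x) t :=
  contour_conj (fun y => wave_conj hR hA x (by simp)) t

theorem continuousOn_waveSol (hκ : 0 < κ) (hR : WaveSym κ R) (hA : Adm κ N A) :
    ContinuousOn (fun z : ℝ × ℝ => waveSol κ A R z.1 z.2) (univ ×ˢ Ioi 0) :=
  Complex.continuous_re.comp_continuousOn (continuousOn_contour_wave hκ hR hA)

theorem continuousOn_waveSol_right (hκ : 0 < κ) (hR : WaveSym κ R) (hA : Adm κ N A) (x : ℝ) :
    ContinuousOn (waveSol κ A R x) (Ioi 0) :=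
  (continuousOn_waveSol hκ hR hA).comp (f := fun t : ℝ => (x, t)) (by fun_prop)
    fun _ ht => ⟨mem_univ _, ht⟩

theorem continuous_waveSol_left (hκ : 0 < κ) (hR : WaveSym κ R) (hA : Adm κ N A) {t : ℝ}
    (ht : 0 < t) : Continuous fun x => waveSol κ A R x t := by
  rw [← continuousOn_univ]
  exact (continuousOn_waveSol hκ hR hA).comp (f := fun x : ℝ => (x, t)) (by fun_prop)
    fun _ hx => ⟨hx, ht⟩

theorem integrable_waveSol (hκ : 0 < κ) (hR : WaveSym κ R) (hA : Adm κ N A) {t : ℝ}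
    (ht : 0 < t) : Integrable fun x => waveSol κ A R x t :=
  (integrable_contour_wave hκ hR hA ht).re

theorem norm_waveSol_le (hκ : 0 < κ) (hR : WaveSym κ R) (hA : Adm κ N A) {σ : ℝ} (hσ : 0 ≤ σ)
    (hN : N + 2 < 2 * σ) : ∃ C : ℝ, 0 ≤ C ∧ ∀ x t : ℝ, 0 < t →
      ‖waveSol κ A R x t‖ ≤ C * Real.exp (2 * κ ^ 2 * t) * t ^ (-σ) := by
  obtain ⟨K, hK, hb⟩ := norm_contour_le hκ hσ hN
  obtain ⟨C, hC, hA⟩ := hA.bound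
  refine ⟨K * C, by positivity, fun x t ht => ?_⟩
  refine (Complex.abs_re_le_norm _).trans (hb C _ (fun y => ?_) t ht)
  exact (norm_wave_le hκ hR A x (by simp)).trans (hA _ (by simp))

theorem integral_waveSol_mul (hκ : 0 < κ) (hR : WaveSym κ R) (hA : Adm κ N A) (hA' : ConjSym κ A)
    {φ : ℝ → ℝ} (hφ : IsTest φ) {t : ℝ} (ht : 0 < t) :
    ((∫ x, waveSol κ A R x t * φ x : ℝ) : ℂ) = contour κ (fun w => A w * absTransform R φ w) t := by
  rw [← integral_complex_ofReal]
  simp_rw [Complex.ofReal_mul, ofReal_waveSol hR hA']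
  exact integral_contour_wave_mul hκ hR hA hφ ht

theorem contour_add {h h' : ℂ → ℂ} {t N' C C' : ℝ} (hκ : 0 < κ) (ht : 0 < t)
    (hc : Continuous fun y : ℝ => h (κ + y * I)) (hc' : Continuous fun y : ℝ => h' (κ + y * I))
    (hb : ∀ y : ℝ, ‖h (κ + y * I)‖ ≤ C * ‖(κ : ℂ) + y * I‖ ^ N)
    (hb' : ∀ y : ℝ, ‖h' (κ + y * I)‖ ≤ C' * ‖(κ : ℂ) + y * I‖ ^ N') :
    contour κ (fun w => h w + h' w) t = contour κ h t + contour κ h' t := by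
  rw [contour, contour, contour, ← mul_add, ← integral_add (integrable_integrand hκ hc hb ht)
    (integrable_integrand hκ hc' hb' ht)]
  congr 1
  refine integral_congr_ae (Eventually.of_forall fun y => ?_)
  simp only; ring

theorem Adm.inv_sq (hκ : 0 < κ) : Adm κ (-2) fun w => (w ^ 2)⁻¹ := by
  refine (Adm.cpow hκ (-2)).congr hκ fun w _ => ?_
  rw [show (((-2 : ℝ)) : ℂ) = ((-2 : ℤ) : ℂ) by norm_num, Complex.cpow_intCast]
  simp [zpow_neg]


/-- The amplitude of the solution. -/
def ampP (R : ℂ → ℂ) (w : ℂ) : ℂ := 1 / 2 * (R w * (w ^ 2)⁻¹)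

/-- The amplitude of the potential, whose second `x`-derivative is the solution up to `δ`. -/
def ampM (R : ℂ → ℂ) (w : ℂ) : ℂ := 1 / 2 * ((R w)⁻¹ * (w ^ 2)⁻¹)

/-- The amplitude of the time derivative of the potential. -/
def ampQ (R : ℂ → ℂ) (w : ℂ) : ℂ := 1 / 2 * (R w)⁻¹

theorem adm_ampP (hκ : 0 < κ) (hR : WaveSym κ R) : Adm κ (-1) (ampP R) := by
  have := (hR.adm.mul hκ (Adm.inv_sq hκ)).const_mul (1 / 2)
  norm_num at this ⊢
  exact this

theorem adm_ampM (hκ : 0 < κ) (hR : WaveSym κ R) : Adm κ (-(5 / 2)) (ampM R) := by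
  have := (hR.inv.mul hκ (Adm.inv_sq hκ)).const_mul (1 / 2)
  rw [show -(1 / 2) + -2 = (-(5 / 2) : ℝ) by norm_num] at this
  exact this

theorem adm_ampQ (hR : WaveSym κ R) : Adm κ (-(1 / 2)) (ampQ R) := hR.inv.const_mul (1 / 2)

theorem conjSym_ampP (hR : WaveSym κ R) : ConjSym κ (ampP R) := fun w hw => by
  simp [ampP, hR.conj w hw]
  exact Or.inl (map_ofNat _ 2).symm

theorem conjSym_ampM (hR : WaveSym κ R) : ConjSym κ (ampM R) := fun w hw => by
  simp [ampM, hR.conj w hw]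
  exact Or.inl (map_ofNat _ 2).symm

theorem conjSym_ampQ (hR : WaveSym κ R) : ConjSym κ (ampQ R) := fun w hw => by
  simp [ampQ, hR.conj w hw]
  exact Or.inl (map_ofNat _ 2).symm

theorem integral_ampP_eq (hκ : 0 < κ) (hR : WaveSym κ R) {φ : ℝ → ℝ} (hφ : IsTest φ) {t : ℝ}
    (ht : 0 < t) : ∫ x, waveSol κ (ampP R) R x t * φ x =
      (∫ x, waveSol κ (ampM R) R x t * deriv (deriv φ) x) + φ 0 := by
  rw [← Complex.ofReal_inj, Complex.ofReal_add,
    integral_waveSol_mul hκ hR (adm_ampP hκ hR) (conjSym_ampP hR) hφ ht,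
    integral_waveSol_mul hκ hR (adm_ampM hκ hR) (conjSym_ampM hR) hφ.deriv.deriv ht]
  obtain ⟨C, hC⟩ := norm_mul_absTransform_le hκ hR (adm_ampM hκ hR) hφ.deriv.deriv
  have hsq := (Adm.inv_sq hκ).const_mul (φ 0)
  obtain ⟨C', hC'⟩ := hsq.line_bound
  have h1 := contour_add (h := fun w => ampM R w * absTransform R (deriv (deriv φ)) w)
    (h' := fun w => φ 0 * (w ^ 2)⁻¹) hκ ht
    ((adm_ampM hκ hR).continuous_line.mul (continuous_absTransform hκ hR hφ.deriv.deriv))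
    hsq.continuous_line hC hC'
  rw [contour_const_mul, contour_inv_sq hκ ht, mul_one] at h1
  rw [← h1]
  refine contour_congr (fun y => ?_) t
  have hw : κ ≤ ((κ : ℂ) + y * I).re := by simp
  have hw0 := ne_zero_of_re hκ hw
  have hR0 := hR.ne _ hw
  rw [absTransform, absTransform, integral_exp_neg_abs_mul_deriv_deriv hφ, ampP, ampM]
  field_simp
  ring

theorem hasDerivAt_integral_ampP (hκ : 0 < κ) (hR : WaveSym κ R) {φ : ℝ → ℝ} (hφ : IsTest φ)
    {t : ℝ} (ht : 0 < t) : HasDerivAt (fun t => ∫ x, waveSol κ (ampP R) R x t * φ x)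
      (∫ x, waveSol κ (ampQ R) R x t * deriv (deriv φ) x) t := by
  have hφ2 := hφ.deriv.deriv
  obtain ⟨C, hC⟩ := norm_mul_absTransform_le hκ hR (adm_ampM hκ hR) hφ2
  have h1 := hasDerivAt_contour (h := fun w => ampM R w * absTransform R (deriv (deriv φ)) w) hκ
    ((adm_ampM hκ hR).continuous_line.mul (continuous_absTransform hκ hR hφ2)) hC ht
  have h2 : contour κ (fun w => w ^ 2 * (ampM R w * absTransform R (deriv (deriv φ)) w)) t =
      ((∫ x, waveSol κ (ampQ R) R x t * deriv (deriv φ) x : ℝ) : ℂ) := by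
    rw [integral_waveSol_mul hκ hR (adm_ampQ hR) (conjSym_ampQ hR) hφ2 ht]
    refine contour_congr (fun y => ?_) t
    have hw0 := ne_zero_of_re hκ (w := κ + y * I) (by simp)
    rw [ampM, ampQ]
    field_simp
  rw [h2] at h1
  have h3 := (Complex.reCLM.hasFDerivAt.comp_hasDerivAt t h1).add_const (φ 0)
  refine h3.congr_of_eventuallyEq ?_
  filter_upwards [Ioi_mem_nhds ht] with τ hτ
  rw [integral_ampP_eq hκ hR hφ hτ]
  simp only [Function.comp, Complex.reCLM_apply]
  rw [← integral_waveSol_mul hκ hR (adm_ampM hκ hR) (conjSym_ampM hR) hφ2 hτ, Complex.ofReal_re]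

theorem tendsto_contour_zero (hκ : 0 < κ) {h : ℂ → ℂ} (hh : Adm κ N h) (hN : N < -2) :
    Tendsto (contour κ h) (𝓝[>] 0) (𝓝 0) := by
  obtain ⟨C, hC, hb⟩ := hh.bound
  have hg : ∀ w : ℂ, κ ≤ w.re → ‖w * h w‖ ≤ C * ‖w‖ ^ (-1 - (-N - 2)) := fun w hw => by
    have h1 : 0 < ‖w‖ := norm_pos_iff.2 (ne_zero_of_re hκ hw)
    rw [norm_mul, show -1 - (-N - 2) = N + 1 by ring, Real.rpow_add_one h1.ne']
    calc _ ≤ ‖w‖ * (C * ‖w‖ ^ N) := by gcongr; exact hb w hw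
      _ = _ := by ring
  have hv := integral_vertical_eq_zero (M := 0) (C := C) (δ := -N - 2) (g := fun w => w * h w) hκ
    (by linarith) (continuousOn_id.mul hh.continuousOn)
    (fun w hw => differentiableAt_id.mul (hh.diff w hw.le)) fun w hw _ => hg w hw
  have h0 : (0 : ℂ) = (Real.pi : ℂ)⁻¹ * ∫ y : ℝ, (κ + y * I) * h (κ + y * I) := by
    rw [hv.2, mul_zero]
  rw [h0]
  refine Tendsto.const_mul _ ?_
  refine tendsto_integral_filter_of_dominated_convergence
    (fun y => Real.exp (2 * κ ^ 2) * ‖(κ + y * I) * h (κ + y * I)‖)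
    (Eventually.of_forall fun t => measurable_integrand hh.continuous_line t) ?_
    (hv.1.norm.const_mul _) (Eventually.of_forall fun y => ?_)
  · filter_upwards [Ioo_mem_nhdsGT (zero_lt_one (α := ℝ))] with t ht
    refine Eventually.of_forall fun y => ?_
    rw [norm_mul, norm_exp_line]
    refine mul_le_mul_of_nonneg_right ?_ (norm_nonneg _)
    have h1 : Real.exp (2 * κ ^ 2 * t) ≤ Real.exp (2 * κ ^ 2) :=
      Real.exp_le_exp.2 (by nlinarith [sq_nonneg κ, ht.2])
    have h2 : Real.exp (-(‖(κ : ℂ) + y * I‖ ^ 2 * t)) ≤ 1 :=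
      Real.exp_le_one_iff.2 (by have := ht.1; simp only [Left.neg_nonpos_iff]; positivity)
    exact (mul_le_mul h1 h2 (Real.exp_pos _).le (Real.exp_pos _).le).trans_eq (mul_one _)
  · have h1 : Continuous fun t : ℝ => Complex.exp ((κ + y * I) ^ 2 * t) *
        ((κ + y * I) * h (κ + y * I)) := by fun_prop
    have h2 := h1.tendsto 0
    simp only [Complex.ofReal_zero, mul_zero, Complex.exp_zero, one_mul] at h2
    exact h2.mono_left nhdsWithin_le_nhds

theorem tendsto_integral_ampP (hκ : 0 < κ) (hR : WaveSym κ R) {φ : ℝ → ℝ} (hφ : IsTest φ) :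
    Tendsto (fun t => ∫ x, waveSol κ (ampP R) R x t * φ x) (𝓝[>] 0) (𝓝 (φ 0)) := by
  have hA := adm_ampM hκ hR
  have hφ2 := hφ.deriv.deriv
  obtain ⟨C, hC0, hC⟩ := norm_waveSol_le hκ hR hA (σ := 0) le_rfl (by norm_num)
  have h1 : Tendsto (fun t => ∫ x, waveSol κ (ampM R) R x t * deriv (deriv φ) x) (𝓝[>] 0)
      (𝓝 (∫ x, 0 * deriv (deriv φ) x)) := by
    refine tendsto_integral_filter_of_dominated_convergence
      (fun x => C * Real.exp (2 * κ ^ 2) * ‖deriv (deriv φ) x‖) ?_ ?_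
      (hφ2.integrable.norm.const_mul _) ?_
    · filter_upwards [self_mem_nhdsWithin] with t ht
      exact ((continuous_waveSol_left hκ hR hA ht).mul hφ2.continuous).aestronglyMeasurable
    · filter_upwards [Ioo_mem_nhdsGT (zero_lt_one (α := ℝ))] with t ht
      refine Eventually.of_forall fun x => ?_
      rw [norm_mul]
      refine mul_le_mul_of_nonneg_right ?_ (norm_nonneg _)
      refine (hC x t ht.1).trans ?_
      rw [neg_zero, Real.rpow_zero, mul_one]
      refine mul_le_mul_of_nonneg_left (Real.exp_le_exp.2 ?_) hC0
      nlinarith [sq_nonneg κ, ht.2]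
    · refine Eventually.of_forall fun x => Tendsto.mul_const _ ?_
      have : Tendsto (waveSol κ (ampM R) R x) (𝓝[>] 0) (𝓝 (0 : ℂ).re) :=
        (Complex.continuous_re.tendsto 0).comp
          (tendsto_contour_zero hκ (hA.wave hκ hR x) (by norm_num))
      simpa using this
  simp only [zero_mul, integral_zero] at h1
  have h2 := h1.add_const (φ 0)
  rw [zero_add] at h2
  refine h2.congr' ?_
  filter_upwards [self_mem_nhdsWithin] with t ht
  exact (integral_ampP_eq hκ hR hφ ht).symm

end DistributedOrder
end

noncomputable section
namespace DistributedOrder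

open Complex (I)

variable {κ N B : ℝ} {A R : ℂ → ℂ} {k r : ℝ → ℝ}

/-- The Laplace transform of the kernel `k` is `B R² / s`, where `R` takes the real value `r s` at
`√s`. -/
structure KernelSym (κ B : ℝ) (R : ℂ → ℂ) (k r : ℝ → ℝ) : Prop where
  cont : ContinuousOn k (Ioi 0)
  real : ∀ s : ℝ, κ ^ 2 < s → R ((√s : ℝ) : ℂ) = ((r s : ℝ) : ℂ)
  integrable : ∀ s : ℝ, κ ^ 2 < s → IntegrableOn (fun t : ℝ => Real.exp (-s * t) * k t) (Ioi 0)
  laplace : ∀ s : ℝ, κ ^ 2 < s → laplace k s = B * r s ^ 2 / s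

theorem KernelSym.r_pos (hκ : 0 < κ) (hR : WaveSym κ R) (hk : KernelSym κ B R k r) {s : ℝ}
    (hs : κ ^ 2 < s) : 0 < r s := by
  have := hR.re_pos hκ (sqrt_facts hs).1.le
  rwa [hk.real s hs, Complex.ofReal_re] at this

theorem laplace_ampP (hκ : 0 < κ) (hR : WaveSym κ R) (hk : KernelSym κ B R k r) (x : ℝ) {s : ℝ}
    (hs : κ ^ 2 < s) :
    IntegrableOn (fun t : ℝ => Real.exp (-s * t) * waveSol κ (ampP R) R x t) (Ioi 0) ∧
      laplace (waveSol κ (ampP R) R x) s = 1 / (2 * s) * r s * Real.exp (-|x| * r s) := by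
  obtain ⟨h1, h2⟩ := ((adm_ampP hκ hR).wave hκ hR x).laplace_contour_re hκ one_pos hs
  refine ⟨h1, h2.trans ?_⟩
  rw [wave, ampP, (sqrt_facts hs).2.2, hk.real s hs,
    show (1 / 2 : ℂ) = ((1 / 2 : ℝ) : ℂ) by norm_num]
  norm_cast
  ring

theorem laplace_ampQ (hκ : 0 < κ) (hR : WaveSym κ R) (hk : KernelSym κ B R k r) (x : ℝ) {s : ℝ}
    (hs : κ ^ 2 < s) :
    IntegrableOn (fun t : ℝ => Real.exp (-s * t) * waveSol κ (ampQ R) R x t) (Ioi 0) ∧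
      laplace (waveSol κ (ampQ R) R x) s = 1 / 2 * (r s)⁻¹ * Real.exp (-|x| * r s) := by
  obtain ⟨h1, h2⟩ := ((adm_ampQ hR).wave hκ hR x).laplace_contour_re hκ one_half_pos hs
  refine ⟨h1, h2.trans ?_⟩
  rw [wave, ampQ, hk.real s hs, show (1 / 2 : ℂ) = ((1 / 2 : ℝ) : ℂ) by norm_num]
  norm_cast

theorem conv_ampQ (hκ : 0 < κ) (hR : WaveSym κ R) (hk : KernelSym κ B R k r) (x : ℝ) {t : ℝ}
    (ht : 0 < t) :
    ∫ ξ in (0 : ℝ)..t, k (t - ξ) * waveSol κ (ampQ R) R x ξ = B * waveSol κ (ampP R) R x t := by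
  have hs0 : κ ^ 2 < κ ^ 2 + 1 := by linarith
  have hq := continuousOn_waveSol_right hκ hR (adm_ampQ hR) x
  have hp := continuousOn_waveSol_right hκ hR (adm_ampP hκ hR) x
  refine eq_of_laplace_eq (s₀ := κ ^ 2)
    (f := fun t => ∫ ξ in (0 : ℝ)..t, k (t - ξ) * waveSol κ (ampQ R) R x ξ)
    (g := fun t => B * waveSol κ (ampP R) R x t)
    (continuousOn_conv hk.cont hq (integrableOn_Ioc_of_laplace (hk.integrable _ hs0))
      (integrableOn_Ioc_of_laplace (laplace_ampQ hκ hR hk x hs0).1))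
    (continuousOn_const.mul hp)
    (fun s hs => (laplace_conv (hk.integrable s hs) (laplace_ampQ hκ hR hk x hs).1).1)
    (fun s hs => ?_) (fun s hs => ?_) ht
  · refine ((laplace_ampP hκ hR hk x hs).1.const_mul B).congr (Eventually.of_forall fun t => ?_)
    simp only; ring
  · rw [(laplace_conv (hk.integrable s hs) (laplace_ampQ hκ hR hk x hs).1).2,
      hk.laplace s hs, (laplace_ampQ hκ hR hk x hs).2]
    have h1 := (laplace_ampP hκ hR hk x hs).2
    have hr := hk.r_pos hκ hR hs
    have hs' : 0 < s := lt_of_le_of_lt (sq_nonneg κ) hs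
    have h2 : laplace (fun t => B * waveSol κ (ampP R) R x t) s =
        B * laplace (waveSol κ (ampP R) R x) s := by
      rw [laplace, laplace, ← integral_const_mul]
      refine integral_congr_ae (Eventually.of_forall fun t => ?_)
      simp only; ring
    rw [h2, h1]
    field_simp

theorem integrable_prod_conv (hκ : 0 < κ) (hR : WaveSym κ R) (hk : KernelSym κ B R k r)
    {φ : ℝ → ℝ} (hφ : IsTest φ) {t : ℝ} (ht : 0 < t) :
    Integrable (fun z : ℝ × ℝ => k (t - z.1) * waveSol κ (ampQ R) R z.2 z.1 * φ z.2)
      ((volume.restrict (Ioo 0 t)).prod volume) := by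
  obtain ⟨C, hC0, hC⟩ := norm_waveSol_le hκ hR (adm_ampQ hR) (σ := 7 / 8) (by norm_num)
    (by norm_num)
  have hs0 : κ ^ 2 < κ ^ 2 + 1 := by linarith
  have hpow : ContinuousOn (fun ξ : ℝ => ξ ^ (-(7 / 8) : ℝ)) (Ioi 0) := fun ξ hξ =>
    (Real.continuousAt_rpow_const _ _ (Or.inl (ne_of_gt hξ))).continuousWithinAt
  have hI := conv_intervalIntegrable hk.cont hpow
    (integrableOn_Ioc_of_laplace (hk.integrable _ hs0))
    (fun T => ?_) ht
  · rw [intervalIntegrable_iff_integrableOn_Ioo_of_le ht.le] at hI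
    have hb := (hI.norm.const_mul (C * Real.exp (2 * κ ^ 2 * t))).mul_prod hφ.integrable.norm
    refine Integrable.mono' hb ?_ ?_
    · rw [← Measure.restrict_univ (μ := (volume : Measure ℝ)), Measure.restrict_restrict
        measurableSet_Ioo, inter_univ, Measure.prod_restrict]
      refine ContinuousOn.aestronglyMeasurable ?_ (measurableSet_Ioo.prod MeasurableSet.univ)
      refine ContinuousOn.mul (ContinuousOn.mul ?_ ?_) ?_
      · exact hk.cont.comp (by fun_prop) fun z hz => sub_pos.2 hz.1.2
      · exact (continuousOn_waveSol hκ hR (adm_ampQ hR)).comp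
          (f := fun z : ℝ × ℝ => (z.2, z.1)) (by fun_prop) fun z hz => ⟨mem_univ _, hz.1.1⟩
      · exact (hφ.continuous.comp continuous_snd).continuousOn
    · have : ∀ᵐ z : ℝ × ℝ ∂((volume.restrict (Ioo 0 t)).prod volume), z.1 ∈ Ioo 0 t :=
        Measure.quasiMeasurePreserving_fst.ae (ae_restrict_mem measurableSet_Ioo)
      filter_upwards [this] with z hz
      rw [norm_mul, norm_mul, norm_mul, Real.norm_of_nonneg (Real.rpow_nonneg hz.1.le _)]
      refine mul_le_mul_of_nonneg_right ?_ (norm_nonneg _)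
      have h1 : ‖waveSol κ (ampQ R) R z.2 z.1‖ ≤
          C * Real.exp (2 * κ ^ 2 * t) * z.1 ^ (-(7 / 8) : ℝ) := by
        refine (hC z.2 z.1 hz.1).trans ?_
        refine mul_le_mul_of_nonneg_right ?_ (Real.rpow_nonneg hz.1.le _)
        refine mul_le_mul_of_nonneg_left (Real.exp_le_exp.2 ?_) hC0
        exact mul_le_mul_of_nonneg_left hz.2.le (by positivity)
      calc _ ≤ ‖k (t - z.1)‖ * (C * Real.exp (2 * κ ^ 2 * t) * z.1 ^ (-(7 / 8) : ℝ)) := by gcongr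
        _ = _ := by ring
  · rcases le_or_gt T 0 with hT | hT
    · rw [Ioc_eq_empty (not_lt.2 hT)]; exact integrableOn_empty
    · rw [← intervalIntegrable_iff_integrableOn_Ioc_of_le hT.le]
      exact intervalIntegral.intervalIntegrable_rpow' (by norm_num)

theorem isFundamentalSolution_of_kernelSym (hκ : 0 < κ) (hR : WaveSym κ R)
    (hk : KernelSym κ B R k r) : IsFundamentalSolution k B (waveSol κ (ampP R) R) where
  continuousOn := continuousOn_waveSol hκ hR (adm_ampP hκ hR)
  integrable t ht := integrable_waveSol hκ hR (adm_ampP hκ hR) ht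
  initial φ hφ := tendsto_integral_ampP hκ hR hφ
  differentiable φ hφ t ht := (hasDerivAt_integral_ampP hκ hR hφ ht).differentiableAt
  convIntegrable φ hφ t ht := by
    rw [intervalIntegrable_iff_integrableOn_Ioo_of_le ht.le]
    refine (integrable_prod_conv hκ hR hk hφ.deriv.deriv ht).integral_prod_left.congr ?_
    filter_upwards [ae_restrict_mem measurableSet_Ioo] with ξ hξ
    rw [(hasDerivAt_integral_ampP hκ hR hφ hξ.1).deriv, ← integral_const_mul]
    simp_rw [mul_assoc]
  equation φ hφ t ht := by
    have e1 : iteratedDeriv 2 φ = deriv (deriv φ) := by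
      rw [iteratedDeriv_succ, iteratedDeriv_one]
    have hi := integrable_prod_conv hκ hR hk hφ.deriv.deriv ht
    rw [e1, intervalIntegral.integral_of_le ht.le, integral_Ioc_eq_integral_Ioo]
    have e2 : ∫ ξ in Ioo 0 t, k (t - ξ) *
        deriv (fun τ => ∫ x, waveSol κ (ampP R) R x τ * φ x) ξ =
        ∫ ξ in Ioo 0 t, ∫ x, k (t - ξ) * waveSol κ (ampQ R) R x ξ * deriv (deriv φ) x := by
      refine setIntegral_congr_fun measurableSet_Ioo fun ξ hξ => ?_
      rw [(hasDerivAt_integral_ampP hκ hR hφ hξ.1).deriv, ← integral_const_mul]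
      simp_rw [mul_assoc]
    rw [e2, integral_integral_swap
      (f := fun ξ x => k (t - ξ) * waveSol κ (ampQ R) R x ξ * deriv (deriv φ) x) hi,
      ← integral_const_mul]
    refine integral_congr_ae (Eventually.of_forall fun x => ?_)
    simp only
    rw [integral_mul_const, ← integral_Ioc_eq_integral_Ioo, ← intervalIntegral.integral_of_le ht.le,
      conv_ampQ hκ hR hk x ht]
    ring

theorem isInverseLaplace_of_kernelSym (hκ : 0 < κ) (hB : 0 < B) (hR : WaveSym κ R)
    (hk : KernelSym κ B R k r) : IsInverseLaplace k B (waveSol κ (ampP R) R) := by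
  refine ⟨κ ^ 2, sq_nonneg κ, fun s hs => ⟨hk.integrable s hs, fun x => ?_⟩⟩
  obtain ⟨h1, h2⟩ := laplace_ampP hκ hR hk x hs
  refine ⟨h1, ?_⟩
  have hs' : 0 < s := lt_of_le_of_lt (sq_nonneg κ) hs
  have e : s * laplace k s / B = r s ^ 2 := by
    rw [hk.laplace s hs]; field_simp
  rw [h2, e, Real.sqrt_sq (hk.r_pos hκ hR hs).le]

/-! ### The symbol of the distributed-order kernel -/

variable {α γ lam : ℝ}

/-- `√(s k̂(s) / B)` for the distributed-order Prabhakar kernel, with `s = w²`. -/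
def rootSym (B α γ lam : ℝ) (w : ℂ) : ℂ := ((√B)⁻¹ : ℝ) * symPow α γ lam (1 / 2) w

theorem waveSym_rootSym (hB : 0 < B) (hκ : 1 < κ) (hα : 0 ≤ α) (hα1 : α ≤ 1) (hlam0 : 0 ≤ lam)
    (hlam : |lam| * κ ^ (-2 * α) < 1) (hγ : 0 ≤ γ) (hγ1 : γ < 1) :
    WaveSym κ (rootSym B α γ lam) where
  adm := by
    have := (adm_symPow_of_nonneg hκ hα hlam γ (b := 1 / 2) (by norm_num)).const_mul ((√B)⁻¹ : ℝ)
    rwa [show (2 : ℝ) * (1 / 2) = 1 by norm_num] at this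
  inv := by
    have := (adm_symPow_neg hκ hα hlam γ (b := 1 / 2) (by norm_num)).const_mul (√B : ℝ)
    refine this.congr (one_pos.trans hκ) fun w _ => ?_
    rw [rootSym, symPow_neg, mul_inv, Complex.ofReal_inv, inv_inv]
  ne w _ := by
    have h1 := symPow_ne_zero α γ lam (1 / 2) w
    have h2 : √B ≠ 0 := (Real.sqrt_pos.2 hB).ne'
    rw [rootSym]
    exact mul_ne_zero (Complex.ofReal_ne_zero.2 (inv_ne_zero h2)) h1
  re := by
    obtain ⟨c, hc, h⟩ := re_symPow_half hκ hα hα1 hlam0 hlam hγ hγ1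
    refine ⟨c, hc, fun w hw => ?_⟩
    rw [rootSym, Complex.re_ofReal_mul, norm_mul, Complex.norm_real,
      Real.norm_of_nonneg (by positivity)]
    have := mul_le_mul_of_nonneg_left (h w hw) (by positivity : 0 ≤ (√B)⁻¹)
    linarith
  conj w hw := by
    rw [rootSym, rootSym, symPow_conj hκ hα hlam γ _ hw, map_mul, Complex.conj_ofReal]

theorem kernelSym_k₂ (hB : 0 < B) (hκ : 1 < κ) (hα : 0 ≤ α) (hlam0 : 0 ≤ lam)
    (hlam : |lam| * κ ^ (-2 * α) < 1) (hγ : 0 ≤ γ) (hγ1 : γ < 1) :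
    KernelSym κ B (rootSym B α γ lam) (k₂ α γ lam)
      fun s => (√B)⁻¹ * symReal α γ lam s ^ (1 / 2 : ℝ) where
  cont := continuousOn_k₂ hκ hα hlam γ
  real s hs := by
    rw [rootSym, symPow_ofReal hκ hα hlam γ _ hs.le, ← Complex.ofReal_mul]
  integrable s hs := (laplace_k₂ hκ hα hlam0 hlam hγ hγ1 hs).1
  laplace s hs := by
    rw [(laplace_k₂ hκ hα hlam0 hlam hγ hγ1 hs).2, mul_pow, ← Real.sqrt_eq_rpow, inv_pow,
      Real.sq_sqrt hB.le, Real.sq_sqrt (symReal_pos hκ hα hlam γ hs.le).le]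
    field_simp

end DistributedOrder
end

noncomputable section
namespace DistributedOrder

open Complex (I)

variable {κ B α γ lam : ℝ}

/-! ### Expansion of the solution in powers of `|x|` -/

theorem bExp_pos (r : ℕ) : 0 < bExp r := by unfold bExp; positivity

theorem coeff_mul_Gamma (B : ℝ) (r : ℕ) (x : ℝ) :
    coeff B r x * Real.Gamma (bExp r) = 1 / (2 * √B) * (-|x| / √B) ^ r / r.factorial := by
  have := (Real.Gamma_pos_of_pos (bExp_pos r)).ne'
  rw [coeff]
  field_simp

/-- The symbol of the `r`-th term of the series. -/
def termSym (α γ lam : ℝ) (r : ℕ) (w : ℂ) : ℂ := symPow α γ lam (bExp r) w * (w ^ 2)⁻¹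

theorem adm_termSym (hκ : 1 < κ) (hα : 0 ≤ α) (hlam : |lam| * κ ^ (-2 * α) < 1) (γ : ℝ) (r : ℕ) :
    Adm κ (2 * bExp r + -2) (termSym α γ lam r) :=
  (adm_symPow_of_nonneg hκ hα hlam γ (bExp_pos r).le).mul (one_pos.trans hκ)
    (Adm.inv_sq (one_pos.trans hκ))

theorem conjSym_termSym (hκ : 1 < κ) (hα : 0 ≤ α) (hlam : |lam| * κ ^ (-2 * α) < 1) (γ : ℝ)
    (r : ℕ) : ConjSym κ (termSym α γ lam r) := fun w hw => by
  rw [termSym, termSym, symPow_conj hκ hα hlam γ _ hw]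
  simp

theorem ampP_mul_pow (B α γ lam x : ℝ) (r : ℕ) (w : ℂ) :
    ampP (rootSym B α γ lam) w * ((-|x| * rootSym B α γ lam w) ^ r / r.factorial) =
      ((coeff B r x * Real.Gamma (bExp r) : ℝ) : ℂ) * termSym α γ lam r w := by
  have h : symPow α γ lam (1 / 2) w ^ (r + 1) = symPow α γ lam (bExp r) w := by
    rw [symPow_pow]; congr 1; simp [bExp]; ring
  rw [coeff_mul_Gamma, termSym, ← h, ampP, rootSym]
  push_cast
  rw [mul_pow, mul_pow, div_pow, pow_succ]
  simp only [div_eq_mul_inv, inv_pow]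
  ring

theorem exists_exp_mul_exp_neg_sq_le {D t : ℝ} (ht : 0 < t) (a : ℝ) :
    Real.exp (D * a) * Real.exp (-(a ^ 2 * t)) ≤
      Real.exp (D ^ 2 / (2 * t)) * Real.exp (-(a ^ 2 * (t / 2))) := by
  rw [← Real.exp_add, ← Real.exp_add, Real.exp_le_exp]
  have h : D * a ≤ D ^ 2 / (2 * t) + a ^ 2 * (t / 2) := by
    have : D ^ 2 / (2 * t) + a ^ 2 * (t / 2) - D * a = (D - a * t) ^ 2 / (2 * t) := by
      field_simp; ring
    have h2 : 0 ≤ (D - a * t) ^ 2 / (2 * t) := by positivity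
    linarith
  nlinarith

theorem integrable_integrand_mul_exp {N C D : ℝ} (hκ : 0 < κ) {h : ℂ → ℂ} {g : ℝ → ℝ}
    (hc : Continuous fun y : ℝ => h (κ + y * I)) (hg : Continuous g)
    (hb : ∀ y : ℝ, ‖h (κ + y * I)‖ ≤ C * ‖(κ : ℂ) + y * I‖ ^ N)
    (hgD : ∀ y : ℝ, g y ≤ D * ‖(κ : ℂ) + y * I‖) {t : ℝ} (ht : 0 < t) :
    Integrable fun y : ℝ => ‖Complex.exp ((κ + y * I) ^ 2 * t) *
      ((κ + y * I) * h (κ + y * I))‖ * Real.exp (g y) := by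
  have hi := ((integrable_integrand hκ hc hb (half_pos ht)).norm.const_mul
    (Real.exp (κ ^ 2 * t) * Real.exp (D ^ 2 / (2 * t))))
  refine Integrable.mono' hi ?_ (Eventually.of_forall fun y => ?_)
  · exact ((measurable_integrand hc t).norm).mul
      (Real.continuous_exp.comp hg).aestronglyMeasurable
  · rw [norm_mul, norm_norm, Real.norm_of_nonneg (Real.exp_pos _).le,
      norm_mul (Complex.exp _), norm_mul (Complex.exp _), norm_exp_line, norm_exp_line]
    have h1 := exists_exp_mul_exp_neg_sq_le (D := D) ht ‖(κ : ℂ) + y * I‖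
    have h2 : Real.exp (g y) * Real.exp (-(‖(κ : ℂ) + y * I‖ ^ 2 * t)) ≤
        Real.exp (D ^ 2 / (2 * t)) * Real.exp (-(‖(κ : ℂ) + y * I‖ ^ 2 * (t / 2))) :=
      le_trans (mul_le_mul_of_nonneg_right (Real.exp_le_exp.2 (hgD y)) (Real.exp_pos _).le) h1
    have h3 : Real.exp (2 * κ ^ 2 * t) =
        Real.exp (κ ^ 2 * t) * Real.exp (2 * κ ^ 2 * (t / 2)) := by
      rw [← Real.exp_add]; congr 1; ring
    have h4 := mul_le_mul_of_nonneg_left h2 (by positivity :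
      0 ≤ Real.exp (2 * κ ^ 2 * t) * ‖((κ + y * I) * h (κ + y * I))‖)
    calc _ = Real.exp (2 * κ ^ 2 * t) * ‖((κ + y * I) * h (κ + y * I))‖ *
          (Real.exp (g y) * Real.exp (-(‖(κ : ℂ) + y * I‖ ^ 2 * t))) := by ring
      _ ≤ _ := h4
      _ = _ := by rw [h3]; ring

theorem hasSum_waveSol (hB : 0 < B) (hκ : 1 < κ) (hα : 0 ≤ α) (hα1 : α ≤ 1) (hlam0 : 0 ≤ lam)
    (hlam : |lam| * κ ^ (-2 * α) < 1) (hγ : 0 ≤ γ) (hγ1 : γ < 1) (x : ℝ) {t : ℝ} (ht : 0 < t) :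
    HasSum (fun r : ℕ => coeff B r x * Real.Gamma (bExp r) *
        (contour κ (termSym α γ lam r) t).re)
      (waveSol κ (ampP (rootSym B α γ lam)) (rootSym B α γ lam) x t) := by
  have hκ0 : 0 < κ := one_pos.trans hκ
  have hR := waveSym_rootSym hB hκ hα hα1 hlam0 hlam hγ hγ1
  set R := rootSym B α γ lam with hRdef
  obtain ⟨C, hC0, hC⟩ := hR.adm.bound
  have hP := adm_ampP hκ0 hR
  obtain ⟨C', hC'⟩ := hP.line_bound
  have hRc := hR.adm.continuous_line
  have key : HasSum (fun r : ℕ => ∫ y : ℝ, Complex.exp ((κ + y * I) ^ 2 * t) *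
      ((κ + y * I) * (ampP R (κ + y * I) * ((-|x| * R (κ + y * I)) ^ r / r.factorial))))
      (∫ y : ℝ, Complex.exp ((κ + y * I) ^ 2 * t) *
        ((κ + y * I) * wave (ampP R) R x (κ + y * I))) := by
    refine hasSum_integral_of_dominated_convergence
      (fun (r : ℕ) (y : ℝ) => ‖Complex.exp ((κ + y * I) ^ 2 * t) *
        ((κ + y * I) * ampP R (κ + y * I))‖ * ((|x| * ‖R (κ + y * I)‖) ^ r / r.factorial))
      (fun r => ?_) (fun r => Eventually.of_forall fun y => ?_)
      (Eventually.of_forall fun y => ?_) ?_ (Eventually.of_forall fun y => ?_)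
    · refine Continuous.aestronglyMeasurable ?_
      refine Continuous.mul (by fun_prop) (Continuous.mul (by fun_prop)
        (hP.continuous_line.mul ?_))
      exact ((continuous_const.mul hRc).pow r).div_const _
    · simp only [norm_mul, norm_div, norm_pow, norm_neg, Complex.norm_real, Complex.norm_natCast,
        Real.norm_eq_abs, abs_abs]
      exact le_of_eq (by ring)
    · exact ((NormedSpace.expSeries_div_summable (𝔸 := ℝ) _).mul_left _)
    · have h1 := integrable_integrand_mul_exp (D := |x| * C) hκ0 (h := ampP R)
        (g := fun y => |x| * ‖R (κ + y * I)‖) hP.continuous_line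
        (continuous_const.mul hRc.norm) hC' (fun y => ?_) ht
      · refine h1.congr (Eventually.of_forall fun y => ?_)
        simp only
        rw [tsum_mul_left, Real.exp_eq_exp_ℝ, NormedSpace.exp_eq_tsum_div]
      · have := hC (κ + y * I) (by simp)
        rw [Real.rpow_one] at this
        rw [mul_assoc]
        exact mul_le_mul_of_nonneg_left this (abs_nonneg x)
    · refine HasSum.mul_left _ (HasSum.mul_left _ (HasSum.mul_left _ ?_))
      rw [Complex.exp_eq_exp_ℂ]
      exact NormedSpace.expSeries_div_hasSum_exp _
  have h2 := (Complex.hasSum_re (key.mul_left (Real.pi : ℂ)⁻¹))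
  have e : (fun r : ℕ => coeff B r x * Real.Gamma (bExp r) * (contour κ (termSym α γ lam r) t).re) =
      fun r : ℕ => ((Real.pi : ℂ)⁻¹ * ∫ y : ℝ, Complex.exp ((κ + y * I) ^ 2 * t) *
        ((κ + y * I) *
          (ampP R (κ + y * I) * ((-|x| * R (κ + y * I)) ^ r / r.factorial)))).re := by
    ext r
    rw [← Complex.re_ofReal_mul, ← contour_const_mul, contour]
    simp_rw [hRdef, ampP_mul_pow]
  rw [e]
  exact h2

/-! ### The terms of the series as Volterra–Prabhakar functions -/

theorem cpow_half_facts {z : ℂ} (hz : 0 < z.re) :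
    0 < (z ^ (1 / 2 : ℂ)).re ∧ (z ^ (1 / 2 : ℂ)) ^ 2 = z ∧
      ∀ b : ℝ, (z ^ (1 / 2 : ℂ)) ^ ((-2 * b : ℝ) : ℂ) = z ^ ((-b : ℝ) : ℂ) := by
  have h0 : z ≠ 0 := fun h => by simp [h] at hz
  have harg := Complex.abs_arg_lt_pi_div_two_iff.2 (Or.inl hz)
  rw [abs_lt] at harg
  have hre : z ^ (1 / 2 : ℂ) = Complex.exp (Complex.log z / 2) := by
    rw [Complex.cpow_def_of_ne_zero h0]; congr 1; ring
  have him : (Complex.log z / 2).im = z.arg / 2 := by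
    rw [show (2 : ℂ) = ((2 : ℝ) : ℂ) by norm_num, Complex.div_ofReal_im, Complex.log_im]
  have hpi := Real.pi_pos
  refine ⟨?_, ?_, fun b => ?_⟩
  · rw [hre, Complex.exp_re]
    exact mul_pos (Real.exp_pos _) (Real.cos_pos_of_mem_Ioo ⟨by rw [him]; linarith,
      by rw [him]; linarith⟩)
  · rw [hre, ← Complex.exp_nat_mul]
    rw [show ((2 : ℕ) : ℂ) * (Complex.log z / 2) = Complex.log z by push_cast; ring,
      Complex.exp_log h0]
  · rw [hre, Complex.cpow_def_of_ne_zero (Complex.exp_ne_zero _),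
      Complex.log_exp (by rw [him]; linarith) (by rw [him]; linarith),
      Complex.cpow_def_of_ne_zero h0]
    congr 1; push_cast; ring

theorem integral_rpow_mul_cexp_neg {z : ℂ} (hz : 0 < z.re) {b : ℝ} (hb : 0 < b) :
    ∫ u in Ioi (0 : ℝ), ((u ^ (b - 1) : ℝ) : ℂ) * Complex.exp (-z * u) =
      Real.Gamma b * z ^ ((-b : ℝ) : ℂ) := by
  obtain ⟨h1, h2, h3⟩ := cpow_half_facts hz
  have hG := (Real.Gamma_pos_of_pos hb).ne'
  obtain ⟨κ, hκ, hκ1, hκ2⟩ : ∃ κ : ℝ, 0 < κ ∧ κ < (z ^ (1 / 2 : ℂ)).re ∧ κ ^ 2 < z.re := by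
    have ht : Tendsto (fun κ : ℝ => κ ^ 2) (𝓝[>] 0) (𝓝 (0 ^ 2)) :=
      ((continuous_pow 2).tendsto 0).mono_left nhdsWithin_le_nhds
    rw [zero_pow two_ne_zero] at ht
    have := ((ht.eventually (gt_mem_nhds hz)).and (Ioo_mem_nhdsGT h1)).exists
    obtain ⟨κ, hκ2, hκ1⟩ := this
    exact ⟨κ, hκ1.1, hκ1.2, hκ2⟩
  have hA := Adm.cpow hκ (-(2 * b))
  have h4 := (hA.laplace_contour hκ (by positivity) hκ1 (by rwa [h2])).2
  rw [h2, show (-(2 * b) : ℝ) = -2 * b by ring, h3] at h4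
  rw [← h4, ← integral_const_mul]
  refine setIntegral_congr_fun measurableSet_Ioi fun u hu => ?_
  rw [contour_cpow hκ b hu, Complex.ofReal_div]
  have : ((Real.Gamma b : ℝ) : ℂ) ≠ 0 := Complex.ofReal_ne_zero.2 hG
  field_simp

theorem prabSym_shift (hκ : 0 < κ) (b u : ℝ) {w : ℂ} (hw : κ ≤ w.re) :
    prabSym (-b) 1 (u + -b + 1) (-1) w =
      Complex.exp (-(2 * Complex.log w) * u) * prabSym (-b) 1 (1 - b) (-1) w := by
  have h0 := ne_zero_of_re hκ hw
  rw [prabSym, prabSym, ← mul_assoc]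
  congr 1
  rw [Complex.cpow_def_of_ne_zero h0, Complex.cpow_def_of_ne_zero h0, ← Complex.exp_add]
  congr 1; push_cast; ring

theorem Gamma_mul_termSym (hκ : 1 < κ) (r : ℕ) {w : ℂ} (hw : κ ≤ w.re) :
    ∫ u in Ioi (0 : ℝ), ((u ^ (bExp r - 1) : ℝ) : ℂ) *
        prabSym (-bExp r) 1 (u + -bExp r + 1) (-1) w =
      Real.Gamma (bExp r) * termSym 1 0 0 r w := by
  have hκ0 := one_pos.trans hκ
  have h0 := ne_zero_of_re hκ0 hw
  simp_rw [prabSym_shift hκ0 _ _ hw, ← mul_assoc]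
  rw [integral_mul_const, integral_rpow_mul_cexp_neg (log_re_pos hκ hw) (bExp_pos r), termSym,
    symPow_eq hκ zero_le_one (by simp) 0 _ hw, prabSym]
  have h1 : w ^ ((-2 * (1 - bExp r) : ℝ) : ℂ) = w ^ ((2 * bExp r : ℝ) : ℂ) * (w ^ 2)⁻¹ := by
    rw [show ((-2 * (1 - bExp r) : ℝ) : ℂ) = ((2 * bExp r : ℝ) : ℂ) - (2 : ℕ) by push_cast; ring,
      Complex.cpow_sub _ _ h0, Complex.cpow_natCast, div_eq_mul_inv]
  rw [h1]
  simp only [neg_neg, Complex.ofReal_zero, zero_mul, add_zero, Complex.one_cpow, mul_one]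
  ring

theorem norm_shift_le (hκ : 0 < κ) (b : ℝ) {u : ℝ} (hu : 0 < u) {w : ℂ} (hw : κ ≤ w.re) :
    ‖((u ^ (b - 1) : ℝ) : ℂ) * prabSym (-b) 1 (u + -b + 1) (-1) w‖ ≤
      u ^ (b - 1) * Real.exp (-(2 * Real.log κ) * u) * ‖prabSym (-b) 1 (1 - b) (-1) w‖ := by
  rw [prabSym_shift hκ b u hw, norm_mul, norm_mul, Complex.norm_real,
    Real.norm_of_nonneg (Real.rpow_nonneg hu.le _), Complex.norm_exp, mul_assoc]
  have h1 : (-(2 * Complex.log w) * u : ℂ).re = -(2 * Real.log ‖w‖) * u := by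
    rw [Complex.re_mul_ofReal, Complex.neg_re, show (2 : ℂ) = ((2 : ℝ) : ℂ) by norm_num,
      Complex.re_ofReal_mul, Complex.log_re]
  have h2 : Real.log κ ≤ Real.log ‖w‖ := Real.log_le_log hκ (hw.trans (Complex.re_le_norm w))
  rw [h1]
  gcongr

theorem integrableOn_rpow_mul_exp_neg {b c : ℝ} (hb : 0 < b) (hc : 0 < c) :
    IntegrableOn (fun u : ℝ => u ^ (b - 1) * Real.exp (-c * u)) (Ioi 0) := by
  have h := ((laplace_rpow hb hc).1.const_mul (Real.Gamma b))
  refine h.congr (Eventually.of_forall fun u => ?_)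
  have := (Real.Gamma_pos_of_pos hb).ne'
  simp only
  field_simp

theorem continuousOn_shift (hκ : 0 < κ) (hlam : |(-1 : ℝ)| * κ ^ (-2 * (1 : ℝ)) < 1) (b : ℝ)
    {p : ℝ → ℂ} (hp : Continuous p) (hp' : ∀ y, κ ≤ (p y).re) :
    ContinuousOn (fun z : ℝ × ℝ => ((z.1 ^ (b - 1) : ℝ) : ℂ) *
      prabSym (-b) 1 (z.1 + -b + 1) (-1) (p z.2)) (Ioi 0 ×ˢ univ) := by
  have hG := ((adm_prabSym hκ zero_le_one hlam (-b) (1 - b)).continuousOn.comp_continuous hp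
    hp').comp (continuous_snd (X := ℝ))
  have hlog : Continuous fun z : ℝ × ℝ => Complex.log (p z.2) :=
    (hp.comp continuous_snd).clog fun z => Or.inl (hκ.trans_le (hp' _))
  have h1 : ContinuousOn (fun z : ℝ × ℝ => ((z.1 ^ (b - 1) : ℝ) : ℂ)) (Ioi 0 ×ˢ univ) :=
    Complex.continuous_ofReal.comp_continuousOn
      (continuousOn_fst.rpow_const fun z hz => Or.inl (ne_of_gt hz.1))
  refine h1.mul (Continuous.continuousOn ?_)
  have h2 : (fun z : ℝ × ℝ => prabSym (-b) 1 (z.1 + -b + 1) (-1) (p z.2)) = fun z : ℝ × ℝ =>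
      Complex.exp (-(2 * Complex.log (p z.2)) * z.1) * prabSym (-b) 1 (1 - b) (-1) (p z.2) := by
    ext z
    exact prabSym_shift hκ b z.1 (hp' _)
  rw [h2]
  exact (Complex.continuous_exp.comp ((continuous_const.mul hlog).neg.mul (by fun_prop))).mul hG

theorem volterraPrabhakar_eq (hκ : 1 < κ) (r : ℕ) {t : ℝ} (ht : 0 < t) :
    volterraPrabhakar (-bExp r) 1 (bExp r - 1) (-bExp r) (-1) t =
      Real.Gamma (bExp r) * (contour κ (termSym 1 0 0 r) t).re := by
  have hκ0 := one_pos.trans hκ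
  have hl := lam_one hκ
  have hb := bExp_pos r
  set b := bExp r with hbdef
  have hG := adm_prabSym hκ0 zero_le_one hl (-b) (1 - b)
  obtain ⟨C, hC⟩ := hG.line_bound
  have hi : Integrable (fun z : ℝ × ℝ => Complex.exp ((κ + z.2 * I) ^ 2 * t) *
      ((κ + z.2 * I) * (((z.1 ^ (b - 1) : ℝ) : ℂ) *
        prabSym (-b) 1 (z.1 + -b + 1) (-1) (κ + z.2 * I))))
      ((volume.restrict (Ioi 0)).prod volume) := by
    have hb1 := (integrableOn_rpow_mul_exp_neg hb (mul_pos two_pos (Real.log_pos hκ))).mul_prod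
      (integrable_integrand hκ0 hG.continuous_line hC ht).norm
    refine Integrable.mono' hb1 ?_ ?_
    · rw [← Measure.restrict_univ (μ := (volume : Measure ℝ)), Measure.restrict_restrict
        measurableSet_Ioi, inter_univ, Measure.prod_restrict]
      refine ContinuousOn.aestronglyMeasurable ?_ (measurableSet_Ioi.prod MeasurableSet.univ)
      refine ContinuousOn.mul (by fun_prop) (ContinuousOn.mul (by fun_prop) ?_)
      exact continuousOn_shift hκ0 hl b (p := fun y => κ + y * I) (by fun_prop) (by simp)
    · have : ∀ᵐ z : ℝ × ℝ ∂((volume.restrict (Ioi 0)).prod volume), z.1 ∈ Ioi (0 : ℝ) :=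
        Measure.quasiMeasurePreserving_fst.ae (ae_restrict_mem measurableSet_Ioi)
      filter_upwards [this] with z hz
      have := norm_shift_le hκ0 b hz (w := κ + z.2 * I) (by simp)
      rw [norm_mul, norm_mul (κ + z.2 * I : ℂ), norm_mul (Complex.exp _),
        norm_mul (κ + z.2 * I : ℂ)]
      calc _ ≤ _ := mul_le_mul_of_nonneg_left (mul_le_mul_of_nonneg_left this (norm_nonneg _))
            (norm_nonneg _)
        _ = _ := by ring
  rw [← Complex.ofReal_inj, Complex.ofReal_mul, contour_conj (fun y =>
    conjSym_termSym hκ zero_le_one (by simp) 0 r _ (by simp)), ← contour_const_mul,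
    volterraPrabhakar, ← integral_complex_ofReal]
  have e : ∀ u : ℝ, ((u ^ (b - 1) * prabhakar (-b) 1 (u + -b + 1) (-1) t : ℝ) : ℂ) =
      (Real.pi : ℂ)⁻¹ * ∫ y : ℝ, Complex.exp ((κ + y * I) ^ 2 * t) *
        ((κ + y * I) * (((u ^ (b - 1) : ℝ) : ℂ) *
          prabSym (-b) 1 (u + -b + 1) (-1) (κ + y * I))) := fun u => by
    rw [Complex.ofReal_mul, ← contour_prabSym hκ0 zero_le_one hl _ _ ht, ← contour_const_mul]
    rfl
  simp_rw [e]
  rw [integral_const_mul, integral_integral_swap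
    (f := fun (u y : ℝ) => Complex.exp ((κ + y * I) ^ 2 * t) *
        ((κ + y * I) * (((u ^ (b - 1) : ℝ) : ℂ) *
          prabSym (-b) 1 (u + -b + 1) (-1) (κ + y * I)))) hi, contour]
  congr 1
  refine integral_congr_ae (Eventually.of_forall fun y => ?_)
  simp only
  rw [integral_const_mul, integral_const_mul, Gamma_mul_termSym hκ r (by simp)]

theorem p₁term_eq (hκ : 1 < κ) (B : ℝ) (r : ℕ) (x : ℝ) {t : ℝ} (ht : 0 < t) :
    p₁term B r x t = coeff B r x * Real.Gamma (bExp r) * (contour κ (termSym 1 0 0 r) t).re := by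
  rw [p₁term, volterraPrabhakar_eq hκ r ht, mul_assoc]

end DistributedOrder
end

noncomputable section
namespace DistributedOrder

open Complex (I)

/-! ### Superpositions of exponentials -/

/-- A parametrization of the vertical line `re s = c`. -/
def sline (c v : ℝ) : ℂ := c - 2 * Real.pi * v * I

/-- The amplitude `g` decays faster than every power on the line `re s = c`. -/
structure Decay (c : ℝ) (g : ℝ → ℂ) : Prop where
  meas : AEStronglyMeasurable g
  int : ∀ n : ℕ, Integrable fun v => ‖sline c v‖ ^ n * ‖g v‖

/-- The real part of the superposition of the exponentials `exp(-s t)`, `re s = c`, with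
amplitude `g`. -/
def expSup (c : ℝ) (g : ℝ → ℂ) (t : ℝ) : ℝ := (∫ v : ℝ, Complex.exp (-sline c v * t) * g v).re

variable {c : ℝ} {g : ℝ → ℂ}

theorem sline_re (c v : ℝ) : (sline c v).re = c := by simp [sline]

theorem continuous_sline (c : ℝ) : Continuous (sline c) := by unfold sline; fun_prop

theorem norm_exp_sline (c v t : ℝ) : ‖Complex.exp (-sline c v * t)‖ = Real.exp (-c * t) := by
  rw [Complex.norm_exp, Complex.re_mul_ofReal, Complex.neg_re, sline_re]

theorem sqrt_sline (hc : 0 < c) {κ : ℝ} (hκ : 0 < κ) (hκc : κ ^ 2 ≤ c) (v : ℝ) :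
    κ ≤ (sline c v ^ (1 / 2 : ℂ)).re := by
  obtain ⟨h1, h2, -⟩ := cpow_half_facts (z := sline c v) (by rwa [sline_re])
  have h3 : ((sline c v ^ (1 / 2 : ℂ)) ^ 2).re = c := by rw [h2, sline_re]
  rw [pow_two, Complex.mul_re] at h3
  nlinarith [mul_self_nonneg (sline c v ^ (1 / 2 : ℂ)).im]

theorem sqrt_sline_sq (hc : 0 < c) (v : ℝ) : (sline c v ^ (1 / 2 : ℂ)) ^ 2 = sline c v :=
  (cpow_half_facts (by rwa [sline_re])).2.1

theorem continuous_sqrt_sline (hc : 0 < c) : Continuous fun v => sline c v ^ (1 / 2 : ℂ) :=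
  (continuous_sline c).cpow continuous_const fun v => Or.inl (by rwa [sline_re])

namespace Decay

theorem norm_integrable (hg : Decay c g) : Integrable fun v => ‖g v‖ := by simpa using hg.int 0

theorem integrable (hg : Decay c g) : Integrable g :=
  (integrable_norm_iff hg.meas).1 hg.norm_integrable

theorem mul (hg : Decay c g) {m : ℝ → ℂ} (hm : Continuous m) {C : ℝ} {n : ℕ}
    (hb : ∀ v, ‖m v‖ ≤ C * ‖sline c v‖ ^ n) : Decay c fun v => m v * g v := by
  refine ⟨hm.aestronglyMeasurable.mul hg.meas, fun k => ?_⟩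
  refine Integrable.mono' ((hg.int (k + n)).const_mul C) ?_ (Eventually.of_forall fun v => ?_)
  · exact ((continuous_sline c).norm.pow k).aestronglyMeasurable.mul
      (hm.aestronglyMeasurable.mul hg.meas).norm
  · rw [norm_mul, norm_norm, norm_pow, norm_norm, norm_mul]
    calc _ ≤ ‖sline c v‖ ^ k * (C * ‖sline c v‖ ^ n * ‖g v‖) := by
          gcongr; exact hb v
      _ = _ := by ring

theorem sline_pow (hg : Decay c g) (n : ℕ) : Decay c fun v => (-sline c v) ^ n * g v :=
  hg.mul (m := fun v => (-sline c v) ^ n) ((continuous_sline c).neg.pow n) (C := 1) (n := n)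
    fun v => by simp

theorem exp (hg : Decay c g) (t : ℝ) : Decay c fun v => Complex.exp (-sline c v * t) * g v :=
  hg.mul (m := fun v => Complex.exp (-sline c v * t))
    (Complex.continuous_exp.comp ((continuous_sline c).neg.mul continuous_const))
    (C := Real.exp (-c * t)) (n := 0) fun v => by rw [norm_exp_sline]; simp

theorem mul_adm (hg : Decay c g) {κ N : ℝ} (hκ : 1 < κ) (hc : κ ^ 2 ≤ c) {h : ℂ → ℂ}
    (hh : Adm κ N h) : Decay c fun v => h (sline c v ^ (1 / 2 : ℂ)) * g v := by
  have hκ0 : 0 < κ := one_pos.trans hκ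
  have hc0 : 0 < c := by nlinarith
  obtain ⟨C, hC, hb⟩ := hh.bound
  have hw := sqrt_sline hc0 hκ0 hc
  refine hg.mul (m := fun v => h (sline c v ^ (1 / 2 : ℂ))) (C := C) (n := ⌈N⌉₊) ?_ fun v => ?_
  · exact hh.continuousOn.comp_continuous (continuous_sqrt_sline hc0) hw
  · refine (hb _ (hw v)).trans (mul_le_mul_of_nonneg_left ?_ hC.le)
    have h1 := (one_lt_norm hκ (hw v)).le
    nth_rw 2 [← sqrt_sline_sq hc0 v]
    rw [norm_pow, ← pow_mul, ← Real.rpow_natCast]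
    refine Real.rpow_le_rpow_of_exponent_le h1 ?_
    have := Nat.le_ceil N
    have h0 : (0 : ℝ) ≤ ⌈N⌉₊ := Nat.cast_nonneg _
    push_cast
    linarith

end Decay

theorem hasDerivAt_expSup (hc : 0 ≤ c) (hg : Decay c g) (t : ℝ) :
    HasDerivAt (expSup c g) (expSup c (fun v => -sline c v * g v) t) t := by
  have h1 := hasDerivAt_integral_of_dominated_loc_of_deriv_le
    (F := fun (τ v : ℝ) => Complex.exp (-sline c v * τ) * g v)
    (F' := fun (τ v : ℝ) => Complex.exp (-sline c v * τ) * (-sline c v * g v))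
    (bound := fun v => Real.exp (c * (|t| + 1)) * (‖sline c v‖ ^ 1 * ‖g v‖))
    (Metric.ball_mem_nhds t one_pos)
    (Eventually.of_forall fun τ => (hg.exp τ).meas) (hg.exp t).integrable
    (by simpa using ((hg.sline_pow 1).exp t).meas)
    (Eventually.of_forall fun v τ hτ => ?_) ((hg.int 1).const_mul _)
    (Eventually.of_forall fun v τ hτ => ?_) (μ := volume)
  · exact Complex.reCLM.hasFDerivAt.comp_hasDerivAt t h1.2
  · rw [norm_mul, norm_exp_sline, norm_mul, norm_neg, pow_one]
    refine mul_le_mul_of_nonneg_right (Real.exp_le_exp.2 ?_) (by positivity)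
    rw [Metric.mem_ball, Real.dist_eq] at hτ
    have h2 : -τ ≤ |t| + 1 := by
      have := abs_lt.1 hτ
      have := neg_abs_le t
      linarith
    nlinarith
  · have h3 : HasDerivAt (fun τ : ℝ => -sline c v * (τ : ℂ)) (-sline c v * 1) τ :=
      (Complex.ofRealCLM.hasDerivAt (x := τ)).const_mul _
    refine (h3.cexp.mul_const (g v)).congr_deriv ?_
    ring

theorem iteratedDeriv_expSup (hc : 0 ≤ c) (hg : Decay c g) (n : ℕ) :
    iteratedDeriv n (expSup c g) = expSup c fun v => (-sline c v) ^ n * g v := by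
  induction n with
  | zero => simp
  | succ n ih =>
    rw [iteratedDeriv_succ, ih]
    ext t
    rw [(hasDerivAt_expSup hc (hg.sline_pow n) t).deriv]
    congr 1; ext v; ring

theorem integral_mul_expSup (hg : Decay c g) {f : ℝ → ℝ}
    (hf : IntegrableOn (fun t : ℝ => Real.exp (-c * t) * f t) (Ioi 0)) :
    ∫ t in Ioi (0 : ℝ), f t * expSup c g t =
      (∫ v : ℝ, (∫ t in Ioi (0 : ℝ), (f t : ℂ) * Complex.exp (-sline c v * t)) * g v).re := by
  have hfm : AEStronglyMeasurable (fun t : ℝ => (f t : ℂ)) (volume.restrict (Ioi 0)) := by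
    have h1 : AEStronglyMeasurable (fun t : ℝ => Real.exp (c * t) * (Real.exp (-c * t) * f t))
        (volume.restrict (Ioi 0)) :=
      (Continuous.aestronglyMeasurable (by fun_prop)).mul hf.aestronglyMeasurable
    refine Complex.continuous_ofReal.comp_aestronglyMeasurable (h1.congr ?_)
    refine Eventually.of_forall fun t => ?_
    simp only
    rw [← mul_assoc, ← Real.exp_add]
    simp
  have hi : Integrable (fun z : ℝ × ℝ => (f z.1 : ℂ) * Complex.exp (-sline c z.2 * z.1) * g z.2)
      ((volume.restrict (Ioi 0)).prod volume) := by
    refine Integrable.mono' (hf.norm.mul_prod hg.norm_integrable) ?_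
      (Eventually.of_forall fun z => ?_)
    · refine (hfm.comp_fst.mul ?_).mul hg.meas.comp_snd
      have := continuous_sline c
      exact Continuous.aestronglyMeasurable (by fun_prop)
    · rw [norm_mul, norm_mul, norm_exp_sline, Complex.norm_real, norm_mul,
        Real.norm_of_nonneg (Real.exp_pos _).le]
      exact le_of_eq (by ring)
  have h1 : ∀ t : ℝ, f t * expSup c g t =
      (∫ v : ℝ, (f t : ℂ) * Complex.exp (-sline c v * t) * g v).re := fun t => by
    rw [expSup, ← Complex.re_ofReal_mul, ← integral_const_mul]
    simp_rw [mul_assoc]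
  simp_rw [h1]
  have h2 := integral_re hi.integral_prod_left
  simp only [RCLike.re_to_complex] at h2
  rw [h2, integral_integral_swap
    (f := fun (t v : ℝ) => (f t : ℂ) * Complex.exp (-sline c v * t) * g v) hi]
  simp_rw [integral_mul_const]

/-! ### Generalized functions as multipliers -/

theorem powerDist_expSup (hc : 0 < c) (hg : Decay c g) (a : ℝ) :
    powerDist a (expSup c g) = (∫ v : ℝ, sline c v ^ ((-a : ℝ) : ℂ) * g v).re := by
  have hn : 0 < a + ⌊1 - a⌋₊ := by
    have := Nat.lt_floor_add_one (1 - a)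
    linarith
  set n := ⌊1 - a⌋₊ with hndef
  have hG := (Real.Gamma_pos_of_pos hn).ne'
  rw [powerDist, ← hndef, iteratedDeriv_expSup hc.le hg, integral_mul_expSup (hg.sline_pow n)
    (laplace_rpow hn hc).1, ← Complex.re_ofReal_mul, ← integral_const_mul]
  congr 1
  refine integral_congr_ae (Eventually.of_forall fun v => ?_)
  have hs : 0 < (sline c v).re := by rwa [sline_re]
  have hs0 : sline c v ≠ 0 := fun h => by rw [h] at hs; simp at hs
  have h1 : ∫ t in Ioi (0 : ℝ), ((t ^ (a + n - 1) / Real.Gamma (a + n) : ℝ) : ℂ) *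
      Complex.exp (-sline c v * t) = sline c v ^ ((-(a + n) : ℝ) : ℂ) := by
    have h2 := integral_rpow_mul_cexp_neg hs hn
    have hG' : ((Real.Gamma (a + n) : ℝ) : ℂ) ≠ 0 := Complex.ofReal_ne_zero.2 hG
    rw [← mul_right_inj' hG', ← h2, ← integral_const_mul]
    refine integral_congr_ae (Eventually.of_forall fun t => ?_)
    simp only
    push_cast
    field_simp
  simp only
  rw [h1, show ((-(a + n) : ℝ) : ℂ) = ((-a : ℝ) : ℂ) - (n : ℕ) by push_cast; ring,
    Complex.cpow_sub _ _ hs0, Complex.cpow_natCast, neg_pow (sline c v)]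
  have h3 : ((((-1) ^ n : ℝ)) : ℂ) * (-1) ^ n = 1 := by
    push_cast
    rw [← mul_pow]; simp
  have h4 : sline c v ^ n ≠ 0 := pow_ne_zero _ hs0
  field_simp
  linear_combination (sline c v ^ ((-a : ℝ) : ℂ)) * g v * h3

theorem sqrt_sline_cpow (hc : 0 < c) (v b : ℝ) :
    (sline c v ^ (1 / 2 : ℂ)) ^ ((-2 * b : ℝ) : ℂ) = sline c v ^ ((-b : ℝ) : ℂ) :=
  (cpow_half_facts (by rwa [sline_re])).2.2 b

variable {κ α lam : ℝ}

theorem prabhakarDist_expSup (hκ : 1 < κ) (hc : κ ^ 2 ≤ c) (hα : 0 ≤ α)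
    (hlam : |lam| * κ ^ (-2 * α) < 1) (hg : Decay c g) (γ β : ℝ) :
    prabhakarDist γ α β lam (expSup c g) =
      expSup c (fun v => prabSym γ α β lam (sline c v ^ (1 / 2 : ℂ)) * g v) 0 := by
  have hκ0 : 0 < κ := one_pos.trans hκ
  have hc0 : 0 < c := by nlinarith
  have hw := sqrt_sline hc0 hκ0 hc
  have hAdm : ∀ j : ℕ, Adm κ (-2 * (β + α * j)) fun w =>
      ((poch γ j * (-lam) ^ j / j.factorial : ℝ) : ℂ) * w ^ ((-2 * (β + α * j) : ℝ) : ℂ) :=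
    fun j => (Adm.cpow hκ0 _).const_mul _
  have hD : Decay c fun v => (sline c v ^ (1 / 2 : ℂ)) ^ ((-2 * β : ℝ) : ℂ) * g v :=
    hg.mul_adm hκ hc (Adm.cpow hκ0 (-2 * β))
  have key := hasSum_integral_of_summable_integral_norm (μ := volume)
    (F := fun (j : ℕ) (v : ℝ) => ((poch γ j * (-lam) ^ j / j.factorial : ℝ) : ℂ) *
      (sline c v ^ (1 / 2 : ℂ)) ^ ((-2 * (β + α * j) : ℝ) : ℂ) * g v)
    (fun j => (hg.mul_adm hκ hc (hAdm j)).integrable) ?_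
  · have e : (∫ v : ℝ, ∑' j : ℕ, ((poch γ j * (-lam) ^ j / j.factorial : ℝ) : ℂ) *
        (sline c v ^ (1 / 2 : ℂ)) ^ ((-2 * (β + α * j) : ℝ) : ℂ) * g v) =
        ∫ v : ℝ, Complex.exp (-sline c v * (0 : ℝ)) *
          (prabSym γ α β lam (sline c v ^ (1 / 2 : ℂ)) * g v) := by
      refine integral_congr_ae (Eventually.of_forall fun v => ?_)
      simp only
      rw [((hasSum_prabSym hκ0 hα hlam γ β (hw v)).mul_right (g v)).tsum_eq]
      simp
    rw [e] at key
    rw [expSup, prabhakarDist, ← (Complex.hasSum_re key).tsum_eq]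
    refine tsum_congr fun j => ?_
    rw [powerDist_expSup hc0 hg, ← Complex.re_ofReal_mul, ← integral_const_mul]
    congr 1
    refine integral_congr_ae (Eventually.of_forall fun v => ?_)
    simp only
    rw [sqrt_sline_cpow hc0, mul_assoc]
  · refine Summable.of_nonneg_of_le (fun j => integral_nonneg fun v => norm_nonneg _)
      (fun j => ?_) ((summable_prab_coeff (lam := lam) (x := κ ^ (-2 * α)) (by positivity) hlam
        γ).mul_right (∫ v, ‖(sline c v ^ (1 / 2 : ℂ)) ^ ((-2 * β : ℝ) : ℂ) * g v‖))
    rw [← integral_const_mul]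
    refine integral_mono (hg.mul_adm hκ hc (hAdm j)).norm_integrable
      (hD.norm_integrable.const_mul _) fun v => ?_
    simp only [norm_mul (_ * _) (g v)]
    rw [norm_mul _ (g v), ← mul_assoc]
    refine mul_le_mul_of_nonneg_right ?_ (norm_nonneg _)
    refine (norm_prab_term_le hκ0 hα γ β j (hw v)).trans_eq ?_
    rw [Complex.norm_cpow_real]

theorem volterraPrabhakarDist_expSup (hκ : 1 < κ) (hc : κ ^ 2 ≤ c) (hg : Decay c g) (r : ℕ) :
    volterraPrabhakarDist (-bExp r) 1 (bExp r - 1) (-bExp r) (-1) (expSup c g) =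
      Real.Gamma (bExp r) *
        expSup c (fun v => termSym 1 0 0 r (sline c v ^ (1 / 2 : ℂ)) * g v) 0 := by
  have hκ0 : 0 < κ := one_pos.trans hκ
  have hc0 : 0 < c := by nlinarith
  have hw := sqrt_sline hc0 hκ0 hc
  have hl := lam_one hκ
  have hb := bExp_pos r
  set b := bExp r with hbdef
  have hG := hg.mul_adm hκ hc (adm_prabSym hκ0 zero_le_one hl (-b) (1 - b))
  have hi : Integrable (fun z : ℝ × ℝ => ((z.1 ^ (b - 1) : ℝ) : ℂ) *
      prabSym (-b) 1 (z.1 + -b + 1) (-1) (sline c z.2 ^ (1 / 2 : ℂ)) * g z.2)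
      ((volume.restrict (Ioi 0)).prod volume) := by
    have hb1 := (integrableOn_rpow_mul_exp_neg hb
      (mul_pos two_pos (Real.log_pos hκ))).mul_prod hG.norm_integrable
    refine Integrable.mono' hb1 ?_ ?_
    · refine AEStronglyMeasurable.mul ?_ hg.meas.comp_snd
      rw [← Measure.restrict_univ (μ := (volume : Measure ℝ)), Measure.restrict_restrict
        measurableSet_Ioi, inter_univ, Measure.prod_restrict]
      refine ContinuousOn.aestronglyMeasurable ?_ (measurableSet_Ioi.prod MeasurableSet.univ)
      exact continuousOn_shift hκ0 hl b (p := fun v => sline c v ^ (1 / 2 : ℂ))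
        (continuous_sqrt_sline hc0) hw
    · have : ∀ᵐ z : ℝ × ℝ ∂((volume.restrict (Ioi 0)).prod volume), z.1 ∈ Ioi (0 : ℝ) :=
        Measure.quasiMeasurePreserving_fst.ae (ae_restrict_mem measurableSet_Ioi)
      filter_upwards [this] with z hz
      rw [norm_mul, norm_mul _ (g z.2), ← mul_assoc]
      exact mul_le_mul_of_nonneg_right (norm_shift_le hκ0 b hz (hw z.2)) (norm_nonneg _)
  rw [volterraPrabhakarDist, expSup, ← Complex.re_ofReal_mul, ← integral_const_mul]
  have e : ∀ u : ℝ, u ^ (b - 1) * prabhakarDist (-b) 1 (u + -b + 1) (-1) (expSup c g) =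
      (∫ v : ℝ, ((u ^ (b - 1) : ℝ) : ℂ) *
        prabSym (-b) 1 (u + -b + 1) (-1) (sline c v ^ (1 / 2 : ℂ)) * g v).re := fun u => by
    rw [prabhakarDist_expSup hκ hc zero_le_one hl hg, expSup, ← Complex.re_ofReal_mul,
      ← integral_const_mul]
    simp [mul_assoc]
  simp_rw [e]
  have h2 := integral_re hi.integral_prod_left
  simp only [RCLike.re_to_complex] at h2
  rw [h2, integral_integral_swap (f := fun (u v : ℝ) => ((u ^ (b - 1) : ℝ) : ℂ) *
      prabSym (-b) 1 (u + -b + 1) (-1) (sline c v ^ (1 / 2 : ℂ)) * g v) hi]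
  congr 1
  refine integral_congr_ae (Eventually.of_forall fun v => ?_)
  simp only
  rw [integral_mul_const, Gamma_mul_termSym hκ r (hw v)]
  simp [mul_assoc, ← hbdef]

theorem expSup_add (c : ℝ) (g : ℝ → ℂ) (t : ℝ) : (fun ξ => expSup c g (t + ξ)) =
    expSup c fun v => Complex.exp (-sline c v * t) * g v := by
  ext ξ
  rw [expSup, expSup]
  congr 1
  refine integral_congr_ae (Eventually.of_forall fun v => ?_)
  simp only
  rw [← mul_assoc, ← Complex.exp_add]
  congr 2; push_cast; ring

theorem termSym_mul_prabSym (hκ : 1 < κ) (hα : 0 ≤ α) (hlam : |lam| * κ ^ (-2 * α) < 1) (γ : ℝ)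
    (r : ℕ) {w : ℂ} (hw : κ ≤ w.re) :
    termSym 1 0 0 r w * prabSym (-γ * bExp r) α 0 lam w = termSym α γ lam r w := by
  rw [termSym, termSym, symPow_eq hκ zero_le_one (by simp) 0 _ hw, symPow_eq hκ hα hlam γ _ hw,
    prabSym, show -(-γ * bExp r) = γ * bExp r by ring]
  simp only [mul_zero, Complex.ofReal_zero, Complex.cpow_zero, zero_mul, add_zero,
    mul_one, one_mul]
  ring

theorem convDist_expSup (hκ : 1 < κ) (hc : κ ^ 2 ≤ c) (hα : 0 ≤ α)
    (hlam : |lam| * κ ^ (-2 * α) < 1) (hg : Decay c g) (γ B : ℝ) (r : ℕ) (x : ℝ) :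
    convDist (p₁termDist B r x) (prabhakarDist (-γ * bExp r) α 0 lam) (expSup c g) =
      coeff B r x * Real.Gamma (bExp r) *
        expSup c (fun v => termSym α γ lam r (sline c v ^ (1 / 2 : ℂ)) * g v) 0 := by
  have hκ0 : 0 < κ := one_pos.trans hκ
  have hc0 : 0 < c := by nlinarith
  have hw := sqrt_sline hc0 hκ0 hc
  have hg' := hg.mul_adm hκ hc (adm_prabSym hκ0 hα hlam (-γ * bExp r) 0)
  have e : (fun t => prabhakarDist (-γ * bExp r) α 0 lam fun ξ => expSup c g (t + ξ)) =
      expSup c fun v => prabSym (-γ * bExp r) α 0 lam (sline c v ^ (1 / 2 : ℂ)) * g v := by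
    ext t
    rw [expSup_add, prabhakarDist_expSup hκ hc hα hlam (hg.exp t), expSup, expSup]
    congr 1
    refine integral_congr_ae (Eventually.of_forall fun v => ?_)
    simp only [Complex.ofReal_zero, mul_zero, Complex.exp_zero, one_mul]
    ring
  rw [convDist, e, p₁termDist, volterraPrabhakarDist_expSup hκ hc hg', ← mul_assoc]
  congr 2
  ext v
  rw [← mul_assoc, termSym_mul_prabSym hκ hα hlam γ r (hw v)]

end DistributedOrder
end

noncomputable section
namespace DistributedOrder

open Complex (I)
open scoped FourierTransform SchwartzMap

/-! ### Test functions as superpositions of exponentials -/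

theorem exists_decay_eq_expSup {φ : ℝ → ℝ} (hφ : IsTest φ) (c : ℝ) :
    ∃ g, Decay c g ∧ φ = expSup c g := by
  have hsm : ContDiff ℝ ∞ fun t : ℝ => ((Real.exp (c * t) * φ t : ℝ) : ℂ) :=
    Complex.ofRealCLM.contDiff.comp ((Real.contDiff_exp.comp (by fun_prop)).mul hφ.1)
  have hcs : HasCompactSupport fun t : ℝ => ((Real.exp (c * t) * φ t : ℝ) : ℂ) :=
    HasCompactSupport.comp_left (g := fun x : ℝ => (x : ℂ)) hφ.2.mul_left Complex.ofReal_zero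
  set ψ : 𝓢(ℝ, ℂ) := hcs.toSchwartzMap hsm
  set Ψ : 𝓢(ℝ, ℂ) := 𝓕 ψ with hΨ
  refine ⟨Ψ, ⟨Ψ.continuous.aestronglyMeasurable, fun n => ?_⟩, ?_⟩
  · have h1 := (Ψ.integrable_pow_mul volume 0)
    have h2 := (Ψ.integrable_pow_mul volume n)
    refine Integrable.mono' ((h1.const_mul (2 ^ (n - 1) * |c| ^ n)).add
      (h2.const_mul (2 ^ (n - 1) * (2 * Real.pi) ^ n))) ?_ (Eventually.of_forall fun v => ?_)
    · exact (((continuous_sline c).norm.pow n).mul Ψ.continuous.norm).aestronglyMeasurable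
    · have h3 : ‖sline c v‖ ≤ |c| + 2 * Real.pi * ‖v‖ := by
        refine (norm_sub_le _ _).trans_eq ?_
        simp [abs_of_pos Real.pi_pos]
      rw [norm_mul, norm_norm, norm_pow, norm_norm]
      have h4 : ‖sline c v‖ ^ n ≤ 2 ^ (n - 1) * (|c| ^ n + (2 * Real.pi * ‖v‖) ^ n) :=
        (pow_le_pow_left₀ (norm_nonneg _) h3 n).trans (add_pow_le (abs_nonneg _)
          (by have := Real.pi_pos; positivity) n)
      refine (mul_le_mul_of_nonneg_right h4 (norm_nonneg _)).trans_eq ?_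
      simp only [Pi.add_apply]
      rw [mul_pow]; ring
  · ext t
    have h1 : (ψ t : ℂ) = ∫ v : ℝ, Complex.exp (↑(2 * Real.pi * v * t) * I) * Ψ v := by
      have h2 : 𝓕⁻ Ψ = ψ := FourierTransform.fourierInv_fourier_eq ψ
      rw [← h2, SchwartzMap.fourierInv_coe, Real.fourierInv_eq']
      refine integral_congr_ae (Eventually.of_forall fun v => ?_)
      simp only [smul_eq_mul]
      congr 3
      simp only [RCLike.inner_apply, conj_trivial]
      push_cast; ring
    have h3 : (ψ t : ℂ) = ((Real.exp (c * t) * φ t : ℝ) : ℂ) := rfl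
    have h4 : ((φ t : ℝ) : ℂ) = ∫ v : ℝ, Complex.exp (-sline c v * t) * Ψ v := by
      have h5 : ((φ t : ℝ) : ℂ) = ((Real.exp (-c * t) : ℝ) : ℂ) * ψ t := by
        rw [h3, ← Complex.ofReal_mul, ← mul_assoc, ← Real.exp_add]
        simp
      rw [h5, h1, ← integral_const_mul]
      refine integral_congr_ae (Eventually.of_forall fun v => ?_)
      simp only
      rw [← mul_assoc, Complex.ofReal_exp, ← Complex.exp_add]
      congr 2
      simp only [sline]; push_cast; ring
    rw [expSup, ← h4, Complex.ofReal_re]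

/-! ### The product of the multipliers as a function of time -/

variable {κ N c : ℝ} {h : ℂ → ℂ}

theorem continuous_mul_of_tsupport {f φ : ℝ → ℝ} (hf : ContinuousOn f (Ioi 0)) (hφ : Continuous φ)
    (hs : tsupport φ ⊆ Ioi 0) : Continuous fun t => f t * φ t :=
  (hf.mul hφ.continuousOn).continuous_of_tsupport_subset isOpen_Ioi
    ((tsupport_mul_subset_right).trans hs)

theorem integral_contour_sq_mul (hκ : 0 < κ) (hh : Adm κ N h) {φ : ℝ → ℝ} (hφ : IsTest φ)
    (hs : tsupport φ ⊆ Ioi 0) :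
    ∫ t in Ioi (0 : ℝ), (contour κ (fun w => w ^ 2 * h w) t).re * φ t =
      -∫ t in Ioi (0 : ℝ), (contour κ h t).re * deriv φ t := by
  have hsq : Adm κ 2 fun w : ℂ => w ^ 2 := by
    refine (Adm.cpow hκ 2).congr hκ fun w _ => ?_
    rw [← Complex.cpow_natCast]; norm_num
  have hf : ContinuousOn (fun t => (contour κ h t).re) (Ioi 0) :=
    Complex.continuous_re.comp_continuousOn (hh.continuousOn_contour hκ)
  have hf' : ContinuousOn (fun t => (contour κ (fun w => w ^ 2 * h w) t).re) (Ioi 0) :=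
    Complex.continuous_re.comp_continuousOn ((hsq.mul hκ hh).continuousOn_contour hκ)
  have hs' : tsupport (deriv φ) ⊆ Ioi 0 := (tsupport_deriv_subset).trans hs
  have c0 := continuous_mul_of_tsupport hf hφ.continuous hs
  have c1 := continuous_mul_of_tsupport hf' hφ.continuous hs
  have c2 := continuous_mul_of_tsupport hf hφ.deriv.continuous hs'
  have i1 := c1.integrable_of_hasCompactSupport (μ := volume) hφ.2.mul_left
  have i2 := c2.integrable_of_hasCompactSupport (μ := volume) hφ.deriv.2.mul_left
  have key := integral_Ioi_of_hasDerivAt_of_tendsto (m := 0) (a := 0)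
    (f := fun t => (contour κ h t).re * φ t)
    (f' := fun t => (contour κ (fun w => w ^ 2 * h w) t).re * φ t + (contour κ h t).re * deriv φ t)
    c0.continuousAt.continuousWithinAt (fun t ht => ?_) (i1.add i2).integrableOn
    ((hφ.2.mul_left (f := fun t => (contour κ h t).re)).is_zero_at_infty.mono_left
      atTop_le_cocompact)
  · rw [integral_add i1.integrableOn i2.integrableOn] at key
    have h0 : φ 0 = 0 := image_eq_zero_of_notMem_tsupport fun h => lt_irrefl (0 : ℝ) (hs h)
    rw [h0, mul_zero, sub_zero] at key
    linarith
  · exact (Complex.reCLM.hasFDerivAt.comp_hasDerivAt t (hh.hasDerivAt_contour hκ ht)).mul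
      (hφ.hasDerivAt t)

theorem integral_contour_pow_mul (hκ : 0 < κ) (m : ℕ) (hh : Adm κ N h) {φ : ℝ → ℝ} (hφ : IsTest φ)
    (hs : tsupport φ ⊆ Ioi 0) :
    ∫ t in Ioi (0 : ℝ), (contour κ (fun w => (w ^ 2) ^ m * h w) t).re * φ t =
      (-1) ^ m * ∫ t in Ioi (0 : ℝ), (contour κ h t).re * iteratedDeriv m φ t := by
  induction m generalizing φ with
  | zero => simp
  | succ m ih =>
    have hsq : Adm κ (2 * m) fun w : ℂ => (w ^ 2) ^ m := by
      refine (Adm.cpow hκ (2 * m)).congr hκ fun w _ => ?_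
      rw [← pow_mul, ← Complex.cpow_natCast]
      push_cast; rfl
    have h1 := integral_contour_sq_mul hκ (hsq.mul hκ hh) hφ hs
    have h2 : (fun w : ℂ => (w ^ 2) ^ (m + 1) * h w) = fun w => w ^ 2 * ((w ^ 2) ^ m * h w) := by
      ext w; ring
    rw [h2, h1, ih hφ.deriv ((tsupport_deriv_subset).trans hs), ← iteratedDeriv_succ']
    ring

theorem integral_contour_mul_expSup (hκ : 1 < κ) (hc : κ ^ 2 < c) {δ : ℝ} (hδ : 0 < δ)
    (hh : Adm κ (-δ) h) {g : ℝ → ℂ} (hg : Decay c g) (hreal : ConjSym κ h) :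
    ∫ t in Ioi (0 : ℝ), (contour κ h t).re * expSup c g t =
      expSup c (fun v => h (sline c v ^ (1 / 2 : ℂ)) * g v) 0 := by
  have hκ0 : 0 < κ := one_pos.trans hκ
  have hc0 : 0 < c := by nlinarith
  rw [integral_mul_expSup hg (hh.laplace_contour_re hκ0 hδ hc).1, expSup]
  congr 1
  refine integral_congr_ae (Eventually.of_forall fun v => ?_)
  obtain ⟨κ', hκ', hκ2⟩ : ∃ κ' : ℝ, κ < κ' ∧ κ' ^ 2 ≤ c :=
    ⟨√c, Real.lt_sqrt_of_sq_lt hc, (Real.sq_sqrt hc0.le).le⟩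
  have hw := sqrt_sline hc0 (hκ0.trans hκ') hκ2 v
  have h1 := (hh.laplace_contour hκ0 hδ (hκ'.trans_le hw)
    (by rwa [sqrt_sline_sq hc0, sline_re])).2
  rw [sqrt_sline_sq hc0] at h1
  simp only [Complex.ofReal_zero, mul_zero, Complex.exp_zero, one_mul]
  rw [← h1]
  congr 1
  refine integral_congr_ae (Eventually.of_forall fun t => ?_)
  simp only
  rw [contour_conj (fun y => hreal _ (by simp)), mul_comm]

theorem integral_contour_mul_expSup_of_tsupport (hκ : 1 < κ) (hc : κ ^ 2 < c) (hh : Adm κ N h)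
    (hreal : ConjSym κ h) {g : ℝ → ℂ} (hg : Decay c g) (hφ : IsTest (expSup c g))
    (hs : tsupport (expSup c g) ⊆ Ioi 0) :
    ∫ t in Ioi (0 : ℝ), (contour κ h t).re * expSup c g t =
      expSup c (fun v => h (sline c v ^ (1 / 2 : ℂ)) * g v) 0 := by
  have hκ0 : 0 < κ := one_pos.trans hκ
  have hc0 : 0 < c := by nlinarith
  obtain ⟨m, hm⟩ := exists_nat_gt N
  have hpow : Adm κ (-2 * m) fun w : ℂ => ((w ^ 2) ^ m)⁻¹ := by
    refine (Adm.cpow hκ0 (-2 * m)).congr hκ0 fun w _ => ?_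
    rw [← pow_mul, ← Complex.cpow_natCast, ← Complex.cpow_neg]
    congr 1; push_cast; ring
  have hm0 : (0 : ℝ) ≤ m := Nat.cast_nonneg m
  have hAdm := hpow.mul hκ0 hh
  have hlt : 0 < 2 * m - N := by linarith
  rw [show (-2 * (m : ℝ) + N) = -(2 * m - N) by ring] at hAdm
  have hreal' : ConjSym κ fun w => ((w ^ 2) ^ m)⁻¹ * h w := fun w hw => by
    rw [map_mul, ← hreal w hw]; simp
  have e : ∀ t, contour κ h t = contour κ (fun w => (w ^ 2) ^ m * (((w ^ 2) ^ m)⁻¹ * h w)) t :=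
    fun t => contour_congr (fun y => by
      have h0 : ((κ : ℂ) + y * I) ≠ 0 := ne_zero_of_re hκ0 (by simp)
      field_simp) t
  simp_rw [e]
  rw [integral_contour_pow_mul hκ0 m hAdm hφ hs, iteratedDeriv_expSup hc0.le hg,
    integral_contour_mul_expSup hκ hc hlt hAdm (hg.sline_pow m) hreal', expSup, expSup,
    ← Complex.re_ofReal_mul, ← integral_const_mul]
  congr 1
  refine integral_congr_ae (Eventually.of_forall fun v => ?_)
  have h0 : sline c v ≠ 0 := fun h => by
    have := sline_re c v
    rw [h] at this; simp at this; linarith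
  have h1 : ((((-1) ^ m : ℝ)) : ℂ) * (-1) ^ m = 1 := by
    push_cast
    rw [← mul_pow]; simp
  have h2 : sline c v ^ m ≠ 0 := pow_ne_zero _ h0
  simp only [Complex.ofReal_zero, mul_zero, Complex.exp_zero, one_mul]
  rw [sqrt_sline_sq hc0, neg_pow (sline c v)]
  field_simp
  linear_combination (h (sline c v ^ (1 / 2 : ℂ)) * g v) * h1

variable {α lam : ℝ}

theorem eqOnPos_convDist (hκ : 1 < κ) (hα : 0 ≤ α) (hlam : |lam| * κ ^ (-2 * α) < 1) (γ B : ℝ)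
    (r : ℕ) (x : ℝ) :
    EqOnPos (convDist (p₁termDist B r x) (prabhakarDist (-γ * bExp r) α 0 lam))
      fun t => coeff B r x * Real.Gamma (bExp r) * (contour κ (termSym α γ lam r) t).re := by
  have hκ0 : 0 < κ := one_pos.trans hκ
  have hA := adm_termSym hκ hα hlam γ r
  refine ⟨continuousOn_const.mul
    (Complex.continuous_re.comp_continuousOn (hA.continuousOn_contour hκ0)), fun φ hφ hs => ?_⟩
  have hc : κ ^ 2 < κ ^ 2 + 1 := by linarith
  obtain ⟨g, hg, rfl⟩ := exists_decay_eq_expSup hφ (κ ^ 2 + 1)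
  rw [convDist_expSup hκ hc.le hα hlam hg, ← integral_contour_mul_expSup_of_tsupport hκ hc hA
    (conjSym_termSym hκ hα hlam γ r) hg hφ hs, ← integral_const_mul]
  simp_rw [mul_assoc]

theorem exists_large (hα : 0 < α) (lam : ℝ) : ∃ κ : ℝ, 1 < κ ∧ |lam| * κ ^ (-2 * α) < 1 := by
  have h1 : Tendsto (fun κ : ℝ => |lam| * κ ^ (-(2 * α))) atTop (𝓝 (|lam| * 0)) :=
    (tendsto_rpow_neg_atTop (by positivity)).const_mul _
  rw [mul_zero] at h1
  obtain ⟨κ, h2, h3⟩ := ((h1.eventually (gt_mem_nhds one_pos)).and (eventually_gt_atTop 1)).exists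
  exact ⟨κ, h3, by rwa [neg_mul]⟩

end DistributedOrder
end

open DistributedOrder
theorem mainTheorem1 (B : ℝ) (hB : 0 < B) :
    (∃ p₁ : ℝ → ℝ → ℝ,
      IsFundamentalSolution k₁ B p₁ ∧ IsInverseLaplace k₁ B p₁ ∧
      ∀ x t : ℝ, 0 < t → HasSum (fun r : ℕ => p₁term B r x t) (p₁ x t)) ∧
    ∀ α γ lam : ℝ, 0 < α → α < 1 → 0 < γ → γ < 1 → 0 < lam →
      ∃ p₂ : ℝ → ℝ → ℝ,
        IsFundamentalSolution (k₂ α γ lam) B p₂ ∧ IsInverseLaplace (k₂ α γ lam) B p₂ ∧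
        ∃ c : ℕ → ℝ → ℝ → ℝ,
          (∀ r x, EqOnPos (convDist (p₁termDist B r x) (prabhakarDist (-γ * bExp r) α 0 lam))
            (c r x)) ∧
          ∀ x t : ℝ, 0 < t → HasSum (fun r : ℕ => c r x t) (p₂ x t) := by
  constructor
  · have hκ : (1 : ℝ) < 2 := one_lt_two
    have hκ0 : (0 : ℝ) < 2 := two_pos
    have hl : |(0 : ℝ)| * 2 ^ (-2 * (1 : ℝ)) < 1 := by simp
    have hR := waveSym_rootSym hB hκ zero_le_one le_rfl le_rfl hl le_rfl one_pos
    have hk := kernelSym_k₂ hB hκ zero_le_one le_rfl hl le_rfl one_pos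
    rw [k₁_eq_k₂]
    refine ⟨_, isFundamentalSolution_of_kernelSym hκ0 hR hk,
      isInverseLaplace_of_kernelSym hκ0 hB hR hk, fun x t ht => ?_⟩
    simp_rw [p₁term_eq hκ B _ x ht]
    exact hasSum_waveSol hB hκ zero_le_one le_rfl le_rfl hl le_rfl one_pos x ht
  · intro α γ lam hα hα1 hγ hγ1 hlam
    obtain ⟨κ, hκ, hl⟩ := exists_large hα lam
    have hκ0 : 0 < κ := one_pos.trans hκ
    have hR := waveSym_rootSym hB hκ hα.le hα1.le hlam.le hl hγ.le hγ1
    have hk := kernelSym_k₂ hB hκ hα.le hlam.le hl hγ.le hγ1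
    exact ⟨_, isFundamentalSolution_of_kernelSym hκ0 hR hk,
      isInverseLaplace_of_kernelSym hκ0 hB hR hk, _,
      fun r x => eqOnPos_convDist hκ hα.le hl γ B r x,
      fun x t ht => hasSum_waveSol hB hκ hα.le hα1.le hlam.le hl hγ.le hγ1 x ht⟩
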